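/- For integers $a_1,\dots,a_n$ ($n\ge 1$) let $P(a_1,\dots,a_n)$ be the unoriented pretzel link diagram formed by $n$ vertical columns of two strands placed side by side, the two strands of the $i$-th column twisting around each other with $|a_i|$ crossings whose kind is given by the sign of $a_i$; at the top and at the bottom the right strand of each column is joined to the left strand of the next one, and the left strand of the first column is joined to the right strand of the last one by an outer arc. An oriented pretzel link is an oriented link having a diagram which, after forgetting the orientation, is some $P(a_1,\dots,a_n)$. Let $V(L)$ denote the Jones polynomial of an oriented link $L$, normalized by $V(\text{unknot})=-t^{-1/2}-t^{1/2}$; that is, $V(L)=(-A)^{-3w(D)}\langle D\rangle$ with $A=t^{-1/4}$ for any oriented diagram $D$ of $L$, where $w(D)$ is the writhe and $\langle D\rangle$ is the Kauffman bracket with $\langle\text{unknot diagram without crossings}\rangle=-A^{-2}-A^{2}$. The span of $V(L)$ is its highest exponent of $t$ minus its lowest exponent of $t$. **Theorem 4.3.** For every natural number $S$ there are, up to isotopy, only finitely many oriented pretzel links $L$ such that $V(L)$ has span $S$. -/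

import Mathlib

namespace PretzelJones

open LaurentPolynomial

/-! ## Link diagrams

A link diagram in the plane, put in general position with respect to the height function, is cut by
horizontal lines into slices, each of which contains exactly one minimum (`cup`), one maximum
(`cap`) or one crossing, all other strands in the slice being vertical.  A diagram is thus the list
of its slices, read from the bottom to the top. -/

/-- The nontrivial part of a slice.  A minimum carries a label in `α`: `α = Unit` for unoriented
diagrams, `α = Bool` for oriented ones.  A crossing is made of a strand `/` and a strand `\`, and
its argument is `true` if `/` passes over `\` and `false` if `\` passes over `/`. -/
inductive Piece (α : Type) : Type
  | cup (a : α)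
  | cap
  | cross (o : Bool)

/-- A slice: its nontrivial part, and the number `pos` of vertical strands to the left of it. -/
structure Slice (α : Type) : Type where
  pos : ℕ
  piece : Piece α

/-- Number of strand ends at the bottom of a piece. -/
def Piece.bot {α : Type} : Piece α → ℕ
  | .cup _ => 0
  | .cap => 2
  | .cross _ => 2

/-- Number of strand ends at the top of a piece. -/
def Piece.top {α : Type} : Piece α → ℕ
  | .cup _ => 2
  | .cap => 0
  | .cross _ => 2

/-- The strands just above a slice, as a list of their directions from left to right (`true` means
upwards), given the list of those just below it.  The label of an oriented minimum is the direction
of its left leg.  The value is `none` if the slice does not fit on these strands, in particular if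
the two strands that meet in a maximum are not oppositely directed. -/
def Slice.act (s : Slice Bool) (l : List Bool) : Option (List Bool) :=
  match s.piece with
  | .cup b => if s.pos ≤ l.length then some (l.take s.pos ++ b :: (!b) :: l.drop s.pos) else none
  | .cap =>
    match l.drop s.pos with
    | x :: y :: r => if y = !x then some (l.take s.pos ++ r) else none
    | _ => none
  | .cross _ =>
    match l.drop s.pos with
    | x :: y :: r => some (l.take s.pos ++ y :: x :: r)
    | _ => none

/-- The strands above a list of slices, given those below it. -/
def run : List (Slice Bool) → List Bool → Option (List Bool)
  | [], l => some l
  | s :: w, l => (s.act l).bind (run w)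

/-- Oriented link diagrams: the slices fit together, starting and ending with no strands. -/
def OrientedDiagram : Type := {w : List (Slice Bool) // run w [] = some []}

/-- The unoriented diagram underlying an oriented one. -/
def forget (w : List (Slice Bool)) : List (Slice Unit) :=
  w.map fun s => ⟨s.pos, match s.piece with
    | .cup _ => .cup ()
    | .cap => .cap
    | .cross o => .cross o⟩

/-! ## Isotopy -/

/-- The local moves on diagrams: the planar isotopies `exchange`, `zigzag`, `slide` (two distant
pieces exchange heights; a minimum and a maximum cancel; a minimum or a maximum is pushed through a
strand that crosses one of its legs) and the three Reidemeister moves. -/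
inductive Move : List (Slice Bool) → List (Slice Bool) → Prop
  | exchange (p q : Piece Bool) (i j : ℕ) (h : i ≤ j) :
      Move [⟨i, p⟩, ⟨j + p.top, q⟩] [⟨j + p.bot, q⟩, ⟨i, p⟩]
  | zigzag_left (i : ℕ) (b : Bool) : Move [⟨i, .cup b⟩, ⟨i + 1, .cap⟩] []
  | zigzag_right (i : ℕ) (b : Bool) : Move [⟨i + 1, .cup b⟩, ⟨i, .cap⟩] []
  | slide_cup (i : ℕ) (b o : Bool) :
      Move [⟨i, .cup b⟩, ⟨i + 1, .cross o⟩] [⟨i + 1, .cup b⟩, ⟨i, .cross (!o)⟩]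
  | slide_cap (i : ℕ) (o : Bool) :
      Move [⟨i + 1, .cross o⟩, ⟨i, .cap⟩] [⟨i, .cross (!o)⟩, ⟨i + 1, .cap⟩]
  | reidemeister_one_right (i : ℕ) (b o : Bool) :
      Move [⟨i + 1, .cup b⟩, ⟨i, .cross o⟩, ⟨i + 1, .cap⟩] []
  | reidemeister_one_left (i : ℕ) (b o : Bool) :
      Move [⟨i, .cup b⟩, ⟨i + 1, .cross o⟩, ⟨i, .cap⟩] []
  | reidemeister_two (i : ℕ) (o : Bool) : Move [⟨i, .cross o⟩, ⟨i, .cross (!o)⟩] []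
  | reidemeister_three (i : ℕ) (o : Bool) :
      Move [⟨i, .cross o⟩, ⟨i + 1, .cross o⟩, ⟨i, .cross o⟩]
        [⟨i + 1, .cross o⟩, ⟨i, .cross o⟩, ⟨i + 1, .cross o⟩]

/-- Two oriented diagrams differ by one local move, applied to consecutive slices. -/
def Step (D E : OrientedDiagram) : Prop :=
  ∃ u v x y : List (Slice Bool), Move x y ∧ D.1 = u ++ x ++ v ∧ E.1 = u ++ y ++ v

/-- Oriented links up to isotopy: oriented diagrams modulo the equivalence relation generated by the
local moves. -/
def OrientedLink : Type := Quot Step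

/-- The oriented link represented by an oriented diagram. -/
def OrientedDiagram.link (D : OrientedDiagram) : OrientedLink := Quot.mk Step D

/-! ## Kauffman bracket and Jones polynomial -/

/-- All the states of an unoriented diagram: every crossing is smoothed in one of the two possible
ways, `)(` (the slice is deleted) or a maximum below a minimum.  A state is recorded as the pair of
the number of `A`-smoothings minus the number of `A⁻¹`-smoothings, and the resulting diagram without
crossings.  For a crossing with `/` over `\` the `A`-smoothing is `)(`; for a crossing with `\` over
`/` it is the other one. -/
def states : List (Slice Unit) → List (ℤ × List (Slice Unit))
  | [] => [(0, [])]
  | ⟨i, .cross o⟩ :: w =>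
      (states w).map (fun σ => (σ.1 + (if o then 1 else -1), σ.2)) ++
      (states w).map (fun σ => (σ.1 + (if o then -1 else 1), ⟨i, .cap⟩ :: ⟨i, .cup ()⟩ :: σ.2))
  | s :: w => (states w).map (fun σ => (σ.1, s :: σ.2))

/-- The number of closed curves that are completed in a list of slices without crossings.  The list
`l` has one entry for each strand below these slices, two entries being equal if and only if the
strands are connected further below; `m` is larger than every entry. -/
def loopsAux : List (Slice Unit) → List ℕ → ℕ → ℕ
  | [], _, _ => 0
  | ⟨i, .cup _⟩ :: w, l, m => loopsAux w (l.take i ++ m :: m :: l.drop i) (m + 1)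
  | ⟨i, .cap⟩ :: w, l, m =>
    match l.drop i with
    | x :: y :: r =>
      if x = y then loopsAux w (l.take i ++ r) m + 1
      else loopsAux w ((l.take i ++ r).map fun z => if z = y then x else z) m
    | _ => 0
  | ⟨_, .cross _⟩ :: w, l, m => loopsAux w l m

/-- The number of closed curves of a diagram without crossings. -/
def loops (w : List (Slice Unit)) : ℕ := loopsAux w [] 0

/-- `δ = -A⁻² - A²`. -/
noncomputable def delta : LaurentPolynomial ℤ := -T (-2) - T 2

/-- The Kauffman bracket, in the variable `A`, normalized to be `δ` on the unknot diagram without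
crossings. -/
noncomputable def bracket (w : List (Slice Unit)) : LaurentPolynomial ℤ :=
  ((states w).map fun σ => T σ.1 * delta ^ loops σ.2).sum

/-- The sum of the signs of the crossings in a list of slices, given the directions of the strands
below it.  A crossing with `/` over `\` is positive if its strands are both directed upwards or both
directed downwards. -/
def writheAux : List (Slice Bool) → List Bool → ℤ
  | [], _ => 0
  | s :: w, l =>
    (match s.piece, l.drop s.pos with
      | .cross o, x :: y :: _ => (if o then 1 else -1) * (if x = y then 1 else -1)
      | _, _ => 0) +
    (match s.act l with
      | some l' => writheAux w l'
      | none => 0)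

/-- The writhe of an oriented diagram. -/
def OrientedDiagram.writhe (D : OrientedDiagram) : ℤ := writheAux D.1 []

/-- The Jones polynomial computed from an oriented diagram `D`, normalized to be `-t^(-1/2)-t^(1/2)`
on the unknot: `(-A)^(-3 w(D)) ⟨D⟩` after the substitution `A = t^(-1/4)`.  It is an element of the
ring of polynomials in rational powers of `t`. -/
noncomputable def OrientedDiagram.jones (D : OrientedDiagram) : AddMonoidAlgebra ℤ ℚ :=
  AddMonoidAlgebra.mapDomain (fun k : ℤ => -(k : ℚ) / 4)
    (C ((Int.negOnePow (-3 * D.writhe) : ℤˣ) : ℤ) * T (-3 * D.writhe) * bracket (forget D.1))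

/-- `V` is the Jones polynomial of the oriented link `L`: it is computed from a diagram of `L`. -/
def OrientedLink.HasJones (L : OrientedLink) (V : AddMonoidAlgebra ℤ ℚ) : Prop :=
  ∃ D : OrientedDiagram, D.link = L ∧ D.jones = V

/-- The span of `V`, i.e. its highest exponent minus its lowest one, is `s` (and `V ≠ 0`). -/
def HasSpan (V : AddMonoidAlgebra ℤ ℚ) (s : ℚ) : Prop :=
  ∃ lo hi : ℚ, IsLeast {q : ℚ | V.coeff q ≠ 0} lo ∧ IsGreatest {q : ℚ | V.coeff q ≠ 0} hi ∧ hi - lo = s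

/-! ## Pretzel links -/

/-- The `k`-th column (`k = 0, 1, …`) of a pretzel diagram: `|a|` crossings of its two strands, one
above the other, of the kind given by the sign of `a`. -/
def column (k : ℕ) (a : ℤ) : List (Slice Unit) :=
  List.replicate a.natAbs ⟨2 * k, .cross (decide (0 < a))⟩

/-- The columns `a₁, …, aₙ`, numbered from `k` on, from left to right. -/
def columns : ℕ → List ℤ → List (Slice Unit)
  | _, [] => []
  | k, a :: as => column k a ++ columns (k + 1) as

/-- The pretzel diagram `P(a₁, …, aₙ)`: there are `n` columns of two strands each; at the bottom as
well as at the top, the right strand of every column is joined to the left strand of the next one,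
and the left strand of the first column is joined to the right strand of the last one by an outer
arc. -/
def pretzel (a : List ℤ) : List (Slice Unit) :=
  ⟨0, .cup ()⟩ :: (List.range (a.length - 1)).map (fun k => ⟨2 * k + 1, .cup ()⟩) ++
  columns 0 a ++
  ((List.range (a.length - 1)).reverse.map (fun k => ⟨2 * k + 1, .cap⟩) ++ [⟨0, .cap⟩])

/-- An oriented link is a pretzel link if it has a diagram which is, after forgetting the
orientation, a pretzel diagram `P(a₁, …, aₙ)`, `n ≥ 1`. -/
def OrientedLink.IsPretzel (L : OrientedLink) : Prop :=
  ∃ (D : OrientedDiagram) (a : List ℤ), a ≠ [] ∧ D.link = L ∧ forget D.1 = pretzel a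

end PretzelJones

namespace PretzelJones

open LaurentPolynomial

/-! ## Actions of slices on lists of directions -/

/-! Only finitely many lists of columns have to be considered: every pretzel diagram is isotopic to
`pretzel l` with `l` satisfying `Reduced`, and the span bounds the length and the entries of such an
`l` (`Reduced.bound`). A fixed unoriented diagram has finitely many orientations
(`finite_forget_eq`), so finitely many links remain.

Reduction (`exists_reduced`). A column `±1` commutes with its neighbours by a flype (`Iso.flype`),
so columns `1` and `-1` cancel as soon as a third column is present, and a column `0` swallows a
column `±1` as a curl. One column gives the unknot, and two columns `a, b` can be merged into `0, a
+ b`. These isotopies are carried out on unoriented words by `Iso`, which lifts them to all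
orientations at once.

Bracket. A word acts on functions of the connections between strands (`ev`), and this action is
invariant under the moves up to units `±Aᵏ`. Units do not change the span, so the writhe never has
to be followed. In the variable `x = -A⁻⁴`, with `κ = δ² - 1 = 1 - x - x⁻¹`, the bracket of `n`
columns times `δⁿ` is, up to a unit, `∏ (x^aᵢ + κ) + κ ∏ (x^aᵢ - 1)` (`ev_closure`). As `δⁿ` has
width `4n` in `A`, span `S` means that this polynomial (`pretzelPoly`) has width `S + n` in `x`.

Bounds. If some column is `0`, the second product vanishes and the width is read off from the
factors. Otherwise the columns `±1` contribute a power of `x - 1`; in the remaining factor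
`reducedPoly` the extreme terms of the two summands are compared. They can cancel, but normally the
next coefficient survives, and the width is about the sum of the `|aᵢ| + 1` over the other columns.
Deeper cancellation at one end essentially leaves one negative column `-b` and positive columns `≥
3`, of which `a`, say, is the least. Then a nonzero coefficient occurs at most `a + 3` places from
the end (`exists_polyA_sub_polyB_coeff_ne_zero`), which is harmless because a second positive column
has at least `a` crossings. -/

def shift (i : ℕ) {α : Type} (w : List (Slice α)) : List (Slice α) :=
  w.map fun s => ⟨i + s.pos, s.piece⟩

@[simp] theorem shift_nil (i : ℕ) {α : Type} : shift i ([] : List (Slice α)) = [] := rfl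

@[simp] theorem shift_cons (i : ℕ) {α : Type} (s : Slice α) (w : List (Slice α)) :
    shift i (s :: w) = ⟨i + s.pos, s.piece⟩ :: shift i w := rfl

@[simp] theorem shift_append (i : ℕ) {α : Type} (v w : List (Slice α)) :
    shift i (v ++ w) = shift i v ++ shift i w := by simp [shift]

@[simp] theorem shift_replicate (i n : ℕ) {α : Type} (s : Slice α) :
    shift i (List.replicate n s) = List.replicate n ⟨i + s.pos, s.piece⟩ := by simp [shift]

theorem shift_shift (i j : ℕ) {α : Type} (w : List (Slice α)) :
    shift i (shift j w) = shift (i + j) w := by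
  simp [shift, add_assoc]

@[simp] theorem shift_zero {α : Type} (w : List (Slice α)) : shift 0 w = w := by
  simp [shift]

/-- Total number of strand ends at the bottom of the pieces of a word. -/
def bots {α : Type} (w : List (Slice α)) : ℕ := (w.map fun s => s.piece.bot).sum

/-- Total number of strand ends at the top of the pieces of a word. -/
def tops {α : Type} (w : List (Slice α)) : ℕ := (w.map fun s => s.piece.top).sum

@[simp] theorem bots_nil {α : Type} : bots ([] : List (Slice α)) = 0 := rfl
@[simp] theorem tops_nil {α : Type} : tops ([] : List (Slice α)) = 0 := rfl
@[simp] theorem bots_cons {α : Type} (s : Slice α) (w) : bots (s :: w) = s.piece.bot + bots w := by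
  simp [bots]
@[simp] theorem tops_cons {α : Type} (s : Slice α) (w) : tops (s :: w) = s.piece.top + tops w := by
  simp [tops]
@[simp] theorem bots_append {α : Type} (v w : List (Slice α)) : bots (v ++ w) = bots v + bots w := by
  simp [bots]
@[simp] theorem tops_append {α : Type} (v w : List (Slice α)) : tops (v ++ w) = tops v + tops w := by
  simp [tops]
@[simp] theorem bots_shift {α : Type} (i : ℕ) (w : List (Slice α)) : bots (shift i w) = bots w := by
  simp [bots, shift, Function.comp_def]
@[simp] theorem tops_shift {α : Type} (i : ℕ) (w : List (Slice α)) : tops (shift i w) = tops w := by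
  simp [tops, shift, Function.comp_def]

def Piece.forget {α : Type} : Piece α → Piece Unit
  | .cup _ => .cup ()
  | .cap => .cap
  | .cross o => .cross o

@[simp] theorem Piece.bot_cup {α : Type} (a : α) : (Piece.cup a).bot = 0 := rfl
@[simp] theorem Piece.bot_cap {α : Type} : (Piece.cap : Piece α).bot = 2 := rfl
@[simp] theorem Piece.bot_cross {α : Type} (o : Bool) : (Piece.cross o : Piece α).bot = 2 := rfl
@[simp] theorem Piece.top_cup {α : Type} (a : α) : (Piece.cup a).top = 2 := rfl
@[simp] theorem Piece.top_cap {α : Type} : (Piece.cap : Piece α).top = 0 := rfl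
@[simp] theorem Piece.top_cross {α : Type} (o : Bool) : (Piece.cross o : Piece α).top = 2 := rfl

@[simp] theorem Piece.bot_forget {α : Type} (p : Piece α) : p.forget.bot = p.bot := by
  cases p <;> rfl
@[simp] theorem Piece.top_forget {α : Type} (p : Piece α) : p.forget.top = p.top := by
  cases p <;> rfl

theorem forget_eq (w : List (Slice Bool)) :
    forget w = w.map fun s => ⟨s.pos, s.piece.forget⟩ := by
  unfold forget
  congr 1
  funext s
  cases s with | mk i p => cases p <;> rfl

@[simp] theorem forget_nil : forget [] = [] := rfl
@[simp] theorem forget_cons (s w) : forget (s :: w) = ⟨s.pos, s.piece.forget⟩ :: forget w := by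
  simp [forget_eq]
@[simp] theorem forget_append (v w) : forget (v ++ w) = forget v ++ forget w := by
  simp [forget_eq]
@[simp] theorem forget_shift (i w) : forget (shift i w) = shift i (forget w) := by
  simp [forget_eq, shift]
@[simp] theorem bots_forget (w) : bots (forget w) = bots w := by
  simp [forget_eq, bots, Function.comp_def]
@[simp] theorem tops_forget (w) : tops (forget w) = tops w := by
  simp [forget_eq, tops, Function.comp_def]

theorem run_append (v w : List (Slice Bool)) (l : List Bool) :
    run (v ++ w) l = (run v l).bind (run w) := by
  induction v generalizing l with
  | nil => rfl
  | cons s v ih =>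
    simp only [List.cons_append, run]
    cases s.act l <;> simp [ih]

theorem act_prefix (i : ℕ) (p : Piece Bool) (a l : List Bool) :
    (Slice.mk (a.length + i) p).act (a ++ l) = ((Slice.mk i p).act l).map (a ++ ·) := by
  cases p with
  | cup b =>
    simp only [Slice.act, List.length_append, List.drop_length_add_append,
      List.take_length_add_append]
    by_cases h : i ≤ l.length <;> simp [h]
  | cap =>
    simp only [Slice.act, List.drop_length_add_append, List.take_length_add_append]
    rcases List.drop i l with _ | ⟨x, _ | ⟨y, r⟩⟩
    · rfl
    · rfl
    · by_cases h : y = !x <;> simp [h]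
  | cross o =>
    simp only [Slice.act, List.drop_length_add_append, List.take_length_add_append]
    rcases List.drop i l with _ | ⟨x, _ | ⟨y, r⟩⟩ <;> simp

theorem run_prefix (w : List (Slice Bool)) (a l : List Bool) :
    run (shift a.length w) (a ++ l) = (run w l).map (a ++ ·) := by
  induction w generalizing l with
  | nil => rfl
  | cons s w ih =>
    simp only [shift_cons, run, act_prefix]
    cases s.act l <;> simp [ih]

theorem act_length {s : Slice Bool} {l l' : List Bool} (h : s.act l = some l') :
    l'.length + s.piece.bot = l.length + s.piece.top ∧ s.pos + s.piece.bot ≤ l.length := by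
  obtain ⟨i, p⟩ := s
  cases p with
  | cup b =>
    simp only [Slice.act] at h
    split at h <;> simp at h
    subst h
    simp; omega
  | cap =>
    simp only [Slice.act] at h
    split at h <;> [skip; simp at h]
    rename_i x y r hr
    split at h <;> simp at h
    subst h
    have := congrArg List.length hr
    simp at this ⊢
    omega
  | cross o =>
    simp only [Slice.act] at h
    split at h <;> simp at h
    rename_i x y r hr
    subst h
    have := congrArg List.length hr
    simp at this ⊢
    omega

theorem run_length {w : List (Slice Bool)} {l l' : List Bool} (h : run w l = some l') :
    l'.length + bots w = l.length + tops w := by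
  induction w generalizing l with
  | nil => simp [run] at h; simp [h]
  | cons s w ih =>
    simp only [run, Option.bind_eq_some_iff] at h
    obtain ⟨l1, h1, h2⟩ := h
    have := ih h2
    have := (act_length h1).1
    simp; omega

/-! ## Isotopy of oriented words and of unoriented words -/

/-- The words `x` and `y` are interchangeable above strands with directions `l`. -/
def Rel (l : List Bool) (x y : List (Slice Bool)) : Prop :=
  run x l = run y l ∧ ∀ u v, run u [] = some l → ∀ hx : run (u ++ x ++ v) [] = some [],
    ∃ hy : run (u ++ y ++ v) [] = some [],
      OrientedDiagram.link ⟨u ++ x ++ v, hx⟩ = OrientedDiagram.link ⟨u ++ y ++ v, hy⟩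

theorem Rel.refl (l x) : Rel l x x := ⟨rfl, fun _ _ _ hx => ⟨hx, rfl⟩⟩

theorem Rel.run_ctx {l : List Bool} {x y : List (Slice Bool)} (h : run x l = run y l) {u v}
    (hu : run u [] = some l) : run (u ++ x ++ v) [] = run (u ++ y ++ v) [] := by
  simp [run_append, hu, h]

theorem Rel.symm {l x y} (h : Rel l x y) : Rel l y x := by
  refine ⟨h.1.symm, fun u v hu hx => ?_⟩
  have hy := hx
  rw [← Rel.run_ctx h.1 hu] at hy
  obtain ⟨_, h2⟩ := h.2 u v hu hy
  exact ⟨hy, h2.symm⟩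

theorem Rel.trans {l x y z} (h : Rel l x y) (h' : Rel l y z) : Rel l x z := by
  refine ⟨h.1.trans h'.1, fun u v hu hx => ?_⟩
  obtain ⟨hy, h2⟩ := h.2 u v hu hx
  obtain ⟨hz, h3⟩ := h'.2 u v hu hy
  exact ⟨hz, h2.trans h3⟩

theorem Rel.of_move {l x y} (m : Move x y) (h : run x l = run y l) : Rel l x y := by
  refine ⟨h, fun u v hu hx => ?_⟩
  have hy := hx
  rw [Rel.run_ctx h hu] at hy
  exact ⟨hy, Quot.sound ⟨u, v, x, y, m, rfl, rfl⟩⟩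

theorem Rel.ctx {l l' x y u} (hu : run u l = some l') (h : Rel l' x y) (v) :
    Rel l (u ++ x ++ v) (u ++ y ++ v) := by
  refine ⟨by simp [run_append, hu, h.1], fun a b ha hx => ?_⟩
  have e : ∀ z, a ++ (u ++ z ++ v) ++ b = (a ++ u) ++ z ++ (v ++ b) := by simp
  have hau : run (a ++ u) [] = some l' := by simp [run_append, ha, hu]
  have hx' := hx
  rw [e] at hx'
  obtain ⟨hy, h2⟩ := h.2 _ _ hau hx'
  simp only [e]
  exact ⟨hy, h2⟩

/-- Every orientation of `w`, placed to the right of `i` strands, above at least `n` strands, is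
isotopic to an orientation of `w'`. -/
def Half (n : ℕ) (w w' : List (Slice Unit)) : Prop :=
  ∀ i l x, i + n ≤ l.length → forget x = shift i w → (run x l).isSome →
    ∃ y, forget y = shift i w' ∧ Rel l x y

/-- The unoriented words `w` and `w'`, above at least `n` strands, have isotopic orientations. -/
def Iso (n : ℕ) (w w' : List (Slice Unit)) : Prop := Half n w w' ∧ Half n w' w

theorem Half.trans {n a b c} (h : Half n a b) (h' : Half n b c) : Half n a c := by
  intro i l x hl hx hr
  obtain ⟨y, hy, r⟩ := h i l x hl hx hr
  obtain ⟨z, hz, r'⟩ := h' i l y hl hy (r.1 ▸ hr)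
  exact ⟨z, hz, r.trans r'⟩

theorem Half.mono {n m a b} (h : Half n a b) (hm : n ≤ m) : Half m a b :=
  fun i l x hl => h i l x (by omega)

theorem Half.shift {n a b} (h : Half n a b) (k : ℕ) :
    Half (k + n) (PretzelJones.shift k a) (PretzelJones.shift k b) := by
  intro i l x hl hx hr
  rw [shift_shift] at hx
  simp only [shift_shift]
  exact h (i + k) l x (by omega) hx hr

/-- Above `u` there are `tops u - bots u` more strands than below it, so `hn` provides the strands
that `a` needs. -/
theorem Half.ctx {n m a b} (h : Half m a b) (u v : List (Slice Unit))
    (hn : m + bots u ≤ n + tops u) : Half n (u ++ a ++ v) (u ++ b ++ v) := by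
  intro i l x hl hx hr
  rw [shift_append, shift_append, forget_eq, List.map_eq_append_iff] at hx
  obtain ⟨x1, v', rfl, hx1, hv⟩ := hx
  rw [List.map_eq_append_iff] at hx1
  obtain ⟨u', x', rfl, hu, hx'⟩ := hx1
  rw [← forget_eq] at hu hv hx'
  rw [run_append, run_append] at hr
  obtain ⟨l1, h1⟩ : ∃ l1, run u' l = some l1 := by
    cases h : run u' l with
    | none => simp [h] at hr
    | some l1 => exact ⟨l1, rfl⟩
  have hr' : (run x' l1).isSome := by
    cases h : run x' l1 with
    | none => simp [h, h1] at hr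
    | some l1 => rfl
  have hlen := run_length h1
  have eb : bots u' = bots u := by rw [← bots_forget, hu, bots_shift]
  have et : tops u' = tops u := by rw [← tops_forget, hu, tops_shift]
  obtain ⟨y, hy, r⟩ := h i l1 x' (by omega) hx' hr'
  exact ⟨u' ++ y ++ v', by simp [hu, hy, hv], r.ctx h1 v'⟩

theorem Iso.refl (n w) : Iso n w w :=
  ⟨fun _ _ x _ hx _ => ⟨x, hx, Rel.refl _ _⟩, fun _ _ x _ hx _ => ⟨x, hx, Rel.refl _ _⟩⟩

theorem Iso.symm {n a b} (h : Iso n a b) : Iso n b a := ⟨h.2, h.1⟩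

theorem Iso.trans {n a b c} (h : Iso n a b) (h' : Iso n b c) : Iso n a c :=
  ⟨h.1.trans h'.1, h'.2.trans h.2⟩

theorem Iso.mono {n m a b} (h : Iso n a b) (hm : n ≤ m) : Iso m a b := ⟨h.1.mono hm, h.2.mono hm⟩

theorem Iso.shift {n a b} (h : Iso n a b) (k : ℕ) :
    Iso (k + n) (PretzelJones.shift k a) (PretzelJones.shift k b) := ⟨h.1.shift k, h.2.shift k⟩

theorem Iso.ctx {n m a b} (h : Iso m a b) (u v : List (Slice Unit))
    (hn : m + bots u ≤ n + tops u) : Iso n (u ++ a ++ v) (u ++ b ++ v) :=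
  ⟨h.1.ctx u v hn, h.2.ctx u v hn⟩

/-- Two diagrams that are interchangeable with arbitrary orientations give the same links. -/
theorem Iso.link {w w' : List (Slice Unit)} (h : Iso 0 w w') (D : OrientedDiagram)
    (hD : forget D.1 = w) : ∃ E : OrientedDiagram, forget E.1 = w' ∧ E.link = D.link := by
  obtain ⟨x, hx⟩ := D
  obtain ⟨y, hy, r⟩ := h.1 0 [] x (by simp) (by simpa using hD) (by simp [hx])
  obtain ⟨h1, h2⟩ := r.2 [] [] rfl (by simpa using hx)
  refine ⟨⟨y, by simpa using h1⟩, by simpa using hy, ?_⟩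
  simpa using h2.symm

/-! ## The unoriented moves -/

theorem exists_shift {i : ℕ} {w : List (Slice Unit)} {x : List (Slice Bool)}
    (hx : forget x = shift i w) : ∃ x', x = shift i x' ∧ forget x' = w := by
  induction x generalizing w with
  | nil =>
    cases w with
    | nil => exact ⟨[], rfl, rfl⟩
    | cons t w => simp at hx
  | cons s x ih =>
    cases w with
    | nil => simp at hx
    | cons t w =>
      simp only [forget_cons, shift_cons, List.cons.injEq] at hx
      obtain ⟨x', rfl, rfl⟩ := ih hx.2
      obtain ⟨j, p⟩ := s
      obtain ⟨k, q⟩ := t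
      simp only [Slice.mk.injEq] at hx
      exact ⟨⟨k, p⟩ :: x', by simp [hx.1.1], by simp [hx.1.2]⟩

theorem run_shift (i : ℕ) (w : List (Slice Bool)) (l : List Bool) (h : i ≤ l.length) :
    run (shift i w) l = (run w (l.drop i)).map (l.take i ++ ·) := by
  have := run_prefix w (l.take i) (l.drop i)
  rwa [List.take_append_drop, List.length_take_of_le h] at this

/-- Strands to the left take no part, so a single move can be checked at position `0`. Either
direction of the move is allowed, since isotopy is symmetric. -/
theorem Half.of_zero {n w w'}
    (h : ∀ l x, n ≤ l.length → forget x = w → (run x l).isSome →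
      ∃ y, forget y = w' ∧ run x l = run y l ∧
        ((∀ i, Move (PretzelJones.shift i x) (PretzelJones.shift i y)) ∨
          ∀ i, Move (PretzelJones.shift i y) (PretzelJones.shift i x))) : Half n w w' := by
  intro i l x hl hx hr
  obtain ⟨x, rfl, hx'⟩ := exists_shift hx
  have hi : i ≤ l.length := by omega
  rw [run_shift i x l hi, Option.isSome_map] at hr
  obtain ⟨y, hy, e, m⟩ := h (l.drop i) x (by simp; omega) hx' hr
  have e' : run (PretzelJones.shift i x) l = run (PretzelJones.shift i y) l := by
    rw [run_shift i x l hi, run_shift i y l hi, e]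
  refine ⟨PretzelJones.shift i y, by simp [hy], ?_⟩
  rcases m with m | m
  · exact Rel.of_move (m i) e'
  · exact (Rel.of_move (m i) e'.symm).symm

theorem forget_eq_cons {x : List (Slice Bool)} {i : ℕ} {p : Piece Unit} {w} :
    forget x = ⟨i, p⟩ :: w ↔ ∃ p' x', x = ⟨i, p'⟩ :: x' ∧ p'.forget = p ∧ forget x' = w := by
  constructor
  · intro h
    cases x with
    | nil => simp at h
    | cons s x =>
      obtain ⟨j, q⟩ := s
      simp only [forget_cons, List.cons.injEq, Slice.mk.injEq] at h
      obtain ⟨⟨rfl, rfl⟩, rfl⟩ := h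
      exact ⟨q, x, rfl, rfl, rfl⟩
  · rintro ⟨p', x', rfl, rfl, rfl⟩
    simp

theorem forget_eq_nil {x : List (Slice Bool)} : forget x = [] ↔ x = [] := by
  simp [forget_eq]

theorem Piece.forget_eq_cup {p : Piece Bool} {a : Unit} :
    p.forget = .cup a ↔ ∃ b, p = .cup b := by
  cases p <;> simp [Piece.forget]

theorem Piece.forget_eq_cap {p : Piece Bool} : p.forget = .cap ↔ p = .cap := by
  cases p <;> simp [Piece.forget]

theorem Piece.forget_eq_cross {p : Piece Bool} {o : Bool} :
    p.forget = .cross o ↔ p = .cross o := by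
  cases p <;> simp [Piece.forget]

theorem act_zero_append (p : Piece Bool) (m r : List Bool) (h : m.length = p.bot) :
    (Slice.mk 0 p).act (m ++ r) = ((Slice.mk 0 p).act m).map (· ++ r) := by
  cases p with
  | cup b =>
    simp at h; subst h
    simp [Slice.act]
  | cap =>
    obtain ⟨a, b, rfl⟩ := List.length_eq_two.1 h
    by_cases h : b = !a <;> simp [Slice.act, h]
  | cross o =>
    obtain ⟨a, b, rfl⟩ := List.length_eq_two.1 h
    simp [Slice.act]

/-- The piece `p` acts on `m` only and `q` on `r` only. -/
theorem run_exchange (p q : Piece Bool) (j : ℕ) (m r : List Bool) (h : m.length = p.bot) :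
    run [⟨0, p⟩, ⟨j + p.top, q⟩] (m ++ r) = run [⟨j + p.bot, q⟩, ⟨0, p⟩] (m ++ r) := by
  have e2 : (Slice.mk (j + p.bot) q).act (m ++ r) = ((Slice.mk j q).act r).map (m ++ ·) := by
    rw [add_comm, ← h, act_prefix]
  simp only [run, act_zero_append p m r h, e2]
  cases h1 : (Slice.mk 0 p).act m with
  | none =>
    cases h2 : (Slice.mk j q).act r with
    | none => simp
    | some r' => simp [act_zero_append p m r' h, h1]
  | some m' =>
    have := (act_length h1).1
    have e3 : (Slice.mk (j + p.top) q).act (m' ++ r) = ((Slice.mk j q).act r).map (m' ++ ·) := by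
      rw [add_comm, show p.top = m'.length by simp at this; omega, act_prefix]
    cases h2 : (Slice.mk j q).act r with
    | none => simp [e3, h2]
    | some r' => simp [e3, h2, act_zero_append p m r' h, h1]

theorem run_exchange' (p q : Piece Bool) (j : ℕ) (l : List Bool) (h : p.bot ≤ l.length) :
    run [⟨0, p⟩, ⟨j + p.top, q⟩] l = run [⟨j + p.bot, q⟩, ⟨0, p⟩] l := by
  have := run_exchange p q j (l.take p.bot) (l.drop p.bot) (by simpa using h)
  rwa [List.take_append_drop] at this

theorem isSome_run_cons {s : Slice Bool} {w : List (Slice Bool)} {l : List Bool}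
    (h : (run (s :: w) l).isSome) : s.pos + s.piece.bot ≤ l.length := by
  simp only [run] at h
  cases h1 : s.act l with
  | none => simp [h1] at h
  | some l' => exact (act_length h1).2

theorem Iso.exchange_zero (p q : Piece Unit) (j : ℕ) :
    Iso 0 [⟨0, p⟩, ⟨j + p.top, q⟩] [⟨j + p.bot, q⟩, ⟨0, p⟩] := by
  constructor
  · refine Half.of_zero fun l x _ hx hr => ?_
    simp only [forget_eq_cons, forget_eq_nil] at hx
    obtain ⟨p, _, rfl, rfl, q, _, rfl, rfl, rfl⟩ := hx
    refine ⟨[⟨j + p.bot, q⟩, ⟨0, p⟩], by simp, ?_, Or.inl fun i => ?_⟩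
    · rw [← run_exchange']
      · simp
      · simpa using isSome_run_cons hr
    · simpa [add_assoc] using Move.exchange p q i (i + j) (by omega)
  · refine Half.of_zero fun l x _ hx hr => ?_
    simp only [forget_eq_cons, forget_eq_nil] at hx
    obtain ⟨q, _, rfl, rfl, p, _, rfl, rfl, rfl⟩ := hx
    refine ⟨[⟨0, p⟩, ⟨j + p.top, q⟩], by simp, ?_, Or.inr fun i => ?_⟩
    · rw [run_exchange']
      · simp
      · have := isSome_run_cons hr
        simp at this; omega
    · simpa [add_assoc] using Move.exchange p q i (i + j) (by omega)

theorem Iso.exchange (p q : Piece Unit) (i j : ℕ) (h : i ≤ j) :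
    Iso i [⟨i, p⟩, ⟨j + p.top, q⟩] [⟨j + p.bot, q⟩, ⟨i, p⟩] := by
  obtain ⟨k, rfl⟩ := Nat.exists_eq_add_of_le h
  simpa [add_assoc] using (Iso.exchange_zero p q k).shift i

abbrev cup (i : ℕ) : Slice Unit := ⟨i, .cup ()⟩
abbrev cap (i : ℕ) : Slice Unit := ⟨i, .cap⟩
abbrev crs (o : Bool) (i : ℕ) : Slice Unit := ⟨i, .cross o⟩

theorem exists_two {l : List Bool} (h : 2 ≤ l.length) : ∃ a b r, l = a :: b :: r := by
  rcases l with _ | ⟨a, _ | ⟨b, r⟩⟩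
  · simp at h
  · simp at h
  · exact ⟨a, b, r, rfl⟩

theorem exists_three {l : List Bool} (h : 3 ≤ l.length) : ∃ a b c r, l = a :: b :: c :: r := by
  rcases l with _ | ⟨a, _ | ⟨b, _ | ⟨c, r⟩⟩⟩
  · simp at h
  · simp at h
  · simp at h
  · exact ⟨a, b, c, r, rfl⟩

theorem exists_one {l : List Bool} (h : 1 ≤ l.length) : ∃ a r, l = a :: r := by
  rcases l with _ | ⟨a, r⟩
  · simp at h
  · exact ⟨a, r, rfl⟩

/-- When a pair is created, the label of the new minimum is dictated by the direction of the strand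
it is inserted in; this is why a strand is required. When it is removed, the incompatible labels are
excluded because the word would not run. The other moves that create a minimum follow the same
pattern. -/
theorem Iso.zigzag_left (i : ℕ) : Iso (i + 1) [cup i, cap (i + 1)] [] := by
  refine Iso.shift (n := 1) (a := [cup 0, cap 1]) (b := []) ?_ i
  constructor
  · refine Half.of_zero fun l x hl hx hr => ?_
    simp only [forget_eq_cons, forget_eq_nil, Piece.forget_eq_cup, Piece.forget_eq_cap] at hx
    obtain ⟨_, _, rfl, ⟨b, rfl⟩, _, _, rfl, rfl, rfl⟩ := hx
    obtain ⟨a, r, rfl⟩ := exists_one hl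
    refine ⟨[], by simp, ?_, Or.inl fun i => Move.zigzag_left i b⟩
    revert hr
    cases a <;> cases b <;> simp [run, Slice.act]
  · refine Half.of_zero fun l x hl hx hr => ?_
    simp only [forget_eq_nil] at hx
    subst hx
    obtain ⟨a, r, rfl⟩ := exists_one hl
    refine ⟨[⟨0, .cup a⟩, ⟨1, .cap⟩], by simp [Piece.forget], ?_,
      Or.inr fun i => Move.zigzag_left i a⟩
    simp [run, Slice.act]

theorem Iso.zigzag_right (i : ℕ) : Iso (i + 1) [cup (i + 1), cap i] [] := by
  refine Iso.shift (n := 1) (a := [cup 1, cap 0]) (b := []) ?_ i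
  constructor
  · refine Half.of_zero fun l x hl hx hr => ?_
    simp only [forget_eq_cons, forget_eq_nil, Piece.forget_eq_cup, Piece.forget_eq_cap] at hx
    obtain ⟨_, _, rfl, ⟨b, rfl⟩, _, _, rfl, rfl, rfl⟩ := hx
    obtain ⟨a, r, rfl⟩ := exists_one hl
    refine ⟨[], by simp, ?_, Or.inl fun i => Move.zigzag_right i b⟩
    revert hr
    cases a <;> cases b <;> simp [run, Slice.act]
  · refine Half.of_zero fun l x hl hx hr => ?_
    simp only [forget_eq_nil] at hx
    subst hx
    obtain ⟨a, r, rfl⟩ := exists_one hl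
    refine ⟨[⟨1, .cup !a⟩, ⟨0, .cap⟩], by simp [Piece.forget], ?_,
      Or.inr fun i => Move.zigzag_right i !a⟩
    simp [run, Slice.act]

theorem Iso.slide_cup (o : Bool) (i : ℕ) :
    Iso (i + 1) [cup i, crs o (i + 1)] [cup (i + 1), crs (!o) i] := by
  refine Iso.shift (n := 1) (a := [cup 0, crs o 1]) (b := [cup 1, crs (!o) 0]) ?_ i
  constructor
  · refine Half.of_zero fun l x hl hx hr => ?_
    simp only [forget_eq_cons, forget_eq_nil, Piece.forget_eq_cup, Piece.forget_eq_cross] at hx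
    obtain ⟨_, _, rfl, ⟨b, rfl⟩, _, _, rfl, rfl, rfl⟩ := hx
    obtain ⟨a, r, rfl⟩ := exists_one hl
    refine ⟨[⟨1, .cup b⟩, ⟨0, .cross !o⟩], by simp [Piece.forget], ?_,
      Or.inl fun i => Move.slide_cup i b o⟩
    simp [run, Slice.act]
  · refine Half.of_zero fun l x hl hx hr => ?_
    simp only [forget_eq_cons, forget_eq_nil, Piece.forget_eq_cup, Piece.forget_eq_cross] at hx
    obtain ⟨_, _, rfl, ⟨b, rfl⟩, _, _, rfl, rfl, rfl⟩ := hx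
    obtain ⟨a, r, rfl⟩ := exists_one hl
    refine ⟨[⟨0, .cup b⟩, ⟨1, .cross o⟩], by simp [Piece.forget], ?_,
      Or.inr fun i => Move.slide_cup i b o⟩
    simp [run, Slice.act]

theorem Iso.slide_cap (o : Bool) (i : ℕ) :
    Iso (i + 3) [crs o (i + 1), cap i] [crs (!o) i, cap (i + 1)] := by
  refine Iso.shift (n := 3) (a := [crs o 1, cap 0]) (b := [crs (!o) 0, cap 1]) ?_ i
  constructor
  · refine Half.of_zero fun l x hl hx hr => ?_
    simp only [forget_eq_cons, forget_eq_nil, Piece.forget_eq_cap, Piece.forget_eq_cross] at hx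
    obtain ⟨_, _, rfl, rfl, _, _, rfl, rfl, rfl⟩ := hx
    obtain ⟨a, b, c, r, rfl⟩ := exists_three hl
    refine ⟨[⟨0, .cross !o⟩, ⟨1, .cap⟩], by simp [Piece.forget], ?_,
      Or.inl fun i => Move.slide_cap i o⟩
    cases a <;> cases c <;> simp [run, Slice.act]
  · refine Half.of_zero fun l x hl hx hr => ?_
    simp only [forget_eq_cons, forget_eq_nil, Piece.forget_eq_cap, Piece.forget_eq_cross] at hx
    obtain ⟨_, _, rfl, rfl, _, _, rfl, rfl, rfl⟩ := hx
    obtain ⟨a, b, c, r, rfl⟩ := exists_three hl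
    refine ⟨[⟨1, .cross o⟩, ⟨0, .cap⟩], by simp [Piece.forget], ?_,
      Or.inr fun i => Move.slide_cap i o⟩
    cases a <;> cases c <;> simp [run, Slice.act]

theorem Iso.reidemeister_one_right (o : Bool) (i : ℕ) :
    Iso (i + 1) [cup (i + 1), crs o i, cap (i + 1)] [] := by
  refine Iso.shift (n := 1) (a := [cup 1, crs o 0, cap 1]) (b := []) ?_ i
  constructor
  · refine Half.of_zero fun l x hl hx hr => ?_
    simp only [forget_eq_cons, forget_eq_nil, Piece.forget_eq_cup, Piece.forget_eq_cap,
      Piece.forget_eq_cross] at hx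
    obtain ⟨_, _, rfl, ⟨b, rfl⟩, _, _, rfl, rfl, _, _, rfl, rfl, rfl⟩ := hx
    obtain ⟨a, r, rfl⟩ := exists_one hl
    refine ⟨[], by simp, ?_, Or.inl fun i => Move.reidemeister_one_right i b o⟩
    revert hr
    cases a <;> cases b <;> simp [run, Slice.act]
  · refine Half.of_zero fun l x hl hx hr => ?_
    simp only [forget_eq_nil] at hx
    subst hx
    obtain ⟨a, r, rfl⟩ := exists_one hl
    refine ⟨[⟨1, .cup a⟩, ⟨0, .cross o⟩, ⟨1, .cap⟩], by simp [Piece.forget], ?_,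
      Or.inr fun i => Move.reidemeister_one_right i a o⟩
    simp [run, Slice.act]

theorem Iso.reidemeister_one_left (o : Bool) (i : ℕ) :
    Iso (i + 1) [cup i, crs o (i + 1), cap i] [] := by
  refine Iso.shift (n := 1) (a := [cup 0, crs o 1, cap 0]) (b := []) ?_ i
  constructor
  · refine Half.of_zero fun l x hl hx hr => ?_
    simp only [forget_eq_cons, forget_eq_nil, Piece.forget_eq_cup, Piece.forget_eq_cap,
      Piece.forget_eq_cross] at hx
    obtain ⟨_, _, rfl, ⟨b, rfl⟩, _, _, rfl, rfl, _, _, rfl, rfl, rfl⟩ := hx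
    obtain ⟨a, r, rfl⟩ := exists_one hl
    refine ⟨[], by simp, ?_, Or.inl fun i => Move.reidemeister_one_left i b o⟩
    revert hr
    cases a <;> cases b <;> simp [run, Slice.act]
  · refine Half.of_zero fun l x hl hx hr => ?_
    simp only [forget_eq_nil] at hx
    subst hx
    obtain ⟨a, r, rfl⟩ := exists_one hl
    refine ⟨[⟨0, .cup !a⟩, ⟨1, .cross o⟩, ⟨0, .cap⟩], by simp [Piece.forget], ?_,
      Or.inr fun i => Move.reidemeister_one_left i (!a) o⟩
    simp [run, Slice.act]

theorem Iso.reidemeister_two (o : Bool) (i : ℕ) : Iso (i + 2) [crs o i, crs (!o) i] [] := by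
  refine Iso.shift (n := 2) (a := [crs o 0, crs (!o) 0]) (b := []) ?_ i
  constructor
  · refine Half.of_zero fun l x hl hx hr => ?_
    simp only [forget_eq_cons, forget_eq_nil, Piece.forget_eq_cross] at hx
    obtain ⟨_, _, rfl, rfl, _, _, rfl, rfl, rfl⟩ := hx
    obtain ⟨a, b, r, rfl⟩ := exists_two hl
    refine ⟨[], by simp, ?_, Or.inl fun i => Move.reidemeister_two i o⟩
    simp [run, Slice.act]
  · refine Half.of_zero fun l x hl hx hr => ?_
    simp only [forget_eq_nil] at hx
    subst hx
    obtain ⟨a, b, r, rfl⟩ := exists_two hl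
    refine ⟨[⟨0, .cross o⟩, ⟨0, .cross !o⟩], by simp [Piece.forget], ?_,
      Or.inr fun i => Move.reidemeister_two i o⟩
    simp [run, Slice.act]

theorem Iso.reidemeister_three (o : Bool) (i : ℕ) :
    Iso (i + 3) [crs o i, crs o (i + 1), crs o i] [crs o (i + 1), crs o i, crs o (i + 1)] := by
  refine Iso.shift (n := 3) (a := [crs o 0, crs o 1, crs o 0])
    (b := [crs o 1, crs o 0, crs o 1]) ?_ i
  constructor
  · refine Half.of_zero fun l x hl hx hr => ?_
    simp only [forget_eq_cons, forget_eq_nil, Piece.forget_eq_cross] at hx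
    obtain ⟨_, _, rfl, rfl, _, _, rfl, rfl, _, _, rfl, rfl, rfl⟩ := hx
    obtain ⟨a, b, c, r, rfl⟩ := exists_three hl
    refine ⟨[⟨1, .cross o⟩, ⟨0, .cross o⟩, ⟨1, .cross o⟩], by simp [Piece.forget], ?_,
      Or.inl fun i => Move.reidemeister_three i o⟩
    simp [run, Slice.act]
  · refine Half.of_zero fun l x hl hx hr => ?_
    simp only [forget_eq_cons, forget_eq_nil, Piece.forget_eq_cross] at hx
    obtain ⟨_, _, rfl, rfl, _, _, rfl, rfl, _, _, rfl, rfl, rfl⟩ := hx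
    obtain ⟨a, b, c, r, rfl⟩ := exists_three hl
    refine ⟨[⟨0, .cross o⟩, ⟨1, .cross o⟩, ⟨0, .cross o⟩], by simp [Piece.forget], ?_,
      Or.inr fun i => Move.reidemeister_three i o⟩
    simp [run, Slice.act]

/-! ## Isotopies of two-strand tangles -/

/-- In contrast to `Half.ctx` no count of strands is needed: the `i` strands to the left survive `u`
unchanged, and `a` asks for no others. -/
theorem Half.ctx_zero {n a b} (h : Half 0 a b) (u v : List (Slice Unit)) :
    Half n (u ++ a ++ v) (u ++ b ++ v) := by
  intro i l x hl hx hr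
  rw [shift_append, shift_append, forget_eq, List.map_eq_append_iff] at hx
  obtain ⟨x1, v', rfl, hx1, hv⟩ := hx
  rw [List.map_eq_append_iff] at hx1
  obtain ⟨u', x', rfl, hu, hx'⟩ := hx1
  rw [← forget_eq] at hu hv hx'
  obtain ⟨u', rfl, hu'⟩ := exists_shift hu
  rw [run_append, run_append, run_shift _ _ _ (by omega)] at hr
  obtain ⟨l2, h2⟩ : ∃ l2, run u' (l.drop i) = some l2 := by
    cases h : run u' (l.drop i) with
    | none => simp [h] at hr
    | some l2 => exact ⟨l2, rfl⟩
  have h1 : run (PretzelJones.shift i u') l = some (l.take i ++ l2) := by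
    rw [run_shift _ _ _ (by omega), h2]; rfl
  have hr' : (run x' (l.take i ++ l2)).isSome := by
    cases h : run x' (l.take i ++ l2) with
    | none => simp [h, h2] at hr
    | some l1 => rfl
  obtain ⟨y, hy, r⟩ := h i _ x' (by simp; omega) hx' hr'
  exact ⟨PretzelJones.shift i u' ++ y ++ v', by simp [hu', hy, hv], r.ctx h1 v'⟩

theorem Iso.ctx_zero {n a b} (h : Iso 0 a b) (u v : List (Slice Unit)) :
    Iso n (u ++ a ++ v) (u ++ b ++ v) := ⟨h.1.ctx_zero u v, h.2.ctx_zero u v⟩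

/-- Rewriting a part of a word. -/
theorem Iso.rw {n m a b} (h : Iso m a b) (u v : List (Slice Unit)) {w w' : List (Slice Unit)}
    (hw : w = u ++ a ++ v) (hn : m + bots u ≤ n + tops u) (k : Iso n (u ++ b ++ v) w') :
    Iso n w w' := by
  subst hw
  exact (h.ctx u v hn).trans k

theorem Iso.rw_zero {n a b} (h : Iso 0 a b) (u v : List (Slice Unit)) {w w' : List (Slice Unit)}
    (hw : w = u ++ a ++ v) (k : Iso n (u ++ b ++ v) w') : Iso n w w' := by
  subst hw
  exact (h.ctx_zero u v).trans k

theorem Iso.of_eq {n} {a b : List (Slice Unit)} (h : a = b) : Iso n a b := h ▸ Iso.refl n a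

theorem Iso.comm_word (p : Piece Unit) (w : List (Slice Unit)) :
    Iso 0 ([⟨0, p⟩] ++ PretzelJones.shift p.top w) (PretzelJones.shift p.bot w ++ [⟨0, p⟩]) := by
  induction w with
  | nil => exact Iso.refl _ _
  | cons s w ih =>
    obtain ⟨j, q⟩ := s
    refine Iso.rw_zero (Iso.exchange_zero p q j) [] (PretzelJones.shift p.top w)
      (by simp [add_comm]) ?_
    refine Iso.rw_zero ih [⟨j + p.bot, q⟩] [] (by simp) ?_
    exact Iso.of_eq (by simp [add_comm])

theorem Iso.rep_comm {m : ℕ} {s t : Slice Unit} (h : Iso m [s, t] [t, s])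
    (hs : s.piece.bot = s.piece.top) (n : ℕ) :
    Iso m (List.replicate n s ++ [t]) ([t] ++ List.replicate n s) := by
  induction n with
  | zero => exact Iso.refl _ _
  | succ n ih =>
    refine Iso.rw ih [s] [] (by simp [List.replicate_succ]) (by simp [hs]) ?_
    exact Iso.rw h [] (List.replicate n s) (by simp) (by simp)
      (Iso.of_eq (by simp [List.replicate_succ]))

@[simp] theorem bots_replicate (n : ℕ) (s : Slice Unit) :
    bots (List.replicate n s) = n * s.piece.bot := by simp [bots]
@[simp] theorem tops_replicate (n : ℕ) (s : Slice Unit) :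
    tops (List.replicate n s) = n * s.piece.top := by simp [tops]

/-! ### Columns as integer powers of a crossing -/

/-- The sign of a crossing. -/
def sg (o : Bool) : ℤ := if o then 1 else -1

@[simp] theorem sg_not (o : Bool) : sg (!o) = -sg o := by cases o <;> rfl

/-- A column of `c` crossings of the strands `i` and `i + 1`. -/
def pw (i : ℕ) (c : ℤ) : List (Slice Unit) := List.replicate c.natAbs (crs (decide (0 < c)) i)

@[simp] theorem pw_zero (i : ℕ) : pw i 0 = [] := rfl
@[simp] theorem pw_sg (i : ℕ) (o : Bool) : pw i (sg o) = [crs o i] := by cases o <;> rfl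
@[simp] theorem shift_pw (i j : ℕ) (c : ℤ) : shift i (pw j c) = pw (i + j) c := by simp [pw]
@[simp] theorem bots_pw (i : ℕ) (c : ℤ) : bots (pw i c) = c.natAbs * 2 := by simp [pw]
@[simp] theorem tops_pw (i : ℕ) (c : ℤ) : tops (pw i c) = c.natAbs * 2 := by simp [pw]

theorem pw_eq (i : ℕ) (o : Bool) (n : ℕ) : pw i (sg o * n) = List.replicate n (crs o i) := by
  rcases Nat.eq_zero_or_pos n with rfl | h
  · simp
  · cases o
    · have h1 : ¬ 0 < sg false * (n : ℤ) := by simp [sg]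
      simp only [pw, h1, decide_false]
      simp [sg]
    · simp [pw, sg, h]

theorem exists_sg (c : ℤ) : ∃ o, ∃ n : ℕ, c = sg o * n := by
  rcases le_total 0 c with h | h
  · exact ⟨true, c.toNat, by simp [sg, h]⟩
  · exact ⟨false, (-c).toNat, by simp [sg, h]⟩

theorem Iso.pw_snoc (i : ℕ) (c : ℤ) (e : Bool) :
    Iso (i + 2) (pw i c ++ [crs e i]) (pw i (c + sg e)) := by
  obtain ⟨o, n, rfl⟩ := exists_sg c
  by_cases h : o = e
  · subst h
    refine Iso.of_eq ?_
    rw [show sg o * (n : ℤ) + sg o = sg o * ((n + 1 : ℕ) : ℤ) by push_cast; ring, pw_eq, pw_eq,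
      List.replicate_succ']
  · obtain rfl : e = !o := by cases o <;> cases e <;> simp_all
    cases n with
    | zero => exact Iso.of_eq (by simp [-sg_not])
    | succ n =>
      rw [show sg o * ((n + 1 : ℕ) : ℤ) + sg (!o) = sg o * (n : ℤ) by simp; ring, pw_eq, pw_eq]
      exact Iso.rw (Iso.reidemeister_two o i) (List.replicate n (crs o i)) []
        (by simp [List.replicate_succ']) (by simp) (Iso.of_eq (by simp))

theorem Iso.pw_cons (i : ℕ) (c : ℤ) (e : Bool) :
    Iso (i + 2) ([crs e i] ++ pw i c) (pw i (c + sg e)) := by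
  obtain ⟨o, n, rfl⟩ := exists_sg c
  by_cases h : o = e
  · subst h
    refine Iso.of_eq ?_
    rw [show sg o * (n : ℤ) + sg o = sg o * ((n + 1 : ℕ) : ℤ) by push_cast; ring, pw_eq, pw_eq,
      List.replicate_succ]
    rfl
  · obtain rfl : o = !e := by cases o <;> cases e <;> simp_all
    cases n with
    | zero => exact Iso.of_eq (by simp [-sg_not])
    | succ n =>
      rw [show sg (!e) * ((n + 1 : ℕ) : ℤ) + sg e = sg (!e) * (n : ℤ) by simp; ring, pw_eq, pw_eq]
      exact Iso.rw (Iso.reidemeister_two e i) [] (List.replicate n (crs (!e) i))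
        (by simp [List.replicate_succ]) (by simp) (Iso.of_eq (by simp))

theorem Iso.pw_append (i : ℕ) (c d : ℤ) : Iso (i + 2) (pw i c ++ pw i d) (pw i (c + d)) := by
  obtain ⟨o, n, rfl⟩ := exists_sg d
  induction n with
  | zero => exact Iso.of_eq (by simp)
  | succ n ih =>
    have e : pw i (sg o * ((n + 1 : ℕ) : ℤ)) = pw i (sg o * (n : ℤ)) ++ [crs o i] := by
      rw [pw_eq, pw_eq, List.replicate_succ']
    refine Iso.rw ih [] [crs o i] (by rw [e]; simp) (by simp) ?_
    refine Iso.rw (Iso.pw_snoc i (c + sg o * n) o) [] [] (by simp) (by simp) (Iso.of_eq ?_)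
    rw [List.nil_append, List.append_nil]
    congr 1
    push_cast; ring

/-- The first Reidemeister move is available only for a vertical strand. A zigzag inserted above the
crossing and a slide bring the curl into that form. -/
theorem Iso.cup_curl (o : Bool) (i : ℕ) : Iso i [cup i, crs o i] [cup i] := by
  refine Iso.shift (n := 0) (a := [cup 0, crs o 0]) (b := [cup 0]) ?_ i
  refine Iso.rw (Iso.zigzag_left 0).symm [cup 0, crs o 0] [] (by simp) (by simp) ?_
  refine Iso.rw_zero (Iso.exchange_zero (.cup ()) (.cross o) 0).symm [cup 0] [cap 1] rfl ?_
  refine Iso.rw (Iso.slide_cap o 1) [cup 0, cup 0] [] rfl (by simp) ?_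
  refine Iso.rw_zero (Iso.exchange_zero (.cup ()) (.cup ()) 0).symm [] [crs (!o) 1, cap 2] rfl ?_
  exact Iso.rw (Iso.reidemeister_one_right (!o) 1) [cup 0] [] rfl (by simp) (Iso.refl _ _)

theorem Iso.slide_cup' (o : Bool) (i : ℕ) :
    Iso (i + 1) [cup (i + 1), crs o i] [cup i, crs (!o) (i + 1)] := by
  simpa using (Iso.slide_cup (!o) i).symm

theorem Iso.slide_cap' (o : Bool) (i : ℕ) :
    Iso (i + 3) [crs o i, cap (i + 1)] [crs (!o) (i + 1), cap i] := by
  simpa using (Iso.slide_cap (!o) i).symm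

/-- A crossing on the left legs of two nested minima slides around the bottom to the right legs.
This transports crossings from one column to the other in a diagram with two columns. -/
theorem Iso.nested_cups (o : Bool) : Iso 0 [cup 0, cup 1, crs o 0] [cup 0, cup 1, crs o 2] := by
  refine Iso.rw (Iso.slide_cup' o 0) [cup 0] [] rfl (by simp) ?_
  refine Iso.rw_zero (Iso.exchange_zero (.cup ()) (.cup ()) 0).symm [] [crs (!o) 1] rfl ?_
  exact Iso.rw (Iso.slide_cup' (!o) 1) [cup 0] [] rfl (by simp) (Iso.of_eq (by simp))

/-- The third Reidemeister move is given for three equal crossings only. The mixed case follows by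
inserting a cancelling pair of crossings, applying that move and cancelling another pair. -/
theorem Iso.braid_up (o e : Bool) (i : ℕ) :
    Iso (i + 3) [crs o i, crs e (i + 1), crs e i] [crs e (i + 1), crs e i, crs o (i + 1)] := by
  by_cases h : o = e
  · subst h; exact Iso.reidemeister_three o i
  · obtain rfl : o = !e := by cases o <;> cases e <;> simp_all
    refine Iso.rw (Iso.reidemeister_two e (i + 1)).symm [crs (!e) i, crs e (i + 1), crs e i] []
      (by simp) (by simp) ?_
    refine Iso.rw (Iso.reidemeister_three e i).symm [crs (!e) i] [crs (!e) (i + 1)]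
      (by simp) (by simp) ?_
    exact Iso.rw (by simpa using Iso.reidemeister_two (!e) i) []
      [crs e (i + 1), crs e i, crs (!e) (i + 1)] (by simp) (by simp) (Iso.refl _ _)

theorem Iso.braid_down (o e : Bool) (i : ℕ) :
    Iso (i + 3) [crs o (i + 1), crs e i, crs e (i + 1)] [crs e i, crs e (i + 1), crs o i] := by
  by_cases h : o = e
  · subst h; exact (Iso.reidemeister_three o i).symm
  · obtain rfl : o = !e := by cases o <;> cases e <;> simp_all
    refine Iso.rw (Iso.reidemeister_two e i).symm [crs (!e) (i + 1), crs e i, crs e (i + 1)] []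
      (by simp) (by simp) ?_
    refine Iso.rw (Iso.reidemeister_three e i) [crs (!e) (i + 1)] [crs (!e) i]
      (by simp) (by simp) ?_
    exact Iso.rw (by simpa using Iso.reidemeister_two (!e) (i + 1)) []
      [crs e i, crs e (i + 1), crs (!e) i] (by simp) (by simp) (Iso.refl _ _)

/-- Pulling a column through a word. -/
theorem Iso.pw_through {m i j : ℕ} {w : List (Slice Unit)} (c : ℤ)
    (h : ∀ o, Iso m ([crs o i] ++ w) (w ++ [crs o j])) : Iso m (pw i c ++ w) (w ++ pw j c) := by
  obtain ⟨o, n, rfl⟩ := exists_sg c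
  simp only [pw_eq]
  induction n with
  | zero => exact Iso.of_eq (by simp)
  | succ n ih =>
    refine Iso.rw (h o) (List.replicate n (crs o i)) [] (by simp [List.replicate_succ'])
      (by simp) ?_
    exact Iso.rw ih [] [crs o j] (by simp) (by simp)
      (Iso.of_eq (by simp [List.replicate_succ']))

theorem Iso.pw_braid_up (c : ℤ) (e : Bool) (i : ℕ) :
    Iso (i + 3) (pw i c ++ [crs e (i + 1), crs e i]) ([crs e (i + 1), crs e i] ++ pw (i + 1) c) :=
  Iso.pw_through c fun o => Iso.braid_up o e i

theorem Iso.pw_braid_down (c : ℤ) (e : Bool) (i : ℕ) :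
    Iso (i + 3) (pw (i + 1) c ++ [crs e i, crs e (i + 1)]) ([crs e i, crs e (i + 1)] ++ pw i c) :=
  Iso.pw_through c fun o => Iso.braid_down o e i

/-- A column commutes with a piece to the right of it. -/
theorem Iso.pw_comm (i j : ℕ) (c : ℤ) (q : Piece Unit) (h : i + 2 ≤ j) :
    Iso i (pw i c ++ [⟨j, q⟩]) ([⟨j, q⟩] ++ pw i c) := by
  obtain ⟨k, rfl⟩ := Nat.exists_eq_add_of_le h
  refine Iso.pw_through c fun o => ?_
  simpa [add_assoc, add_comm, add_left_comm] using Iso.exchange (.cross o) q i (i + k) (by omega)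

/-! ### Quarter turns and flypes -/

/-- The column of `c` crossings, turned by a quarter to the left. -/
def turnL (c : ℤ) : List (Slice Unit) := [cup 0] ++ pw 1 c ++ [cap 2]

/-- The column of `c` crossings, turned by a quarter to the right. -/
def turnR (c : ℤ) : List (Slice Unit) := [cup 2] ++ pw 1 c ++ [cap 0]

/-- Two tangles with two strands side by side. -/
def beside (X Y : List (Slice Unit)) : List (Slice Unit) := [cup 1] ++ X ++ shift 2 Y ++ [cap 1]

/-- In Conway's fractions a column is `1/a`, its quarter turn is `-a`, and a single crossing is `e =
±1` in either reading; the isotopy realizes `1/a + e = 1/(e - 1/(a + e))`. A cancelling pair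
inserted at the top lets the column slide through a braid and come out turned. -/
theorem Iso.beside_crs (a : ℤ) (e : Bool) :
    Iso 2 (beside (pw 0 a) [crs e 0]) (turnL (a + sg e) ++ [crs e 0]) := by
  refine Iso.rw (Iso.slide_cap e 1) ([cup 1] ++ pw 0 a) [] (by simp [beside]) (by simp; omega) ?_
  refine Iso.rw (by simpa using (Iso.reidemeister_two (!e) 0).symm)
    ([cup 1] ++ pw 0 a ++ [crs (!e) 1]) [cap 2] (by simp) (by simp) ?_
  refine Iso.rw (Iso.pw_braid_up a (!e) 0) [cup 1] [crs e 0, cap 2] (by simp) (by simp) ?_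
  refine Iso.rw (Iso.cup_curl (!e) 1) [] ([crs (!e) 0] ++ pw 1 a ++ [crs e 0, cap 2])
    (by simp) (by simp) ?_
  refine Iso.rw (Iso.slide_cup' (!e) 0) [] (pw 1 a ++ [crs e 0, cap 2]) (by simp) (by simp) ?_
  refine Iso.rw (Iso.pw_cons 1 a e) [cup 0] [crs e 0, cap 2] (by simp) (by simp) ?_
  refine Iso.rw_zero (Iso.exchange_zero (.cross e) .cap 0) ([cup 0] ++ pw 1 (a + sg e)) []
    (by simp) ?_
  exact Iso.of_eq (by simp [turnL])

theorem Iso.crs_beside (a : ℤ) (e : Bool) :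
    Iso 2 (beside [crs e 0] (pw 0 a)) (turnR (a + sg e) ++ [crs e 0]) := by
  refine Iso.rw_zero (Iso.comm_word (.cross e) (pw 0 a)) [cup 1] [cap 1] (by simp [beside]) ?_
  refine Iso.rw (Iso.slide_cap' e 0) ([cup 1] ++ pw 2 a) [] (by simp) (by simp; omega) ?_
  refine Iso.rw (by simpa using (Iso.reidemeister_two (!e) 2).symm)
    ([cup 1] ++ pw 2 a ++ [crs (!e) 1]) [cap 0] (by simp) (by simp; omega) ?_
  refine Iso.rw (Iso.pw_braid_down a (!e) 1) [cup 1] [crs e 2, cap 0] (by simp) (by simp) ?_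
  refine Iso.rw (Iso.cup_curl (!e) 1) [] ([crs (!e) 2] ++ pw 1 a ++ [crs e 2, cap 0])
    (by simp) (by simp) ?_
  refine Iso.rw (Iso.slide_cup (!e) 1) [] (pw 1 a ++ [crs e 2, cap 0]) (by simp) (by simp) ?_
  refine Iso.rw (Iso.pw_cons 1 a e) [cup 2] [crs e 2, cap 0] (by simp) (by simp) ?_
  refine Iso.rw_zero (Iso.exchange_zero .cap (.cross e) 0).symm ([cup 2] ++ pw 1 (a + sg e)) []
    (by simp) ?_
  exact Iso.of_eq (by simp [turnR])

/-- A crossing added beside a turned column lengthens the turned column. The sign changes because a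
crossing looks opposite after a quarter turn. -/
theorem Iso.turnL_beside (c : ℤ) (e : Bool) :
    Iso 2 (beside (turnL c) [crs e 0]) (turnL (c - sg e)) := by
  refine Iso.rw (Iso.slide_cap e 1) ([cup 1, cup 0] ++ pw 1 c ++ [cap 2]) []
    (by simp [beside, turnL]) (by simp; omega) ?_
  refine Iso.rw_zero (Iso.exchange_zero (.cup ()) (.cup ()) 1).symm []
    (pw 1 c ++ [cap 2, crs (!e) 1, cap 2]) (by simp) ?_
  refine Iso.rw (Iso.pw_comm 1 3 c (.cup ()) (by simp)).symm [cup 0] [cap 2, crs (!e) 1, cap 2]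
    (by simp) (by simp) ?_
  refine Iso.rw (Iso.zigzag_right 2) ([cup 0] ++ pw 1 c) [crs (!e) 1, cap 2]
    (by simp) (by simp; omega) ?_
  refine Iso.rw (Iso.pw_snoc 1 c (!e)) [cup 0] [cap 2] (by simp) (by simp) ?_
  exact Iso.of_eq (by simp [turnL, sub_eq_add_neg])

theorem Iso.turnR_beside (c : ℤ) (e : Bool) :
    Iso 2 (beside (turnR c) [crs e 0]) (turnR (c - sg e)) := by
  refine Iso.rw_zero (Iso.exchange_zero .cap (.cross e) 2) ([cup 1, cup 2] ++ pw 1 c) [cap 1]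
    (by simp [beside, turnR]) ?_
  refine Iso.rw (Iso.pw_comm 1 4 c (.cross e) (by simp)) [cup 1, cup 2] [cap 0, cap 1]
    (by simp) (by simp) ?_
  refine Iso.rw (Iso.exchange (.cup ()) (.cross e) 2 2 le_rfl) [cup 1]
    (pw 1 c ++ [cap 0, cap 1]) (by simp) (by simp) ?_
  refine Iso.rw (Iso.slide_cup e 1) [] ([cup 2] ++ pw 1 c ++ [cap 0, cap 1])
    (by simp) (by simp) ?_
  refine Iso.rw_zero (Iso.exchange_zero .cap .cap 1) ([cup 2, crs (!e) 1, cup 2] ++ pw 1 c) []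
    (by simp) ?_
  refine Iso.rw (Iso.pw_comm 1 3 c .cap (by simp)) [cup 2, crs (!e) 1, cup 2] [cap 0]
    (by simp) (by simp) ?_
  refine Iso.rw (Iso.zigzag_left 2) [cup 2, crs (!e) 1] (pw 1 c ++ [cap 0])
    (by simp) (by simp) ?_
  refine Iso.rw (Iso.pw_cons 1 c (!e)) [cup 2] [cap 0] (by simp) (by simp) ?_
  exact Iso.of_eq (by simp [turnR, sub_eq_add_neg])

theorem Iso.turn_zero : Iso 0 (turnL 0) [cap 0, cup 0] :=
  Iso.exchange_zero (.cup ()) .cap 0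

theorem Iso.turn_zero' : Iso 0 (turnR 0) [cap 0, cup 0] :=
  (Iso.exchange_zero .cap (.cup ()) 0).symm

theorem Iso.beside_congr_left {X X' : List (Slice Unit)} (h : Iso 2 X X') (Y) :
    Iso 2 (beside X Y) (beside X' Y) :=
  Iso.rw h [cup 1] (PretzelJones.shift 2 Y ++ [cap 1]) (by simp [beside]) (by simp)
    (Iso.of_eq (by simp [beside]))

theorem Iso.beside_congr_right (X) (hX : bots X = tops X) {Y Y' : List (Slice Unit)}
    (h : Iso 2 Y Y') : Iso 2 (beside X Y) (beside X Y') :=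
  Iso.rw (h.shift 2) ([cup 1] ++ X) [cap 1] (by simp [beside]) (by simp; omega)
    (Iso.of_eq (by simp [beside]))

/-- Both turns of the empty column are `≍`, and adding a crossing on the right changes both turns in
the same way; induction in both directions reaches every `c`. -/
theorem Iso.turn (c : ℤ) : Iso 2 (turnL c) (turnR c) := by
  have key : ∀ c e, Iso 2 (turnL c) (turnR c) → Iso 2 (turnL (c - sg e)) (turnR (c - sg e)) :=
    fun c e h => (Iso.turnL_beside c e).symm.trans
      ((Iso.beside_congr_left h _).trans (Iso.turnR_beside c e))
  induction c with
  | zero => exact (Iso.turn_zero.trans Iso.turn_zero'.symm).mono (by simp)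
  | succ n ih => simpa [sg] using key _ false ih
  | pred n ih => simpa [sg] using key _ true ih

/-- Both sides are a turned column of `a ± 1` crossings below one crossing, and the two ways of
turning agree. -/
theorem Iso.flype (a : ℤ) (e : Bool) :
    Iso 2 (beside (pw 0 a) [crs e 0]) (beside [crs e 0] (pw 0 a)) := by
  refine (Iso.beside_crs a e).trans (Iso.trans ?_ (Iso.crs_beside a e).symm)
  exact Iso.rw (Iso.turn (a + sg e)) [] [crs e 0] (by simp) (by simp) (Iso.of_eq (by simp))

theorem Iso.turnL_neg_sg (e : Bool) : Iso 2 (turnL (-sg e)) [crs e 0] := by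
  rw [← sg_not, turnL, pw_sg]
  refine Iso.rw (Iso.slide_cup (!e) 0) [] [cap 2] rfl (by simp) ?_
  refine Iso.rw_zero (Iso.exchange_zero (.cross e) .cap 0) [cup 1] [] (by simp) ?_
  exact Iso.rw (Iso.zigzag_left 1) [] [crs e 0] (by simp) (by simp) (Iso.of_eq (by simp))

/-- One of the crossings is itself a turned column, which the opposite crossing shortens to `≍`. By
`Iso.beside_trivial` the tangle `≍` is neutral for `beside`. -/
theorem Iso.beside_cancel (e : Bool) : Iso 2 (beside [crs e 0] [crs (!e) 0]) [cap 0, cup 0] := by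
  refine (Iso.beside_congr_left (Iso.turnL_neg_sg e).symm _).trans ?_
  refine (Iso.turnL_beside _ _).trans ?_
  simpa using Iso.turn_zero.mono (Nat.zero_le 2)

theorem Iso.beside_trivial (X : List (Slice Unit)) (hX : bots X = tops X) :
    Iso 2 (beside [cap 0, cup 0] X) X := by
  refine Iso.rw (Iso.zigzag_right 0) [] ([cup 0] ++ PretzelJones.shift 2 X ++ [cap 1])
    (by simp [beside]) (by simp) ?_
  refine Iso.rw_zero (Iso.comm_word (.cup ()) X) [] [cap 1] (by simp) ?_
  exact Iso.rw (Iso.zigzag_left 0) X [] (by simp) (by simp; omega) (Iso.of_eq (by simp))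

/-- Next to a column without crossings, a single crossing is a curl of the right strand. -/
theorem Iso.zero_beside (e : Bool) : Iso 2 (beside (pw 0 0) [crs e 0]) (pw 0 0) :=
  (Iso.reidemeister_one_left e 1).mono (by simp)

theorem Iso.beside_assoc (a b : ℤ) (Z : List (Slice Unit)) (hZ : bots Z = tops Z) :
    Iso 2 (beside (beside (pw 0 a) (pw 0 b)) Z) (beside (pw 0 a) (beside (pw 0 b) Z)) := by
  refine Iso.rw (Iso.exchange (.cup ()) (.cup ()) 1 1 le_rfl).symm []
    (pw 0 a ++ pw 2 b ++ [cap 1] ++ PretzelJones.shift 2 Z ++ [cap 1])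
    (by simp [beside]) (by simp) ?_
  refine Iso.rw (Iso.pw_comm 0 3 a (.cup ()) (by simp)).symm [cup 1]
    (pw 2 b ++ [cap 1] ++ PretzelJones.shift 2 Z ++ [cap 1]) (by simp) (by simp) ?_
  refine Iso.rw ((Iso.comm_word .cap (PretzelJones.shift 1 Z)).shift 1)
    ([cup 1] ++ pw 0 a ++ [cup 3] ++ pw 2 b) [cap 1] (by simp [shift_shift]) (by simp; omega) ?_
  refine Iso.rw (Iso.exchange .cap .cap 1 1 le_rfl)
    ([cup 1] ++ pw 0 a ++ [cup 3] ++ pw 2 b ++ PretzelJones.shift 4 Z) []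
    (by simp [shift_shift]) (by simp; omega) ?_
  exact Iso.of_eq (by simp [beside, shift_shift])

/-! ## Isotopies of pretzel diagrams -/

/-- The columns `a₁, …, aₙ` side by side. -/
def rowOf : List ℤ → List (Slice Unit)
  | [] => []
  | [a] => pw 0 a
  | a :: b :: l => beside (pw 0 a) (rowOf (b :: l))

theorem bots_rowOf (l : List ℤ) : bots (rowOf l) = tops (rowOf l) := by
  induction l using rowOf.induct with
  | case1 => rfl
  | case2 => simp [rowOf]
  | case3 a b l ih => simp [rowOf, beside, ih]; omega

/-- The minima of a pretzel diagram with `n + 1` columns, except for the outer one. -/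
def cupsOf (n : ℕ) : List (Slice Unit) := (List.range n).map fun k => cup (2 * k + 1)

/-- The maxima of a pretzel diagram with `n + 1` columns, except for the outer one. -/
def capsOf (n : ℕ) : List (Slice Unit) := (List.range n).reverse.map fun k => cap (2 * k + 1)

theorem cupsOf_succ (n : ℕ) : cupsOf (n + 1) = [cup 1] ++ shift 2 (cupsOf n) := by
  simp [cupsOf, List.range_succ_eq_map, shift, Function.comp_def]
  intros; ring

theorem capsOf_succ (n : ℕ) : capsOf (n + 1) = shift 2 (capsOf n) ++ [cap 1] := by
  simp [capsOf, List.range_succ_eq_map, shift, Function.comp_def]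
  intros; ring

theorem columns_eq_shift (k : ℕ) (l : List ℤ) : columns k l = shift (2 * k) (columns 0 l) := by
  induction l generalizing k with
  | nil => rfl
  | cons a l ih =>
    rw [columns, columns, ih (k + 1), ih (0 + 1), shift_append, shift_shift]
    simp [column, mul_add]

theorem Iso.rowOf_pretzel (a : ℤ) (l : List ℤ) :
    Iso 2 (cupsOf l.length ++ columns 0 (a :: l) ++ capsOf l.length) (rowOf (a :: l)) := by
  induction l generalizing a with
  | nil => exact Iso.of_eq (by simp [cupsOf, capsOf, columns, rowOf, column, pw])
  | cons b l ih =>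
    have h1 : columns 0 (a :: b :: l) = pw 0 a ++ PretzelJones.shift 2 (columns 0 (b :: l)) := by
      rw [columns, columns_eq_shift]; rfl
    have h2 : Iso 0 (pw 0 a ++ PretzelJones.shift 2 (cupsOf l.length))
        (PretzelJones.shift 2 (cupsOf l.length) ++ pw 0 a) :=
      Iso.pw_through a fun o => Iso.comm_word (.cross o) (cupsOf l.length)
    refine Iso.rw_zero h2.symm [cup 1] (PretzelJones.shift 2 (columns 0 (b :: l) ++ capsOf l.length) ++ [cap 1]) ?_ ?_
    · simp [cupsOf_succ, capsOf_succ, h1]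
    · refine Iso.trans (Iso.of_eq ?_) (Iso.beside_congr_right (pw 0 a) (by simp) (ih b))
      simp [beside]

theorem Iso.pretzel (l : List ℤ) (hl : l ≠ []) :
    Iso 0 (PretzelJones.pretzel l) ([cup 0] ++ rowOf l ++ [cap 0]) := by
  obtain ⟨a, l, rfl⟩ := List.exists_cons_of_ne_nil hl
  exact Iso.rw (Iso.rowOf_pretzel a l) [cup 0] [cap 0]
    (by simp [PretzelJones.pretzel, cupsOf, capsOf]) (by simp) (Iso.refl _ _)

theorem Iso.pretzel_of_rowOf {l l' : List ℤ} (hl : l ≠ []) (hl' : l' ≠ [])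
    (h : Iso 2 (rowOf l) (rowOf l')) : Iso 0 (PretzelJones.pretzel l) (PretzelJones.pretzel l') :=
  (Iso.pretzel l hl).trans ((Iso.rw h [cup 0] [cap 0] rfl (by simp) (Iso.refl _ _)).trans
    (Iso.pretzel l' hl').symm)

theorem rowOf_cons (a : ℤ) {l : List ℤ} (hl : l ≠ []) :
    rowOf (a :: l) = beside (pw 0 a) (rowOf l) := by
  obtain ⟨b, l, rfl⟩ := List.exists_cons_of_ne_nil hl
  rfl

theorem Iso.rowOf_cons_congr (a : ℤ) {l l' : List ℤ} (hl : l ≠ []) (hl' : l' ≠ [])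
    (h : Iso 2 (rowOf l) (rowOf l')) : Iso 2 (rowOf (a :: l)) (rowOf (a :: l')) := by
  rw [rowOf_cons a hl, rowOf_cons a hl']
  exact Iso.beside_congr_right _ (by simp) h

theorem Iso.rowOf_append_congr (k : List ℤ) {l l' : List ℤ} (hl : l ≠ []) (hl' : l' ≠ [])
    (h : Iso 2 (rowOf l) (rowOf l')) : Iso 2 (rowOf (k ++ l)) (rowOf (k ++ l')) := by
  induction k with
  | nil => exact h
  | cons a k ih => exact Iso.rowOf_cons_congr a (by simp [hl]) (by simp [hl']) ih

theorem Iso.rowOf_swap (a : ℤ) (e : Bool) (l : List ℤ) :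
    Iso 2 (rowOf (a :: sg e :: l)) (rowOf (sg e :: a :: l)) := by
  by_cases hl : l = []
  · subst hl
    simpa [rowOf] using Iso.flype a e
  · rw [rowOf_cons _ (by simp), rowOf_cons _ hl, rowOf_cons _ (by simp), rowOf_cons _ hl]
    refine (Iso.beside_assoc _ _ _ (bots_rowOf l)).symm.trans
      (Iso.trans ?_ (Iso.beside_assoc _ _ _ (bots_rowOf l)))
    exact Iso.beside_congr_left (by simpa using Iso.flype a e) _

theorem Iso.rowOf_move (k l : List ℤ) (e : Bool) :
    Iso 2 (rowOf (k ++ sg e :: l)) (rowOf (sg e :: (k ++ l))) := by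
  induction k with
  | nil => exact Iso.refl _ _
  | cons a k ih =>
    exact (Iso.rowOf_cons_congr a (by simp) (by simp) ih).trans (Iso.rowOf_swap a e _)

theorem Iso.rowOf_cancel (e : Bool) (l : List ℤ) (hl : l ≠ []) :
    Iso 2 (rowOf (sg e :: sg (!e) :: l)) (rowOf l) := by
  rw [rowOf_cons _ (by simp), rowOf_cons _ hl]
  refine (Iso.beside_assoc _ _ _ (bots_rowOf l)).symm.trans
    (Iso.trans ?_ (Iso.beside_trivial _ (bots_rowOf l)))
  exact Iso.beside_congr_left (by simpa [-sg_not] using Iso.beside_cancel e) _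

theorem Iso.rowOf_zero (e : Bool) (l : List ℤ) :
    Iso 2 (rowOf (0 :: sg e :: l)) (rowOf (0 :: l)) := by
  by_cases hl : l = []
  · subst hl
    simpa [rowOf] using Iso.zero_beside e
  · rw [rowOf_cons _ (by simp), rowOf_cons _ hl, rowOf_cons _ hl]
    refine (Iso.beside_assoc _ _ _ (bots_rowOf l)).symm.trans ?_
    exact Iso.beside_congr_left (by simpa using Iso.zero_beside e) _

/-- Both columns are moved to the front and cancelled there. The bound on the length ensures that a
column is left over. -/
theorem Iso.rowOf_cancel_of_mem {l : List ℤ} (h1 : (1 : ℤ) ∈ l) (h2 : (-1 : ℤ) ∈ l)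
    (hl : 3 ≤ l.length) :
    ∃ l' : List ℤ, l' ≠ [] ∧ l'.length < l.length ∧ Iso 2 (rowOf l) (rowOf l') := by
  obtain ⟨k, m, rfl⟩ := List.append_of_mem h2
  have h3 : (1 : ℤ) ∈ k ++ m := by simpa using h1
  obtain ⟨k', m', e⟩ := List.append_of_mem h3
  have hlen : (k ++ m).length = (k' ++ 1 :: m').length := by rw [e]
  simp at hlen hl
  have hne : k' ++ m' ≠ [] := by
    intro h0
    simp at h0
    obtain ⟨rfl, rfl⟩ := h0
    simp at hlen
    omega
  refine ⟨k' ++ m', hne, by simp; omega, ?_⟩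
  have s1 := Iso.rowOf_move k m false
  rw [e] at s1
  have s2 := Iso.rowOf_cons_congr (-1) (by simp) (by simp) (Iso.rowOf_move k' m' true)
  exact s1.trans (s2.trans (Iso.rowOf_cancel false _ hne))

/-- The column `±1` is moved to the front, then back to the place next to the `0`, where it is a
curl. -/
theorem Iso.rowOf_zero_of_mem {l : List ℤ} (h1 : (0 : ℤ) ∈ l) (e : Bool) (h2 : sg e ∈ l) :
    ∃ l' : List ℤ, l' ≠ [] ∧ l'.length < l.length ∧ Iso 2 (rowOf l) (rowOf l') := by
  obtain ⟨k, m, rfl⟩ := List.append_of_mem h2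
  have h3 : (0 : ℤ) ∈ k ++ m := by
    have : (0 : ℤ) ≠ sg e := by cases e <;> decide
    simpa [this] using h1
  obtain ⟨k', m', h⟩ := List.append_of_mem h3
  refine ⟨k ++ m, by simp [h], by simp, ?_⟩
  have s1 := Iso.rowOf_move k m e
  rw [h] at s1 ⊢
  refine s1.trans ((Iso.rowOf_move k' (0 :: m') e).symm.trans ?_)
  refine Iso.rowOf_append_congr k' (by simp) (by simp) ?_
  exact (Iso.rowOf_swap 0 e m').symm.trans (Iso.rowOf_zero e m')

theorem Iso.pretzel_singleton (a : ℤ) :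
    Iso 0 (PretzelJones.pretzel [a]) (PretzelJones.pretzel [0]) := by
  refine (Iso.pretzel [a] (by simp)).trans (Iso.trans ?_ (Iso.pretzel [0] (by simp)).symm)
  simp only [rowOf]
  obtain ⟨o, n, rfl⟩ := exists_sg a
  rw [pw_eq]
  induction n with
  | zero => exact Iso.of_eq (by simp)
  | succ n ih =>
    exact Iso.rw (Iso.cup_curl o 0) [] (List.replicate n (crs o 0) ++ [cap 0])
      (by simp [List.replicate_succ]) (by simp) (Iso.trans (Iso.of_eq (by simp)) ih)

/-- The first column slides along the two nested minima onto the second one: the diagram is that of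
a `(2, a + b)` torus link. -/
theorem Iso.pretzel_pair (a b : ℤ) :
    Iso 0 (PretzelJones.pretzel [a, b]) (PretzelJones.pretzel [0, a + b]) := by
  refine (Iso.pretzel [a, b] (by simp)).trans
    (Iso.trans ?_ (Iso.pretzel [0, a + b] (by simp)).symm)
  have key : ∀ n : ℕ, ∀ o : Bool, Iso 0 ([cup 0, cup 1] ++ List.replicate n (crs o 0))
      ([cup 0, cup 1] ++ List.replicate n (crs o 2)) := by
    intro n o
    induction n with
    | zero => exact Iso.refl _ _
    | succ n ih =>
      refine Iso.rw ih [] [crs o 0] (by simp [List.replicate_succ']) (by simp) ?_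
      refine Iso.rw (Iso.rep_comm (Iso.exchange_zero (.cross o) (.cross o) 0).symm rfl n)
        [cup 0, cup 1] [] (by simp) (by simp) ?_
      exact Iso.rw (Iso.nested_cups o) [] (List.replicate n (crs o 2)) (by simp) (by simp)
        (Iso.of_eq (by simp [List.replicate_succ]))
  obtain ⟨o, n, rfl⟩ := exists_sg a
  refine Iso.rw (key n o) [] (pw 2 b ++ [cap 1, cap 0]) (by simp [rowOf, beside, pw_eq])
    (by simp) ?_
  refine Iso.rw (Iso.pw_append 2 (sg o * n) b) [cup 0, cup 1] [cap 1, cap 0]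
    (by simp [pw_eq]) (by simp) ?_
  exact Iso.of_eq (by simp [rowOf, beside])

/-! ### Reduced lists of columns -/

/-- The lists of columns to which every list of columns can be reduced. -/
structure Reduced (l : List ℤ) : Prop where
  ne_nil : l ≠ []
  not_opposite : ¬ ((1 : ℤ) ∈ l ∧ (-1 : ℤ) ∈ l)
  not_zero : (0 : ℤ) ∈ l → (1 : ℤ) ∉ l ∧ (-1 : ℤ) ∉ l
  zero_mem : l.length ≤ 2 → (0 : ℤ) ∈ l

theorem exists_reduced (l : List ℤ) (hl : l ≠ []) :
    ∃ l', Reduced l' ∧ Iso 0 (pretzel l) (pretzel l') := by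
  induction hn : l.length using Nat.strong_induction_on generalizing l with
  | _ n ih =>
  subst hn
  have red0 : Reduced [0] := ⟨by simp, by simp, by simp, by simp⟩
  have step : (∃ l' : List ℤ, l' ≠ [] ∧ l'.length < l.length ∧ Iso 2 (rowOf l) (rowOf l')) →
      ∃ l', Reduced l' ∧ Iso 0 (pretzel l) (pretzel l') := by
    rintro ⟨l', h1, h2, h3⟩
    obtain ⟨l'', h4, h5⟩ := ih _ h2 l' h1 rfl
    exact ⟨l'', h4, (Iso.pretzel_of_rowOf hl h1 h3).trans h5⟩
  rcases l with _ | ⟨a, _ | ⟨b, _ | ⟨c, l⟩⟩⟩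
  · exact absurd rfl hl
  · exact ⟨[0], red0, Iso.pretzel_singleton a⟩
  -- If the merged column is `±1`, the column `0` swallows it too.
  · by_cases h : ∃ e, a + b = sg e
    · obtain ⟨e, he⟩ := h
      refine ⟨[0], red0, (Iso.pretzel_pair a b).trans ?_⟩
      rw [he]
      exact Iso.pretzel_of_rowOf (by simp) (by simp) (Iso.rowOf_zero e [])
    · refine ⟨[0, a + b], ⟨by simp, ?_, fun _ => ⟨?_, ?_⟩, by simp⟩, Iso.pretzel_pair a b⟩
      · rintro ⟨h1, -⟩
        exact h ⟨true, by simpa [sg, eq_comm] using h1⟩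
      · intro h1
        exact h ⟨true, by simpa [sg, eq_comm] using h1⟩
      · intro h1
        exact h ⟨false, by simpa [sg, eq_comm] using h1⟩
  · by_cases h1 : (1 : ℤ) ∈ a :: b :: c :: l ∧ (-1 : ℤ) ∈ a :: b :: c :: l
    · exact step (Iso.rowOf_cancel_of_mem h1.1 h1.2 (by simp))
    by_cases h2 : (0 : ℤ) ∈ a :: b :: c :: l
    · by_cases h3 : (1 : ℤ) ∈ a :: b :: c :: l
      · exact step (Iso.rowOf_zero_of_mem h2 true h3)
      by_cases h4 : (-1 : ℤ) ∈ a :: b :: c :: l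
      · exact step (Iso.rowOf_zero_of_mem h2 false h4)
      exact ⟨_, ⟨hl, h1, fun _ => ⟨h3, h4⟩, by simp⟩, Iso.refl _ _⟩
    · exact ⟨_, ⟨hl, h1, fun h => absurd h h2, by simp⟩, Iso.refl _ _⟩

/-! ## Connectivity of strands -/

/-- The position below a maximum at `i` of the strand `a` above it. -/
def skip (i a : ℕ) : ℕ := if a < i then a else a + 2

/-- The connections above a minimum at `i`, given those below it. -/
def cupS (i : ℕ) (r : Setoid ℕ) : Setoid ℕ where
  r a b := ((a = i ∨ a = i + 1) ∧ (b = i ∨ b = i + 1)) ∨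
    ∃ a' b', a = skip i a' ∧ b = skip i b' ∧ r.r a' b'
  iseqv := by
    have h1 := r.iseqv.refl
    have h2 := @r.iseqv.symm
    have h3 := @r.iseqv.trans
    refine ⟨fun a => ?_, fun {a b} h => ?_, fun {a b c} h h' => ?_⟩
    · by_cases h : a = i ∨ a = i + 1
      · exact Or.inl ⟨h, h⟩
      · refine Or.inr ⟨if a < i then a else a - 2, if a < i then a else a - 2, ?_, ?_, h1 _⟩ <;>
        · unfold skip
          grind
    · grind
    · rcases h with h | ⟨a', b', rfl, rfl, h⟩ <;> rcases h' with h' | ⟨b'', c', e, rfl, h'⟩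
      · exact Or.inl ⟨h.1, h'.2⟩
      · unfold skip at e; grind
      · unfold skip at h'; grind
      · have : b' = b'' := by unfold skip at e; grind
        subst this
        exact Or.inr ⟨a', c', rfl, rfl, h3 h h'⟩

/-- The connections above a maximum at `i`, given those below it. -/
def capS (i : ℕ) (r : Setoid ℕ) : Setoid ℕ where
  r a b := r.r (skip i a) (skip i b) ∨ (r.r (skip i a) i ∧ r.r (i + 1) (skip i b)) ∨
    (r.r (skip i a) (i + 1) ∧ r.r i (skip i b))
  iseqv := by
    have h1 := r.iseqv.refl
    have h2 := @r.iseqv.symm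
    have h3 := @r.iseqv.trans
    refine ⟨fun a => ?_, fun {a b} h => ?_, fun {a b c} h h' => ?_⟩ <;> grind

theorem cupS_skip (i : ℕ) (r : Setoid ℕ) (a b : ℕ) :
    (cupS i r).r (skip i a) (skip i b) ↔ r.r a b := by
  constructor
  · rintro (h | ⟨a', b', h, h', hr⟩)
    · unfold skip at h; grind
    · have h1 : a = a' := by unfold skip at h; grind
      have h2 : b = b' := by unfold skip at h'; grind
      rwa [h1, h2]
  · exact fun h => Or.inr ⟨a, b, rfl, rfl, h⟩

theorem cupS_iff (i : ℕ) (r : Setoid ℕ) (a b : ℕ) :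
    (cupS i r).r a b ↔ ((a = i ∨ a = i + 1) ∧ (b = i ∨ b = i + 1)) ∨
      ((a < i ∨ i + 2 ≤ a) ∧ (b < i ∨ i + 2 ≤ b) ∧
        r.r (if a < i then a else a - 2) (if b < i then b else b - 2)) := by
  constructor
  · rintro (h | ⟨a', b', rfl, rfl, hr⟩)
    · exact Or.inl h
    · right
      unfold skip
      grind
  · rintro (h | ⟨h, h', hr⟩)
    · exact Or.inl h
    · refine Or.inr ⟨_, _, ?_, ?_, hr⟩ <;>
      · unfold skip; grind

theorem capS_iff (i : ℕ) (r : Setoid ℕ) (a b : ℕ) :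
    (capS i r).r a b ↔ r.r (skip i a) (skip i b) ∨ (r.r (skip i a) i ∧ r.r (i + 1) (skip i b)) ∨
    (r.r (skip i a) (i + 1) ∧ r.r i (skip i b)) := Iff.rfl

/-- Writing the relation as equality of labels turns the identities between `cupS` and `capS` into
case distinctions on positions combined with congruence closure. -/
theorem exists_label (r : Setoid ℕ) : ∃ (X : Type) (f : ℕ → X), ∀ a b, r.r a b ↔ f a = f b :=
  ⟨Quotient r, Quotient.mk r, fun _ _ => (Quotient.eq (r := r)).symm⟩

theorem capS_cupS (i : ℕ) (r : Setoid ℕ) : capS i (cupS i r) = r := by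
  obtain ⟨X, f, hf⟩ := exists_label r
  ext a b
  simp only [capS_iff, cupS_iff, hf, skip]
  grind (splits := 40)

theorem capS_cupS_left (i : ℕ) (r : Setoid ℕ) : capS (i + 1) (cupS i r) = r := by
  obtain ⟨X, f, hf⟩ := exists_label r
  ext a b
  simp only [capS_iff, cupS_iff, hf, skip]
  grind (splits := 40)

theorem capS_cupS_right (i : ℕ) (r : Setoid ℕ) : capS i (cupS (i + 1) r) = r := by
  obtain ⟨X, f, hf⟩ := exists_label r
  ext a b
  simp only [capS_iff, cupS_iff, hf, skip]
  grind (splits := 40)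

theorem cupS_cupS (i j : ℕ) (h : i ≤ j) (r : Setoid ℕ) :
    cupS (j + 2) (cupS i r) = cupS i (cupS j r) := by
  obtain ⟨X, f, hf⟩ := exists_label r
  ext a b
  simp only [cupS_iff, hf]
  grind (splits := 40)

theorem capS_cupS_right_of_le (i j : ℕ) (h : i ≤ j) (r : Setoid ℕ) :
    capS (j + 2) (cupS i r) = cupS i (capS j r) := by
  obtain ⟨X, f, hf⟩ := exists_label r
  ext a b
  simp only [cupS_iff, capS_iff, hf, skip]
  grind (splits := 40)

theorem capS_cupS_left_of_le (i j : ℕ) (h : i ≤ j) (r : Setoid ℕ) :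
    cupS j (capS i r) = capS i (cupS (j + 2) r) := by
  obtain ⟨X, f, hf⟩ := exists_label r
  ext a b
  simp only [cupS_iff, capS_iff, hf, skip]
  grind (splits := 40)

theorem capS_capS (i j : ℕ) (h : i ≤ j) (r : Setoid ℕ) :
    capS j (capS i r) = capS i (capS (j + 2) r) := by
  obtain ⟨X, f, hf⟩ := exists_label r
  ext a b
  have e : ∀ a, skip i (skip j a) = skip (j + 2) (skip i a) := by
    intro a; unfold skip; grind
  have e1 : skip i j = j + 2 := by unfold skip; grind
  have e2 : skip i (j + 1) = j + 3 := by unfold skip; grind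
  have e3 : skip (j + 2) i = i := by unfold skip; grind
  have e4 : skip (j + 2) (i + 1) = i + 1 := by unfold skip; grind
  simp only [capS_iff, hf, e, e1, e2, e3, e4]
  grind (splits := 40)

/-! ## The bracket as an operator -/

/-- Functions of the connections between strands. -/
abbrev Fn : Type := Setoid ℕ → LaurentPolynomial ℤ

open Classical in
/-- The contribution of a maximum at `i`: `δ` if it closes a curve. -/
noncomputable def closing (i : ℕ) (r : Setoid ℕ) : LaurentPolynomial ℤ :=
  if r.r i (i + 1) then delta else 1

theorem closing_of_rel {i : ℕ} {r : Setoid ℕ} (h : r.r i (i + 1)) : closing i r = delta :=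
  if_pos h

theorem closing_of_not_rel {i : ℕ} {r : Setoid ℕ} (h : ¬ r.r i (i + 1)) : closing i r = 1 :=
  if_neg h

theorem closing_congr {i j : ℕ} {r s : Setoid ℕ} (h : r.r i (i + 1) ↔ s.r j (j + 1)) :
    closing i r = closing j s := by
  unfold closing
  congr 1
  exact propext h

/-- Effect of a piece on functions. -/
noncomputable def op (i : ℕ) : Piece Unit → Fn → Fn
  | .cup _, φ => fun r => φ (cupS i r)
  | .cap, φ => fun r => closing i r * φ (capS i r)
  | .cross o, φ => fun r => T (sg o) * φ r + T (-sg o) *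
      (closing i r * φ (cupS i (capS i r)))

/-- Effect of a word on functions. -/
noncomputable def ev : List (Slice Unit) → Fn → Fn
  | [], φ => φ
  | s :: w, φ => op s.pos s.piece (ev w φ)

theorem ev_append (v w : List (Slice Unit)) (φ : Fn) : ev (v ++ w) φ = ev v (ev w φ) := by
  induction v with
  | nil => rfl
  | cons s v ih => simp [ev, ih]

theorem op_smul (i : ℕ) (p : Piece Unit) (c : LaurentPolynomial ℤ) (φ : Fn) :
    op i p (c • φ) = c • op i p φ := by
  funext r
  cases p <;> simp [op] <;> ring

theorem op_add (i : ℕ) (p : Piece Unit) (φ ψ : Fn) :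
    op i p (φ + ψ) = op i p φ + op i p ψ := by
  funext r
  cases p <;> simp [op] <;> ring

theorem ev_smul (w : List (Slice Unit)) (c : LaurentPolynomial ℤ) (φ : Fn) :
    ev w (c • φ) = c • ev w φ := by
  induction w with
  | nil => rfl
  | cons s w ih => simp [ev, ih, op_smul]

theorem op_cross (i : ℕ) (o : Bool) (φ : Fn) :
    op i (.cross o) φ = (T (sg o) : LaurentPolynomial ℤ) • φ +
      (T (-sg o) : LaurentPolynomial ℤ) • op i .cap (op i (.cup ()) φ) := by
  funext r
  simp [op]

theorem cupS_self (i : ℕ) (r : Setoid ℕ) : (cupS i r).r i (i + 1) := by simp [cupS_iff]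

theorem op_loop (i : ℕ) (φ : Fn) : op i (.cup ()) (op i .cap φ) = delta • φ := by
  funext r
  simp [op, closing_of_rel (cupS_self i r), capS_cupS]

theorem op_zigzag_left (i : ℕ) (φ : Fn) : op i (.cup ()) (op (i + 1) .cap φ) = φ := by
  funext r
  have : ¬ (cupS i r).r (i + 1) (i + 1 + 1) := by rw [cupS_iff]; omega
  simp only [op, closing_of_not_rel this, capS_cupS_left, one_mul]

theorem op_zigzag_right (i : ℕ) (φ : Fn) : op (i + 1) (.cup ()) (op i .cap φ) = φ := by
  funext r
  have : ¬ (cupS (i + 1) r).r i (i + 1) := by rw [cupS_iff]; omega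
  simp only [op, closing_of_not_rel this, capS_cupS_right, one_mul]

theorem op_cup_cup (i j : ℕ) (h : i ≤ j) (φ : Fn) :
    op i (.cup ()) (op (j + 2) (.cup ()) φ) = op j (.cup ()) (op i (.cup ()) φ) := by
  funext r
  simp only [op, cupS_cupS i j h]

theorem op_cup_cap (i j : ℕ) (h : i ≤ j) (φ : Fn) :
    op i (.cup ()) (op (j + 2) .cap φ) = op j .cap (op i (.cup ()) φ) := by
  funext r
  have : (cupS i r).r (j + 2) (j + 2 + 1) ↔ r.r j (j + 1) := by
    have h1 := cupS_skip i r j (j + 1)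
    rwa [show skip i j = j + 2 by unfold skip; grind,
      show skip i (j + 1) = j + 2 + 1 by unfold skip; grind] at h1
  simp only [op, capS_cupS_right_of_le i j h, closing_congr this]

theorem op_cap_cup (i j : ℕ) (h : i ≤ j) (φ : Fn) :
    op i .cap (op j (.cup ()) φ) = op (j + 2) (.cup ()) (op i .cap φ) := by
  funext r
  have : (cupS (j + 2) r).r i (i + 1) ↔ r.r i (i + 1) := by
    have h1 := cupS_skip (j + 2) r i (i + 1)
    rwa [show skip (j + 2) i = i by unfold skip; grind,
      show skip (j + 2) (i + 1) = i + 1 by unfold skip; grind] at h1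
  simp only [op, capS_cupS_left_of_le i j h, closing_congr this]

/-- If the two maxima together close one curve, the factor `δ` belongs to whichever of them is
higher. Hence only the product of the two factors is independent of the order. -/
theorem op_cap_cap (i j : ℕ) (h : i ≤ j) (φ : Fn) :
    op i .cap (op j .cap φ) = op (j + 2) .cap (op i .cap φ) := by
  funext r
  obtain ⟨X, f, hf⟩ := exists_label r
  have e1 : skip i j = j + 2 := by unfold skip; grind
  have e2 : skip i (j + 1) = j + 3 := by unfold skip; grind
  have e3 : skip (j + 2) i = i := by unfold skip; grind
  have e4 : skip (j + 2) (i + 1) = i + 1 := by unfold skip; grind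
  have k1 : (capS i r).r j (j + 1) ↔ f (j + 2) = f (j + 3) ∨
      (f (j + 2) = f i ∧ f (i + 1) = f (j + 3)) ∨ (f (j + 2) = f (i + 1) ∧ f i = f (j + 3)) := by
    simp only [capS_iff, hf, e1, e2]
  have k2 : (capS (j + 2) r).r i (i + 1) ↔ f i = f (i + 1) ∨
      (f i = f (j + 2) ∧ f (j + 3) = f (i + 1)) ∨ (f i = f (j + 3) ∧ f (j + 2) = f (i + 1)) := by
    simp only [capS_iff, hf, e3, e4]
  have k : closing i r * closing j (capS i r) =
      closing (j + 2) r * closing i (capS (j + 2) r) := by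
    have h1 := hf i (i + 1)
    have h2 := hf (j + 2) (j + 2 + 1)
    unfold closing
    by_cases c1 : f i = f (i + 1)
    · by_cases c2 : f (j + 2) = f (j + 3)
      · rw [if_pos (h1.2 c1), if_pos (h2.2 c2), if_pos (k1.2 (Or.inl c2)),
          if_pos (k2.2 (Or.inl c1))]
      · rw [if_pos (h1.2 c1), if_neg (h2.not.2 c2), if_neg (k1.not.2 (by grind)),
          if_pos (k2.2 (Or.inl c1)), mul_one, one_mul]
    · by_cases c2 : f (j + 2) = f (j + 3)
      · rw [if_neg (h1.not.2 c1), if_pos (h2.2 c2), if_pos (k1.2 (Or.inl c2)),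
          if_neg (k2.not.2 (by grind)), mul_one, one_mul]
      · have : (capS i r).r j (j + 1) ↔ (capS (j + 2) r).r i (i + 1) := by
          rw [k1, k2]; grind
        rw [if_neg (h1.not.2 c1), if_neg (h2.not.2 c2)]
        exact congrArg _ (closing_congr this)
  simp only [op, capS_capS i j h, ← mul_assoc, k]

/-- A crossing is a linear combination of the identity and a maximum below a minimum, so the
commutation of minima and maxima implies all the other cases. -/
theorem op_exchange (p q : Piece Unit) (i j : ℕ) (h : i ≤ j) (φ : Fn) :
    op i p (op (j + p.top) q φ) = op (j + p.bot) q (op i p φ) := by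
  have base : ∀ p q : Piece Unit, (∀ o, p ≠ .cross o) → (∀ o, q ≠ .cross o) → ∀ j, i ≤ j → ∀ φ,
      op i p (op (j + p.top) q φ) = op (j + p.bot) q (op i p φ) := by
    intro p q hp hq j h φ
    cases p with
    | cross o => exact absurd rfl (hp o)
    | cup a =>
      cases q with
      | cross o => exact absurd rfl (hq o)
      | cup b => exact op_cup_cup i j h φ
      | cap => exact op_cup_cap i j h φ
    | cap =>
      cases q with
      | cross o => exact absurd rfl (hq o)
      | cup b => exact op_cap_cup i j h φ
      | cap => exact op_cap_cap i j h φ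
  have right : ∀ p q : Piece Unit, (∀ o, p ≠ .cross o) → ∀ j, i ≤ j → ∀ φ,
      op i p (op (j + p.top) q φ) = op (j + p.bot) q (op i p φ) := by
    intro p q hp j h φ
    cases q with
    | cup b => exact base p _ hp (by simp) j h φ
    | cap => exact base p _ hp (by simp) j h φ
    | cross o =>
      simp only [op_cross, op_add, op_smul]
      rw [base p .cap hp (by simp) j h, base p (.cup ()) hp (by simp) j h]
  cases p with
  | cup b => exact right _ q (by simp) j h φ
  | cap => exact right _ q (by simp) j h φ
  | cross o =>
    simp only [op_cross, op_add, op_smul, Piece.top_cross, Piece.bot_cross]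
    have h1 := right (.cup ()) q (by simp) j h φ
    have h2 := right .cap q (by simp) j h (op i (.cup ()) φ)
    simp only [Piece.top_cup, Piece.bot_cup, Piece.top_cap, Piece.bot_cap, add_zero] at h1 h2
    rw [h1, h2]

theorem T_mul_T_neg (k : ℤ) : (T k * T (-k) : LaurentPolynomial ℤ) = 1 := by
  rw [← T_add, add_neg_cancel, T_zero]

theorem op_slide_cup (i : ℕ) (o : Bool) (φ : Fn) :
    op i (.cup ()) (op (i + 1) (.cross o) φ) = op (i + 1) (.cup ()) (op i (.cross !o) φ) := by
  simp only [op_cross, op_add, op_smul, op_zigzag_left, op_zigzag_right, sg_not, neg_neg]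
  exact add_comm _ _

theorem op_slide_cap (i : ℕ) (o : Bool) (φ : Fn) :
    op (i + 1) (.cross o) (op i .cap φ) = op i (.cross !o) (op (i + 1) .cap φ) := by
  simp only [op_cross, op_zigzag_left, op_zigzag_right, sg_not, neg_neg]
  exact add_comm _ _

theorem delta_eq (o : Bool) : delta = -T (2 * sg o) - T (-2 * sg o) := by
  cases o
  · simp [delta, sg]
  · simp [delta, sg]; ring

theorem T_mul_delta_add (o : Bool) :
    T (sg o) * delta + T (-sg o) = (-T (3 * sg o) : LaurentPolynomial ℤ) := by
  rw [delta_eq o]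
  have h1 : (T (3 * sg o) : LaurentPolynomial ℤ) = T (sg o) * T (2 * sg o) := by
    rw [← T_add]; congr 1; ring
  have h2 : (T (-sg o) : LaurentPolynomial ℤ) = T (sg o) * T (-2 * sg o) := by
    rw [← T_add]; congr 1; ring
  rw [h1, h2]; ring

theorem op_reidemeister_one_right (i : ℕ) (o : Bool) (φ : Fn) :
    op (i + 1) (.cup ()) (op i (.cross o) (op (i + 1) .cap φ)) = (-T (3 * sg o) : LaurentPolynomial ℤ) • φ := by
  simp only [op_cross, op_add, op_smul, op_zigzag_left, op_zigzag_right, op_loop, smul_smul,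
    ← add_smul, T_mul_delta_add]

theorem op_reidemeister_one_left (i : ℕ) (o : Bool) (φ : Fn) :
    op i (.cup ()) (op (i + 1) (.cross o) (op i .cap φ)) = (-T (3 * sg o) : LaurentPolynomial ℤ) • φ := by
  simp only [op_cross, op_add, op_smul, op_zigzag_left, op_zigzag_right, op_loop, smul_smul,
    ← add_smul, T_mul_delta_add]

/-- The coefficient of `≍` is `A² + A⁻² + δ = 0`. -/
theorem op_reidemeister_two (i : ℕ) (o : Bool) (φ : Fn) :
    op i (.cross o) (op i (.cross !o) φ) = φ := by
  have h1 : (T (-sg o) * T (sg o) : LaurentPolynomial ℤ) = 1 := by rw [mul_comm, T_mul_T_neg]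
  have h2 : T (-sg o) * T (-sg o) + (T (sg o) * T (sg o) + T (sg o) * (T (-sg o) * delta)) =
      (0 : LaurentPolynomial ℤ) := by
    rw [← mul_assoc, T_mul_T_neg, one_mul, ← T_add, ← T_add, delta_eq o,
      show 2 * sg o = sg o + sg o by ring, show -2 * sg o = -sg o + -sg o by ring]
    ring
  simp only [op_cross, op_add, op_smul, op_loop, sg_not, neg_neg, smul_add, smul_smul]
  rw [add_assoc, ← add_smul, ← add_smul, h1, h2, one_smul, zero_smul, add_zero]

/-- Kauffman's argument: one crossing is expanded on each side. The terms `)(` agree literally, and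
in the terms `≍` the remaining two crossings slide off by the second Reidemeister move. -/
theorem op_reidemeister_three (i : ℕ) (o : Bool) (φ : Fn) :
    op i (.cross o) (op (i + 1) (.cross o) (op i (.cross o) φ)) =
      op (i + 1) (.cross o) (op i (.cross o) (op (i + 1) (.cross o) φ)) := by
  have h1 : ∀ ψ, op i (.cup ()) (op (i + 1) (.cross o) (op i (.cross o) ψ)) =
      op (i + 1) (.cup ()) ψ := by
    intro ψ
    rw [op_slide_cup]
    congr 1
    simpa using op_reidemeister_two i (!o) ψ
  have h2 : ∀ ψ, op (i + 1) (.cross o) (op i (.cross o) (op (i + 1) .cap ψ)) = op i .cap ψ := by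
    intro ψ
    have := op_slide_cap i (!o) ψ
    rw [Bool.not_not] at this
    rw [← this]
    simpa using op_reidemeister_two (i + 1) o (op i .cap ψ)
  conv_lhs => rw [op_cross i o (op (i + 1) (.cross o) (op i (.cross o) φ)), h1]
  conv_rhs => rw [op_cross (i + 1) o φ]
  simp only [op_add, op_smul, h2]

/-- The units `±Aᵏ`. -/
def IsMonomial (c : LaurentPolynomial ℤ) : Prop := ∃ (e : ℤˣ) (k : ℤ), c = C (e : ℤ) * T k

theorem IsMonomial.one : IsMonomial 1 := ⟨1, 0, by simp⟩

theorem IsMonomial.neg_T (k : ℤ) : IsMonomial (-T k) := ⟨-1, k, by simp⟩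

theorem IsMonomial.mul {c d : LaurentPolynomial ℤ} (hc : IsMonomial c) (hd : IsMonomial d) :
    IsMonomial (c * d) := by
  obtain ⟨e, k, rfl⟩ := hc
  obtain ⟨f, l, rfl⟩ := hd
  refine ⟨e * f, k + l, ?_⟩
  rw [T_add, Units.val_mul, map_mul]; ring

theorem IsMonomial.exists_inv {c : LaurentPolynomial ℤ} (hc : IsMonomial c) :
    ∃ d, IsMonomial d ∧ d * c = 1 := by
  obtain ⟨e, k, rfl⟩ := hc
  refine ⟨C (e : ℤ) * T (-k), ⟨e, -k, rfl⟩, ?_⟩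
  calc C (e : ℤ) * T (-k) * (C (e : ℤ) * T k) = C ((e * e : ℤˣ) : ℤ) * (T (-k) * T k) := by
        rw [Units.val_mul, map_mul]; ring
    _ = 1 := by rw [Int.units_mul_self, ← T_add]; simp

/-- Only the first Reidemeister move contributes a unit other than `1`, namely `-A³` or `-A⁻³`. -/
theorem ev_move {x y : List (Slice Bool)} (m : Move x y) :
    ∃ c, IsMonomial c ∧ ∀ φ, ev (forget x) φ = c • ev (forget y) φ := by
  cases m with
  | exchange p q i j h =>
    refine ⟨1, .one, fun φ => ?_⟩
    have := op_exchange p.forget q.forget i j h φ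
    simpa [ev] using this
  | zigzag_left i b => exact ⟨1, .one, fun φ => by simpa [ev, Piece.forget] using op_zigzag_left i φ⟩
  | zigzag_right i b => exact ⟨1, .one, fun φ => by simpa [ev, Piece.forget] using op_zigzag_right i φ⟩
  | slide_cup i b o => exact ⟨1, .one, fun φ => by simpa [ev, Piece.forget] using op_slide_cup i o φ⟩
  | slide_cap i o => exact ⟨1, .one, fun φ => by simpa [ev, Piece.forget] using op_slide_cap i o φ⟩
  | reidemeister_one_right i b o =>
    exact ⟨_, .neg_T _, fun φ => by simpa [ev, Piece.forget] using op_reidemeister_one_right i o φ⟩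
  | reidemeister_one_left i b o =>
    exact ⟨_, .neg_T _, fun φ => by simpa [ev, Piece.forget] using op_reidemeister_one_left i o φ⟩
  | reidemeister_two i o => exact ⟨1, .one, fun φ => by simpa [ev, Piece.forget] using op_reidemeister_two i o φ⟩
  | reidemeister_three i o =>
    exact ⟨1, .one, fun φ => by simpa [ev, Piece.forget] using op_reidemeister_three i o φ⟩

/-! ## Comparison with the state sum -/

/-- The connections recorded by a list of labels. -/
def relOf (l : List ℕ) : Setoid ℕ where
  r a b := a = b ∨ (a < l.length ∧ l[a]? = l[b]?)
  iseqv := by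
    refine ⟨fun a => Or.inl rfl, fun {a b} h => ?_, fun {a b c} h h' => ?_⟩
    · rcases h with h | ⟨h, h'⟩
      · exact Or.inl h.symm
      · refine Or.inr ⟨?_, h'.symm⟩
        by_contra hb
        rw [List.getElem?_eq_none (by omega : l.length ≤ b), List.getElem?_eq_none_iff] at h'
        omega
    · rcases h with rfl | ⟨h1, h2⟩
      · exact h'
      · rcases h' with rfl | ⟨h3, h4⟩
        · exact Or.inr ⟨h1, h2⟩
        · exact Or.inr ⟨h1, h2.trans h4⟩

theorem relOf_nil : relOf [] = ⊥ := by
  ext a b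
  change (a = b ∨ _) ↔ a = b
  simp

theorem relOf_cup (i m : ℕ) (l : List ℕ) (hi : i ≤ l.length) (hm : ∀ x ∈ l, x < m) :
    relOf (l.take i ++ m :: m :: l.drop i) = cupS i (relOf l) := by
  have key : ∀ a, (l.take i ++ m :: m :: l.drop i)[a]? =
      if a < i then l[a]? else if a = i ∨ a = i + 1 then some m else l[a - 2]? := by
    intro a
    by_cases h : a < i
    · rw [if_pos h, List.getElem?_append_left (by simp; omega), List.getElem?_take_of_lt h]
    · rw [if_neg h, List.getElem?_append_right (by simp; omega), List.length_take_of_le hi]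
      obtain ⟨k, rfl⟩ := Nat.exists_eq_add_of_le (not_lt.1 h)
      rcases k with _ | _ | k
      · simp
      · simp
      · have e : i + (k + 1 + 1) - 2 = i + k := by omega
        simp [e]
  have hf : ∀ k : ℕ, l[k]? ≠ some m := by
    intro k hk
    exact lt_irrefl _ (hm m (List.mem_of_getElem? hk))
  ext a b
  change (a = b ∨ (a < (l.take i ++ m :: m :: l.drop i).length ∧ _)) ↔ (cupS i (relOf l)).r a b
  rw [cupS_iff, key, key]
  change _ ↔ _ ∨ (_ ∧ _ ∧ (_ ∨ _ ∧ _))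
  simp only [List.length_append, List.length_cons, List.length_take_of_le hi, List.length_drop]
  have := hf (a - 2)
  have := hf a
  have := hf b
  have := hf (b - 2)
  grind (splits := 40)

theorem relOf_cap (i : ℕ) (l : List ℕ) (x y : ℕ) (r : List ℕ)
    (h : l.drop i = x :: y :: r) :
    relOf ((l.take i ++ r).map fun z => if z = y then x else z) = capS i (relOf l) := by
  have hlen := congrArg List.length h
  simp only [List.length_drop, List.length_cons] at hlen
  have hx : l[i]? = some x := by
    have := congrArg (·[0]?) h
    simpa using this
  have hy : l[i + 1]? = some y := by
    have := congrArg (·[1]?) h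
    simpa using this
  have hr : ∀ k, r[k]? = l[i + (k + 2)]? := by
    intro k
    have := congrArg (·[k + 2]?) h
    simpa using this.symm
  have key : ∀ a, (l.take i ++ r)[a]? = l[skip i a]? := by
    intro a
    unfold skip
    by_cases h : a < i
    · rw [if_pos h, List.getElem?_append_left (by simp; omega), List.getElem?_take_of_lt h]
    · rw [if_neg h, List.getElem?_append_right (by simp; omega),
        List.length_take_of_le (by omega), hr]
      congr 1; omega
  ext a b
  change (a = b ∨ (a < ((l.take i ++ r).map _).length ∧ _)) ↔
    (_ ∨ _ ∧ _) ∨ ((_ ∨ _ ∧ _) ∧ (_ ∨ _ ∧ _)) ∨ ((_ ∨ _ ∧ _) ∧ (_ ∨ _ ∧ _))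
  simp only [List.getElem?_map, key, List.length_map, List.length_append,
    List.length_take_of_le (by omega : i ≤ l.length), hx, hy]
  have s1 : ∀ a, a < i + r.length ↔ skip i a < l.length := by
    intro a; unfold skip; grind
  have s2 : ∀ a, skip i a ≠ i := by intro a; unfold skip; grind
  have s3 : ∀ a, skip i a ≠ i + 1 := by intro a; unfold skip; grind
  have s4 : skip i a = skip i b ↔ a = b := by unfold skip; grind
  have s5 : ∀ c, c < l.length ↔ ∃ v, l[c]? = some v := by
    intro c
    constructor
    · exact fun hc => ⟨l[c], List.getElem?_eq_getElem hc⟩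
    · rintro ⟨v, hv⟩
      by_contra hc
      rw [List.getElem?_eq_none (by omega)] at hv
      simp at hv
  rw [s4, s1]
  simp only [s2, (s2 _).symm, s3, (s3 _).symm, false_or]
  by_cases hab : a = b
  · simp [hab]
  · simp only [hab, false_or]
    have hi1 : i + 1 < l.length := by omega
    have hi0 : i < l.length := by omega
    simp only [hi0, hi1, true_and]
    cases hA : l[skip i a]? with
    | none =>
      have : ¬ skip i a < l.length := by rw [s5]; simp [hA]
      simp [this]
    | some u =>
      have : skip i a < l.length := by rw [s5]; simp [hA]
      simp only [this, true_and]
      cases hB : l[skip i b]? with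
      | none => simp
      | some v => 
        simp only [Option.map_some, Option.some.injEq]
        grind

/-- The word fits on `n` strands. -/
def Fits : List (Slice Unit) → ℕ → Prop
  | [], _ => True
  | s :: w, n => s.pos + s.piece.bot ≤ n ∧ Fits w (n + s.piece.top - s.piece.bot)

theorem fits_of_run {w : List (Slice Bool)} {l : List Bool} (h : (run w l).isSome) :
    Fits (forget w) l.length := by
  induction w generalizing l with
  | nil => trivial
  | cons s w ih =>
    rw [forget_cons]
    simp only [run] at h
    cases h1 : s.act l with
    | none => simp [h1] at h
    | some l' =>
      have h2 := act_length h1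
      simp only [h1, Option.bind_some] at h
      have := ih h
      refine ⟨by simpa using h2.2, ?_⟩
      simp only [Piece.top_forget, Piece.bot_forget]
      rwa [← h2.1, Nat.add_sub_cancel] 

/-- The state sum, over strands with given labels. -/
noncomputable def stateSum (w : List (Slice Unit)) (l : List ℕ) (m : ℕ) : LaurentPolynomial ℤ :=
  ((states w).map fun σ => T σ.1 * delta ^ loopsAux σ.2 l m).sum

theorem stateSum_cup (i : ℕ) (w l m) : stateSum (cup i :: w) l m =
    stateSum w (l.take i ++ m :: m :: l.drop i) (m + 1) := by
  simp [stateSum, states, Function.comp_def, loopsAux]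

theorem stateSum_cap (i : ℕ) (w l m x y r) (h : l.drop i = x :: y :: r) :
    stateSum (cap i :: w) l m = if x = y then delta * stateSum w (l.take i ++ r) m else
      stateSum w ((l.take i ++ r).map fun z => if z = y then x else z) m := by
  simp only [stateSum, states, List.map_map, Function.comp_def, loopsAux, h]
  split_ifs
  · simp only [pow_succ, ← List.sum_map_mul_left]
    congr 2
    funext σ
    ring
  · rfl

theorem stateSum_cross (i : ℕ) (o : Bool) (w l m) : stateSum (crs o i :: w) l m =
    T (sg o) * stateSum w l m + T (-sg o) * stateSum (cap i :: cup i :: w) l m := by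
  simp only [stateSum, states, List.map_append, List.map_map, List.sum_append, Function.comp_def,
    ← List.sum_map_mul_left]
  congr 3
  · funext σ
    rw [← mul_assoc, ← T_add]
    congr 2
    cases o <;> simp [sg, add_comm]
  · funext σ
    rw [← mul_assoc, ← T_add]
    congr 2
    cases o <;> simp [sg, add_comm]

/-- Both sides obey the same recursion over the slices, because the labels enter the count of curves
only through the question which of them are equal. `Fits` excludes the default values of `loopsAux`,
and `m` must exceed all labels so that a new minimum gets a fresh one. -/
theorem stateSum_eq_ev (w : List (Slice Unit)) (l : List ℕ) (m : ℕ) (hw : Fits w l.length)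
    (hm : ∀ x ∈ l, x < m) : stateSum w l m = ev w 1 (relOf l) := by
  induction w generalizing l m with
  | nil => simp [stateSum, states, loopsAux, ev]
  | cons s w ih =>
    obtain ⟨i, p⟩ := s
    obtain ⟨h1, h2⟩ := hw
    -- Minima and maxima are treated for arbitrary labels, as a smoothed crossing uses both in
    -- succession.
    have hcup : ∀ (l : List ℕ) m, i ≤ l.length → Fits w (l.length + 2) → (∀ x ∈ l, x < m) →
        stateSum (cup i :: w) l m = ev (cup i :: w) 1 (relOf l) := by
      intro l m h1 h2 hm
      rw [stateSum_cup, ih, relOf_cup i m l h1 hm]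
      · rfl
      · have e : (l.take i ++ m :: m :: l.drop i).length = l.length + 2 := by simp; omega
        rwa [e]
      · intro x hx
        simp only [List.mem_append, List.mem_cons] at hx
        rcases hx with hx | rfl | rfl | hx
        · exact (hm x (List.mem_of_mem_take hx)).trans (Nat.lt_succ_self _)
        · exact Nat.lt_succ_self _
        · exact Nat.lt_succ_self _
        · exact (hm x (List.mem_of_mem_drop hx)).trans (Nat.lt_succ_self _)
    have hcap : ∀ (v : List (Slice Unit)) (l : List ℕ) m, i + 2 ≤ l.length →
        (∀ (l' : List ℕ), l'.length + 2 = l.length → (∀ x ∈ l', x < m) →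
          stateSum v l' m = ev v 1 (relOf l')) → (∀ x ∈ l, x < m) →
        stateSum (cap i :: v) l m = ev (cap i :: v) 1 (relOf l) := by
      intro v l m h1 hv hm
      have : ∃ x y r, l.drop i = x :: y :: r := by
        rcases h : l.drop i with _ | ⟨x, _ | ⟨y, r⟩⟩
        · have := congrArg List.length h
          simp at this; omega
        · have := congrArg List.length h
          simp at this; omega
        · exact ⟨x, y, r, rfl⟩
      obtain ⟨x, y, r, h⟩ := this
      have hlen := congrArg List.length h
      simp only [List.length_drop, List.length_cons] at hlen
      have hmr : ∀ z ∈ l.take i ++ r, z < m := by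
        intro z hz
        rw [List.mem_append] at hz
        rcases hz with hz | hz
        · exact hm z (List.mem_of_mem_take hz)
        · exact hm z (List.mem_of_mem_drop (i := i) (by rw [h]; simp [hz]))
      have hxm : x < m := hm x (List.mem_of_mem_drop (i := i) (by rw [h]; simp))
      have hx : l[i]? = some x := by
        have := congrArg (·[0]?) h
        simpa using this
      have hy : l[i + 1]? = some y := by
        have := congrArg (·[1]?) h
        simpa using this
      have hrel : (relOf l).r i (i + 1) ↔ x = y := by
        change (i = i + 1 ∨ (i < l.length ∧ l[i]? = l[i + 1]?)) ↔ _
        rw [hx, hy]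
        simp
        omega
      have hcapS := relOf_cap i l x y r h
      rw [stateSum_cap i v l m x y r h]
      change _ = closing i (relOf l) * ev v 1 (capS i (relOf l))
      rw [← hcapS]
      split_ifs with hxy
      · have hid : (fun z => if z = y then x else z) = id := by
          funext z
          by_cases hz : z = y <;> simp [hz, hxy]
        rw [closing_of_rel (hrel.2 hxy), hid, List.map_id, hv _ _ hmr]
        simp; omega
      · rw [closing_of_not_rel (hrel.not.2 hxy), one_mul, hv]
        · simp; omega
        · intro z hz
          rw [List.mem_map] at hz
          obtain ⟨z', hz', rfl⟩ := hz
          split_ifs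
          · exact hxm
          · exact hmr z' hz'
    cases p with
    | cup a => exact hcup l m (by simpa using h1) (by simpa using h2) hm
    | cap =>
      exact hcap w l m (by simpa using h1)
        (fun l' hl' hm' => ih l' m (by simpa [← hl'] using h2) hm') hm
    | cross o =>
      have h1' : i + 2 ≤ l.length := by simpa using h1
      rw [stateSum_cross, ih l m (by simpa using h2) hm, hcap (cup i :: w) l m h1' ?_ hm]
      · simp only [ev]
        rw [op_cross]
        rfl
      · intro l' hl' hm'
        exact hcup l' m (by omega) (by rw [hl']; simpa using h2) hm'

theorem bracket_eq_ev (D : OrientedDiagram) : bracket (forget D.1) = ev (forget D.1) 1 ⊥ := by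
  have := stateSum_eq_ev (forget D.1) [] 0 (fits_of_run (l := []) (by simp [D.2])) (by simp)
  rwa [relOf_nil] at this

/-- The bracket of an oriented link is well defined up to units `±Aᵏ`. -/
theorem exists_bracket_of_link_eq {D E : OrientedDiagram} (h : D.link = E.link) :
    ∃ c, IsMonomial c ∧ bracket (forget D.1) = c * bracket (forget E.1) := by
  have h' := Quot.eqvGen_exact h
  clear h
  induction h' with
  | rel D E h =>
    obtain ⟨u, v, x, y, m, hD, hE⟩ := h
    obtain ⟨c, hc, h⟩ := ev_move m
    refine ⟨c, hc, ?_⟩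
    rw [bracket_eq_ev, bracket_eq_ev, hD, hE]
    simp only [forget_append, ev_append, h, ev_smul]
    rfl
  | refl D => exact ⟨1, .one, by simp⟩
  | symm D E _ ih =>
    obtain ⟨c, hc, h⟩ := ih
    obtain ⟨d, hd, e⟩ := hc.exists_inv
    exact ⟨d, hd, by rw [h, ← mul_assoc, e, one_mul]⟩
  | trans D E F _ _ ih ih' =>
    obtain ⟨c, hc, h⟩ := ih
    obtain ⟨d, hd, h'⟩ := ih'
    exact ⟨c * d, hc.mul hd, by rw [h, h', mul_assoc]⟩

/-! ## The bracket of a pretzel diagram -/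

/-- The powers of `-A⁻⁴`. -/
noncomputable def xp (a : ℤ) : LaurentPolynomial ℤ := C ((a.negOnePow : ℤˣ) : ℤ) * T (-4 * a)

theorem xp_zero : xp 0 = 1 := by simp [xp]

theorem xp_add (a b : ℤ) : xp (a + b) = xp a * xp b := by
  unfold xp
  rw [Int.negOnePow_add, Units.val_mul, map_mul, mul_add, T_add]
  ring

theorem xp_one : xp 1 = -T (-4) := by simp [xp]

theorem xp_neg_one : xp (-1) = -T 4 := by
  simp [xp, Int.negOnePow_neg]

/-- The tangle `w` has bracket `α )( + β ≍`. -/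
def HasTangle (w : List (Slice Unit)) (α β : LaurentPolynomial ℤ) : Prop :=
  ∀ i φ, ev (shift i w) φ = α • φ + β • op i .cap (op i (.cup ()) φ)

/-- Two tangles `)(` side by side enclose a circle, which gives `δ`; `)(` beside `≍` is `)(`, and
`≍` beside `≍` is `≍`. -/
theorem HasTangle.beside {X Y : List (Slice Unit)} {α β α' β' : LaurentPolynomial ℤ}
    (hX : HasTangle X α β) (hY : HasTangle Y α' β') :
    HasTangle (beside X Y) (delta * α * α' + α * β' + α' * β) (β * β') := by
  intro i φ
  have e1 : ev (shift i (PretzelJones.beside X Y)) φ = op (i + 1) (.cup ())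
      (ev (shift i X) (ev (shift (i + 2) Y) (op (i + 1) .cap φ))) := by
    simp [PretzelJones.beside, ev, ev_append, shift_shift]
  rw [e1, hX, hY]
  simp only [op_add, op_smul, op_loop, op_zigzag_right, op_zigzag_left, smul_add, smul_smul]
  rw [op_cup_cap i i le_rfl]
  module

/-- Closing the column by a maximum turns `≍` into `δ` and every crossing into a curl with factor
`-A^(∓3) = A^(±1) x^(±1)`. Hence `Aᵃ + δ β = Aᵃ xᵃ`. -/
theorem HasTangle.column (a : ℤ) : ∃ β, delta * β = T a * (xp a - 1) ∧
    HasTangle (pw 0 a) (T a) β := by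
  obtain ⟨o, n, rfl⟩ := exists_sg a
  rw [pw_eq]
  induction n with
  | zero => exact ⟨0, by simp [xp_zero], fun i φ => by simp [ev]⟩
  | succ n ih =>
    obtain ⟨β, h1, h2⟩ := ih
    have hd := T_mul_delta_add (!o)
    rw [sg_not, neg_neg] at hd
    have e0 : sg o * ((n + 1 : ℕ) : ℤ) = sg o * n + sg o := by push_cast; ring
    have e1 : (T (sg o * ((n + 1 : ℕ) : ℤ)) : LaurentPolynomial ℤ) = T (sg o * n) * T (sg o) := by
      rw [e0, T_add]
    have e2 : T (sg o) * xp (sg o) = (-T (3 * -sg o) : LaurentPolynomial ℤ) := by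
      cases o
      · rw [show sg false = -1 from rfl, xp_neg_one, mul_neg, ← T_add]; norm_num
      · rw [show sg true = 1 from rfl, xp_one, mul_neg, ← T_add]; norm_num
    refine ⟨T (sg o * n) * T (-sg o) + β * (T (sg o) + T (-sg o) * delta), ?_, fun i φ => ?_⟩
    · rw [e1, e0, xp_add]
      linear_combination (T (-sg o) * delta + T (sg o)) * h1 +
        (T (sg o * n) * xp (sg o * n)) * hd - (T (sg o * n) * xp (sg o * n)) * e2
    · have h3 := h2 i φ
      rw [shift_replicate] at h3 ⊢
      rw [List.replicate_succ]
      simp only [ev]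
      rw [h3]
      simp only [op_cross, op_add, op_smul, op_loop, add_zero, e1]
      module

/-- The Laurent polynomial `δ² - 1`. -/
noncomputable def kappa : LaurentPolynomial ℤ := delta ^ 2 - 1

/-- Both `β` and `δ α + β` are multiplicative under `beside`. For one column, `δ β = Aᵃ (xᵃ - 1)`
and `δ (δ α + β) = Aᵃ (xᵃ + κ)`. -/
theorem HasTangle.rowOf (l : List ℤ) (hl : l ≠ []) : ∃ α β, HasTangle (rowOf l) α β ∧
    delta ^ l.length * β = T l.sum * (l.map fun a => xp a - 1).prod ∧
    delta ^ l.length * (delta * α + β) = T l.sum * (l.map fun a => xp a + kappa).prod := by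
  induction l using PretzelJones.rowOf.induct with
  | case1 => exact absurd rfl hl
  | case2 a =>
    obtain ⟨β, h1, h2⟩ := HasTangle.column a
    refine ⟨T a, β, h2, by simpa using h1, ?_⟩
    simp only [List.length_singleton, List.sum_singleton, List.map_cons, List.map_nil,
      List.prod_singleton, pow_one, kappa]
    linear_combination h1
  | case3 a b l ih =>
    obtain ⟨α', β', h3, h4, h5⟩ := ih (by simp)
    obtain ⟨β, h1, h2⟩ := HasTangle.column a
    refine ⟨_, _, h2.beside h3, ?_, ?_⟩
    · rw [List.length_cons, pow_succ, List.sum_cons, T_add, List.map_cons, List.prod_cons]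
      linear_combination (delta ^ (b :: l).length * β') * h1 + (T a * (xp a - 1)) * h4
    · rw [List.length_cons, pow_succ, List.sum_cons, T_add, List.map_cons, List.prod_cons]
      have h1' : delta * (delta * T a + β) = T a * (xp a + kappa) := by
        unfold kappa; linear_combination h1
      linear_combination (delta ^ (b :: l).length * (delta * α' + β')) * h1' +
        (T a * (xp a + kappa)) * h5

/-- The closure of `)(` is one curve and that of `≍` is two, so the bracket is `δ α + δ² β = (δ α +
β) + κ β`. -/
theorem ev_closure (l : List ℤ) (hl : l ≠ []) (r : Setoid ℕ) :
    delta ^ l.length * ev ([cup 0] ++ rowOf l ++ [cap 0]) 1 r =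
      T l.sum * ((l.map fun a => xp a + kappa).prod +
        kappa * (l.map fun a => xp a - 1).prod) := by
  obtain ⟨α, β, h1, h2, h3⟩ := HasTangle.rowOf l hl
  have h4 : ev ([cup 0] ++ rowOf l ++ [cap 0]) 1 = (delta * (α + β * delta)) • (1 : Fn) := by
    have := h1 0 (op 0 .cap 1)
    rw [shift_zero] at this
    simp only [ev_append, ev, this, op_add, op_smul, op_loop, smul_smul]
    module
  rw [h4]
  simp only [Pi.smul_apply, Pi.one_apply, smul_eq_mul, mul_one]
  have hk : delta ^ 2 = kappa + 1 := by unfold kappa; ring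
  linear_combination h3 + kappa * h2 + (delta ^ l.length * β) * hk

theorem exists_bracket_pretzel (D : OrientedDiagram) (l : List ℤ) (hl : l ≠ [])
    (h : forget D.1 = pretzel l) : ∃ c, IsMonomial c ∧
      delta ^ l.length * bracket (forget D.1) = c * ((l.map fun a => xp a + kappa).prod +
        kappa * (l.map fun a => xp a - 1).prod) := by
  obtain ⟨E, hE, hl'⟩ := (Iso.pretzel l hl).link D h
  obtain ⟨c, hc, h1⟩ := exists_bracket_of_link_eq hl'.symm
  refine ⟨c * T l.sum, hc.mul ⟨1, l.sum, by simp⟩, ?_⟩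
  rw [h1, bracket_eq_ev, hE, mul_left_comm, ev_closure l hl, mul_assoc]

/-! ## Width of Laurent polynomials -/

/-- The lowest exponent of `f` is `lo` and the highest one is `lo + d`. -/
def HasWidth (f : LaurentPolynomial ℤ) (d : ℤ) : Prop :=
  ∃ lo, f.coeff lo ≠ 0 ∧ f.coeff (lo + d) ≠ 0 ∧ ∀ k, f.coeff k ≠ 0 → lo ≤ k ∧ k ≤ lo + d

theorem HasWidth.ne_zero {f : LaurentPolynomial ℤ} {d} (h : HasWidth f d) : f ≠ 0 := by
  rintro rfl
  obtain ⟨lo, h, -⟩ := h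
  simp at h

theorem HasWidth.le {f : LaurentPolynomial ℤ} {d i j} (h : HasWidth f d) (hi : f.coeff i ≠ 0)
    (hj : f.coeff j ≠ 0) : j - i ≤ d := by
  obtain ⟨lo, -, -, h⟩ := h
  have := h i hi
  have := h j hj
  omega

theorem HasWidth.unique {f : LaurentPolynomial ℤ} {d e} (h : HasWidth f d) (h' : HasWidth f e) :
    d = e := by
  obtain ⟨lo, h1, h2, -⟩ := id h
  obtain ⟨lo', h1', h2', -⟩ := id h'
  have := h.le h1' h2'
  have := h'.le h1 h2
  omega

theorem exists_hasWidth {f : LaurentPolynomial ℤ} (h : f ≠ 0) : ∃ d, HasWidth f d := by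
  have hs : f.coeff.support.Nonempty := by
    rw [Finsupp.support_nonempty_iff]
    simpa using h
  refine ⟨f.coeff.support.max' hs - f.coeff.support.min' hs, f.coeff.support.min' hs, ?_, ?_, ?_⟩
  · exact Finsupp.mem_support_iff.1 (f.coeff.support.min'_mem hs)
  · rw [add_sub_cancel]
    exact Finsupp.mem_support_iff.1 (f.coeff.support.max'_mem hs)
  · intro k hk
    rw [add_sub_cancel]
    exact ⟨Finset.min'_le _ _ (Finsupp.mem_support_iff.2 hk),
      Finset.le_max' _ _ (Finsupp.mem_support_iff.2 hk)⟩

theorem HasWidth.mul {f g : LaurentPolynomial ℤ} {d e} (hf : HasWidth f d) (hg : HasWidth g e) :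
    HasWidth (f * g) (d + e) := by
  obtain ⟨a, h1, h2, h3⟩ := hf
  obtain ⟨b, h1', h2', h3'⟩ := hg
  have hlo : (f * g).coeff (a + b) = f.coeff a * g.coeff b := by
    -- An extreme exponent of a product arises from a single pair of exponents.
    refine AddMonoidAlgebra.coeff_mul_add_of_uniqueAdd ?_
    intro x y hx hy hxy
    have := h3 x (Finsupp.mem_support_iff.1 hx)
    have := h3' y (Finsupp.mem_support_iff.1 hy)
    omega
  have hhi : (f * g).coeff (a + d + (b + e)) = f.coeff (a + d) * g.coeff (b + e) := by
    refine AddMonoidAlgebra.coeff_mul_add_of_uniqueAdd ?_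
    intro x y hx hy hxy
    have := h3 x (Finsupp.mem_support_iff.1 hx)
    have := h3' y (Finsupp.mem_support_iff.1 hy)
    omega
  refine ⟨a + b, ?_, ?_, ?_⟩
  · rw [hlo]; exact mul_ne_zero h1 h1'
  · rw [show a + b + (d + e) = a + d + (b + e) by ring, hhi]; exact mul_ne_zero h2 h2'
  · intro k hk
    have hk' := AddMonoidAlgebra.support_coeff_mul_subset f g (Finsupp.mem_support_iff.2 hk)
    obtain ⟨x, hx, y, hy, rfl⟩ := Finset.mem_add.1 hk'
    have := h3 x (Finsupp.mem_support_iff.1 hx)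
    have := h3' y (Finsupp.mem_support_iff.1 hy)
    constructor <;> linarith

theorem HasWidth.of_mul {f g : LaurentPolynomial ℤ} {d e} (hf : HasWidth f d)
    (h : HasWidth (f * g) e) : HasWidth g (e - d) := by
  obtain ⟨e', hg⟩ := exists_hasWidth (right_ne_zero_of_mul h.ne_zero)
  have := h.unique (hf.mul hg)
  rwa [this, add_sub_cancel_left]

theorem hasWidth_one : HasWidth 1 0 := by
  refine ⟨0, ?_, ?_, ?_⟩
  · rw [← T_zero]; simp
  · rw [← T_zero]; simp
  · intro k hk
    rw [← T_zero, T_apply] at hk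
    split_ifs at hk <;> simp_all

theorem HasWidth.pow {f : LaurentPolynomial ℤ} {d} (h : HasWidth f d) (n : ℕ) :
    HasWidth (f ^ n) (n * d) := by
  induction n with
  | zero => simpa using hasWidth_one
  | succ n ih =>
    rw [pow_succ]
    convert ih.mul h using 1
    push_cast; ring

theorem coeff_monomial (c n k : ℤ) :
    (C c * T n : LaurentPolynomial ℤ).coeff k = if n = k then c else 0 := by
  rw [← single_eq_C_mul_T, AddMonoidAlgebra.coeff_single, Finsupp.single_apply]

theorem IsMonomial.hasWidth {c : LaurentPolynomial ℤ} (h : IsMonomial c) : HasWidth c 0 := by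
  obtain ⟨e, k, rfl⟩ := h
  refine ⟨k, ?_, ?_, ?_⟩
  · rw [coeff_monomial, if_pos rfl]; exact e.ne_zero
  · rw [coeff_monomial, if_pos (by ring)]; exact e.ne_zero
  · intro j hj
    rw [coeff_monomial] at hj
    split_ifs at hj <;> simp_all

theorem hasWidth_delta : HasWidth delta 4 := by
  refine ⟨-2, ?_, ?_, ?_⟩
  · simp [delta]
  · simp [delta]
  · intro k hk
    simp only [delta, AddMonoidAlgebra.coeff_sub, AddMonoidAlgebra.coeff_neg, Finsupp.sub_apply,
      Finsupp.neg_apply, T_apply] at hk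
    split_ifs at hk <;> omega

/-- The substitution of `-A⁻⁴` for the variable. -/
noncomputable def subst : LaurentPolynomial ℤ →+* LaurentPolynomial ℤ :=
  eval₂ C ⟨xp 1, xp (-1), by rw [← xp_add]; exact xp_zero, by rw [← xp_add]; exact xp_zero⟩

theorem subst_C (c : ℤ) : subst (C c) = C c := by simp [subst]

theorem subst_T (a : ℤ) : subst (T a) = xp a := by
  induction a with
  | zero => rw [T_zero, map_one, xp_zero]
  | succ n ih => rw [T_add, map_mul, ih, xp_add]; congr 1; simp [subst]
  | pred n ih =>
    rw [sub_eq_add_neg, T_add, map_mul, ih, xp_add]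
    congr 1
    simp [subst]

theorem coeff_subst (f : LaurentPolynomial ℤ) (k : ℤ) : (subst f).coeff k =
    if 4 ∣ k then ((-k / 4).negOnePow : ℤˣ) * f.coeff (-k / 4) else 0 := by
  induction f using LaurentPolynomial.induction_on' with
  | add p q hp hq =>
    rw [map_add, AddMonoidAlgebra.coeff_add, Finsupp.add_apply, hp, hq, AddMonoidAlgebra.coeff_add,
      Finsupp.add_apply]
    split_ifs <;> ring
  | C_mul_T n a =>
    rw [map_mul, subst_C, subst_T, xp, ← mul_assoc, ← map_mul, coeff_monomial, coeff_monomial]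
    by_cases h : 4 ∣ k
    · obtain ⟨j, rfl⟩ := h
      have : -(4 * j) / 4 = -j := by omega
      rw [if_pos (Dvd.intro _ rfl), this]
      by_cases hn : n = -j
      · subst hn
        simp [mul_comm]
      · rw [if_neg (by omega), if_neg hn, mul_zero]
    · rw [if_neg h, if_neg]
      rintro rfl
      exact h ⟨-n, by ring⟩

theorem HasWidth.of_subst {f : LaurentPolynomial ℤ} {d : ℤ} (h : HasWidth (subst f) (4 * d)) :
    HasWidth f d := by
  have key : ∀ k, (subst f).coeff k ≠ 0 → ∃ e, k = -4 * e ∧ f.coeff e ≠ 0 := by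
    intro k hk
    rw [coeff_subst] at hk
    split_ifs at hk with h4
    · obtain ⟨j, rfl⟩ := h4
      have : -(4 * j) / 4 = -j := by omega
      rw [this] at hk
      exact ⟨-j, by ring, right_ne_zero_of_mul hk⟩
    · exact absurd rfl hk
  have key' : ∀ e, f.coeff e ≠ 0 → (subst f).coeff (-4 * e) ≠ 0 := by
    intro e he
    rw [coeff_subst, if_pos ⟨-e, by ring⟩, show -(-4 * e) / 4 = e by omega]
    exact mul_ne_zero (Units.ne_zero _) he
  obtain ⟨lo, h1, h2, h3⟩ := h
  obtain ⟨a, ha, ha'⟩ := key _ h1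
  obtain ⟨b, hb, hb'⟩ := key _ h2
  have hab : a = b + d := by omega
  subst hab
  refine ⟨b, hb', ha', fun k hk => ?_⟩
  have := h3 _ (key' k hk)
  omega

/-- The Laurent polynomial `1 - x - x⁻¹`. -/
noncomputable def kap : LaurentPolynomial ℤ := 1 - T 1 - T (-1)

theorem subst_kap : subst kap = kappa := by
  simp only [kap, map_sub, map_one, subst_T, xp_one, xp_neg_one, kappa, delta]
  have h1 : (T 4 : LaurentPolynomial ℤ) = T 2 * T 2 := by rw [← T_add]; norm_num
  have h2 : (T (-4) : LaurentPolynomial ℤ) = T (-2) * T (-2) := by rw [← T_add]; norm_num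
  have h3 : (T (-2) * T 2 : LaurentPolynomial ℤ) = 1 := by rw [← T_add]; simp
  rw [h1, h2]
  linear_combination -2 * h3

/-- The normalized bracket of a pretzel diagram in the variable `x = -A⁻⁴`. -/
noncomputable def pretzelPoly (l : List ℤ) : LaurentPolynomial ℤ :=
  (l.map fun a => T a + kap).prod + kap * (l.map fun a => T a - 1).prod

theorem subst_pretzelPoly (l : List ℤ) : subst (pretzelPoly l) =
    (l.map fun a => xp a + kappa).prod + kappa * (l.map fun a => xp a - 1).prod := by
  simp [pretzelPoly, map_list_prod, subst_kap, subst_T, Function.comp_def]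

/-! ### From the span of the Jones polynomial to the width of `pretzelPoly` -/

theorem hasWidth_of_hasSpan {D : OrientedDiagram} {S : ℕ} (h : HasSpan D.jones (S : ℚ)) :
    HasWidth (bracket (forget D.1)) (4 * S) := by
  have hinj : Function.Injective (fun k : ℤ => -(k : ℚ) / 4) := by
    intro a b hab
    simp only at hab
    have : (a : ℚ) = b := by linarith
    exact_mod_cast this
  have hw : HasWidth (C ((Int.negOnePow (-3 * D.writhe) : ℤˣ) : ℤ) * T (-3 * D.writhe) *
      bracket (forget D.1)) (4 * S) := by
    obtain ⟨lo, hi, ⟨h1, h2⟩, ⟨h3, h4⟩, h5⟩ := h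
    unfold OrientedDiagram.jones at h1 h2 h3 h4
    set f := C ((Int.negOnePow (-3 * D.writhe) : ℤˣ) : ℤ) * T (-3 * D.writhe) *
      bracket (forget D.1)
    have key : ∀ q, (AddMonoidAlgebra.mapDomain (fun k : ℤ => -(k : ℚ) / 4) f).coeff q ≠ 0 →
        ∃ k : ℤ, q = -(k : ℚ) / 4 ∧ f.coeff k ≠ 0 := by
      intro q hq
      by_cases hr : q ∈ Set.range (fun k : ℤ => -(k : ℚ) / 4)
      · obtain ⟨k, rfl⟩ := hr
        refine ⟨k, rfl, ?_⟩
        rw [AddMonoidAlgebra.coeff_mapDomain] at hq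
        rwa [Finsupp.mapDomain_apply hinj] at hq
      · rw [AddMonoidAlgebra.coeff_mapDomain, Finsupp.mapDomain_of_notMem_range _ _ hr] at hq
        exact absurd rfl hq
    have key' : ∀ k : ℤ, f.coeff k ≠ 0 →
        (AddMonoidAlgebra.mapDomain (fun k : ℤ => -(k : ℚ) / 4) f).coeff (-(k : ℚ) / 4) ≠ 0 := by
      intro k hk
      rw [AddMonoidAlgebra.coeff_mapDomain]
      exact (Finsupp.mapDomain_apply hinj f.coeff k).trans_ne hk
    -- The substitution `k ↦ -k / 4` reverses the order: the lowest exponent of `t` belongs to the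
    -- highest exponent of `A`.
    obtain ⟨a, rfl, ha⟩ := key _ h1
    obtain ⟨b, rfl, hb⟩ := key _ h3
    have hab : a = b + 4 * S := by
      have : (a : ℚ) = ((b + 4 * S : ℤ) : ℚ) := by push_cast; linarith
      exact_mod_cast this
    refine ⟨b, hb, hab ▸ ha, fun k hk => ?_⟩
    have i1 := h2 (key' k hk)
    have i2 := h4 (key' k hk)
    constructor
    · have : (b : ℚ) ≤ k := by linarith
      exact_mod_cast this
    · rw [← hab]
      have : (k : ℚ) ≤ a := by linarith
      exact_mod_cast this
  have := IsMonomial.hasWidth ⟨Int.negOnePow (-3 * D.writhe), -3 * D.writhe, rfl⟩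
  simpa using this.of_mul hw

/-- The span of the Jones polynomial of a pretzel link, computed from `pretzelPoly`. -/
theorem hasWidth_pretzelPoly {D E : OrientedDiagram} {S : ℕ} {l : List ℤ} (hl : l ≠ [])
    (hE : forget E.1 = pretzel l) (h : D.link = E.link) (hS : HasSpan D.jones (S : ℚ)) :
    HasWidth (pretzelPoly l) (S + l.length) := by
  obtain ⟨c, hc, h1⟩ := exists_bracket_of_link_eq h
  obtain ⟨d, hd, h2⟩ := exists_bracket_pretzel E l hl hE
  have h3 := hasWidth_of_hasSpan hS
  rw [h1] at h3
  -- In `A` the width is `4 S + 4 n`, which is `S + n` in `x = -A⁻⁴`.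
  have h4 := (hasWidth_delta.pow l.length).mul (hc.hasWidth.of_mul h3)
  rw [h2] at h4
  have h5 := hd.hasWidth.of_mul h4
  rw [← subst_pretzelPoly] at h5
  refine HasWidth.of_subst ?_
  convert h5 using 1
  ring

/-! ## Lowest coefficients of some polynomials -/

section
open Polynomial

theorem mul_coeff_two (f g : ℤ[X]) : (f * g).coeff 2 =
    f.coeff 0 * g.coeff 2 + f.coeff 1 * g.coeff 1 + f.coeff 2 * g.coeff 0 := by
  rw [Polynomial.coeff_mul]
  simp [Finset.Nat.antidiagonal_succ]
  ring

theorem mul_coeff_three (f g : ℤ[X]) : (f * g).coeff 3 =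
    f.coeff 0 * g.coeff 3 + f.coeff 1 * g.coeff 2 + f.coeff 2 * g.coeff 1 +
      f.coeff 3 * g.coeff 0 := by
  rw [Polynomial.coeff_mul]
  simp [Finset.Nat.antidiagonal_succ]
  ring

/-- The polynomial `1 - y + y²`. -/
noncomputable def phi : ℤ[X] := 1 - X + X ^ 2

theorem phi_coeff_zero : phi.coeff 0 = 1 := by simp [phi]
theorem phi_coeff_one : phi.coeff 1 = -1 := by simp [phi, coeff_one, coeff_X]
theorem phi_coeff_two : phi.coeff 2 = 1 := by simp [phi, coeff_one, coeff_X]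

/-- The normalized product of the `x ^ a + κ`, for `a ∈ ps` and `-a ∈ bs`. -/
noncomputable def polyA (ps bs : List ℕ) : ℤ[X] :=
  (ps.map fun a => 1 - X ^ (a - 1) * phi).prod * (bs.map fun b => phi - X ^ (b + 1)).prod

/-- The normalized product of `κ` and the `x ^ a - 1`, for `a ∈ ps` and `-a ∈ bs`. -/
noncomputable def polyB (ps bs : List ℕ) : ℤ[X] :=
  phi * (ps.map fun a => 1 - X ^ a).prod * (bs.map fun b => 1 - X ^ b).prod

theorem list_prod_coeff (l : List ℕ) (f : ℕ → ℤ[X]) (c : ℕ → ℤ)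
    (h0 : ∀ a ∈ l, (f a).coeff 0 = 1) (h1 : ∀ a ∈ l, (f a).coeff 1 = c a) :
    (l.map f).prod.coeff 0 = 1 ∧ (l.map f).prod.coeff 1 = (l.map c).sum := by
  induction l with
  | nil => simp [coeff_one]
  | cons a l ih =>
    have := ih (fun a ha => h0 a (List.mem_cons_of_mem _ ha))
      (fun a ha => h1 a (List.mem_cons_of_mem _ ha))
    simp only [List.map_cons, List.prod_cons, List.sum_cons, mul_coeff_zero, mul_coeff_one,
      this.1, this.2, h0 a (by simp), h1 a (by simp)]
    constructor <;> ring

/-- These two coefficients and those of `polyB` decide how far the extreme terms of the two summands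
cancel. A linear term comes from each entry `2` of `ps` and from the `-y` in each factor `φ -
y^(b+1)`. -/
theorem polyA_coeff (ps bs : List ℕ) (hp : ∀ a ∈ ps, 2 ≤ a) (hb : ∀ b ∈ bs, 2 ≤ b) :
    (polyA ps bs).coeff 0 = 1 ∧ (polyA ps bs).coeff 1 = -(ps.count 2 : ℤ) - bs.length := by
  have h1 := list_prod_coeff ps (fun a => 1 - X ^ (a - 1) * phi) (fun a => if a = 2 then -1 else 0)
    (fun a ha => by
      have := hp a ha
      simp [coeff_X_pow, show 0 ≠ a - 1 by omega])
    (fun a ha => by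
      have := hp a ha
      simp only [coeff_sub, coeff_one, mul_coeff_one, coeff_X_pow, phi_coeff_zero]
      by_cases h : a = 2
      · simp [h]
      · simp [h, show 0 ≠ a - 1 by omega, show 1 ≠ a - 1 by omega])
  have h2 := list_prod_coeff bs (fun b => phi - X ^ (b + 1)) (fun _ => -1)
    (fun b hb' => by simp [phi_coeff_zero])
    (fun b hb' => by
      have := hb b hb'
      simp [phi_coeff_one, coeff_X_pow, show b ≠ 0 by omega])
  have h3 : (ps.map fun a => if a = 2 then (-1 : ℤ) else 0).sum = -(ps.count 2 : ℤ) := by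
    clear h1 hp
    induction ps with
    | nil => simp
    | cons a l ih =>
      rw [List.map_cons, List.sum_cons, ih, List.count_cons]
      by_cases h : a = 2 <;> simp [h]
  have h4 : (bs.map fun _ => (-1 : ℤ)).sum = -bs.length := by simp
  rw [polyA, mul_coeff_zero, mul_coeff_one, h1.1, h1.2, h2.1, h2.2, h3, h4]
  constructor <;> ring

theorem polyB_coeff (ps bs : List ℕ) (hp : ∀ a ∈ ps, 2 ≤ a) (hb : ∀ b ∈ bs, 2 ≤ b) :
    (polyB ps bs).coeff 0 = 1 ∧ (polyB ps bs).coeff 1 = -1 := by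
  have key : ∀ l : List ℕ, (∀ a ∈ l, 2 ≤ a) → (l.map fun a => (1 - X ^ a : ℤ[X])).prod.coeff 0 = 1 ∧
      (l.map fun a => (1 - X ^ a : ℤ[X])).prod.coeff 1 = 0 := by
    intro l hl
    have := list_prod_coeff l (fun a => 1 - X ^ a) (fun _ => 0)
      (fun a ha => by
        have := hl a ha
        simp [coeff_X_pow, show 0 ≠ a by omega])
      (fun a ha => by
        have := hl a ha
        simp [coeff_X_pow, coeff_one, show 1 ≠ a by omega])
    simpa using this
  have h1 := key ps hp
  have h2 := key bs hb
  rw [polyB]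
  simp only [mul_coeff_zero, mul_coeff_one, h1.1, h1.2, h2.1, h2.2, phi_coeff_zero, phi_coeff_one]
  simp

/-- The sum of the `y ^ (a - c)`, for `a ∈ l`. -/
noncomputable def powSum (c : ℕ) (l : List ℕ) : ℤ[X] := (l.map fun a => X ^ (a - c)).sum

theorem powSum_coeff_nonneg (c : ℕ) (l : List ℕ) (i : ℕ) : 0 ≤ (powSum c l).coeff i := by
  induction l with
  | nil => simp [powSum]
  | cons a l ih =>
    simp only [powSum, List.map_cons, List.sum_cons, coeff_add, coeff_X_pow] at ih ⊢
    split_ifs <;> omega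

/-- Expansion of `∏ (1 - ψ y ^ (d + a - c))`, all exponents being at least `d`. -/
theorem prod_expand (d c : ℕ) (hd : 0 < d) (ψ : ℤ[X]) (l : List ℕ)
    (f : ℕ → ℕ) (hf : ∀ a ∈ l, f a = d + (a - c)) : ∃ e : ℤ[X],
      (l.map fun a => 1 - X ^ f a * ψ).prod =
        1 - ψ * X ^ d * powSum c l + X ^ (2 * d) * e ∧
      2 * e.coeff 0 = (ψ.coeff 0) ^ 2 * ((powSum c l).coeff 0 ^ 2 - (powSum c l).coeff 0) := by
  induction l with
  | nil => exact ⟨0, by simp [powSum], by simp [powSum]⟩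
  | cons a l ih =>
    obtain ⟨e, h1, h2⟩ := ih (fun a ha => hf a (List.mem_cons_of_mem _ ha))
    have hfa := hf a (by simp)
    have hs : powSum c (a :: l) = X ^ (a - c) + powSum c l := by simp [powSum]
    refine ⟨ψ ^ 2 * X ^ (a - c) * powSum c l + e * (1 - X ^ (d + (a - c)) * ψ), ?_, ?_⟩
    · rw [List.map_cons, List.prod_cons, h1, hfa, hs, pow_add]
      ring
    · rw [hs]
      simp only [coeff_add, mul_coeff_zero, coeff_sub, coeff_one_zero, coeff_X_pow, pow_two]
      rw [if_neg (by omega : ¬ 0 = d + (a - c))]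
      by_cases h : 0 = a - c
      · simp only [if_pos h]; linarith
      · simp only [if_neg h]; linarith

theorem exists_coeff_ne_zero_of_X_pow_mul {H K : ℤ[X]} {d i : ℕ} (h : H = X ^ d * K)
    (hK : K.coeff i ≠ 0) : H.coeff (d + i) ≠ 0 := by
  rw [h, add_comm, coeff_X_pow_mul]
  exact hK

theorem exists_prod_eq_one_sub (d : ℕ) (ψ : ℤ[X]) (l : List ℕ) (f : ℕ → ℕ)
    (hf : ∀ a ∈ l, d ≤ f a) : ∃ p : ℤ[X], (l.map fun a => 1 - X ^ f a * ψ).prod = 1 - X ^ d * p := by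
  induction l with
  | nil => exact ⟨0, by simp⟩
  | cons a l ih =>
    obtain ⟨p, hp⟩ := ih (fun a ha => hf a (List.mem_cons_of_mem _ ha))
    obtain ⟨t, ht⟩ := Nat.exists_eq_add_of_le (hf a (by simp))
    refine ⟨p + X ^ t * ψ * (1 - X ^ d * p), ?_⟩
    rw [List.map_cons, List.prod_cons, hp, ht, pow_add]
    ring

/-- The factor `1 - y^b` of `polyB` produces the first difference, since all positive columns act
only from degree `a - 1 ≥ b + 1` on. -/
theorem polyA_sub_polyB_small (a b : ℕ) (l : List ℕ) (hab : b + 2 ≤ a)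
    (hl : ∀ c ∈ l, a ≤ c) : (polyA (a :: l) [b] - polyB (a :: l) [b]).coeff b ≠ 0 := by
  obtain ⟨p, hp⟩ := exists_prod_eq_one_sub (b + 1) phi (a :: l) (fun a => a - 1) (by
    intro c hc
    rcases List.mem_cons.1 hc with rfl | hc
    · omega
    · have := hl c hc; omega)
  obtain ⟨q, hq⟩ := exists_prod_eq_one_sub (b + 1) 1 (a :: l) (fun a => a) (by
    intro c hc
    rcases List.mem_cons.1 hc with rfl | hc
    · omega
    · have := hl c hc; omega)
  simp only [mul_one] at hq
  have h : polyA (a :: l) [b] - polyB (a :: l) [b] =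
      X ^ b * (phi + X * (-1 - p * phi + X ^ (b + 1) * p + phi * q * (1 - X ^ b))) := by
    rw [polyA, polyB, hp, hq]
    simp only [List.map_cons, List.map_nil, List.prod_singleton]
    ring
  exact exists_coeff_ne_zero_of_X_pow_mul (i := 0) h (by simp [phi_coeff_zero])

/-- In degree `d` each entry `d + 1` of `l` contributes `-1`, and the negative column contributes
`1` if `b = d`; everything else cancels or starts later. -/
theorem polyA_sub_polyB_large (d b : ℕ) (l : List ℕ) (hd : 2 ≤ d) (hb : d ≤ b)
    (hl : ∀ c ∈ l, d + 1 ≤ c) : (polyA l [b] - polyB l [b]).coeff d =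
      (if b = d then 1 else 0) - (powSum (d + 1) l).coeff 0 := by
  obtain ⟨e, hp, -⟩ := prod_expand d (d + 1) (by omega) phi l (fun a => a - 1)
    (fun c hc => by have := hl c hc; omega)
  obtain ⟨q, hq⟩ := exists_prod_eq_one_sub (d + 1) 1 l (fun a => a) hl
  simp only [mul_one] at hq
  obtain ⟨t, rfl⟩ := Nat.exists_eq_add_of_le hb
  set σ := powSum (d + 1) l
  have h : polyA l [d + t] - polyB l [d + t] =
      X ^ d * (phi * X ^ t - phi ^ 2 * σ + X ^ d * (phi * e) + X *
        (phi * q - X ^ t * (1 - phi * X ^ d * σ + X ^ (2 * d) * e) - X ^ (d + t) * phi * q)) := by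
    simp only [polyA, polyB, hp, hq, List.map_cons, List.map_nil, List.prod_singleton]
    ring
  rw [h]
  have := coeff_X_pow_mul (phi * X ^ t - phi ^ 2 * σ + X ^ d * (phi * e) + X *
        (phi * q - X ^ t * (1 - phi * X ^ d * σ + X ^ (2 * d) * e) - X ^ (d + t) * phi * q)) d 0
  rw [zero_add] at this
  rw [this]
  simp only [coeff_add, coeff_sub, mul_coeff_zero, coeff_X_zero, zero_mul, coeff_X_pow,
    phi_coeff_zero, pow_two, if_neg (show ¬ 0 = d by omega)]
  by_cases h : t = 0
  · simp [h]
  · simp [h, Ne.symm h]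

theorem powSum_coeff_zero_cons (a : ℕ) (l : List ℕ) :
    (powSum a (a :: l)).coeff 0 = 1 + (powSum a l).coeff 0 := by
  simp [powSum]

theorem one_le_powSum_coeff_zero {a : ℕ} {l : List ℕ} (h : a ∈ l) :
    1 ≤ (powSum a l).coeff 0 := by
  induction l with
  | nil => simp at h
  | cons c l ih =>
    rcases List.mem_cons.1 h with rfl | h
    · rw [powSum_coeff_zero_cons]
      have := powSum_coeff_nonneg a l 0
      omega
    · have := ih h
      simp only [powSum, List.map_cons, List.sum_cons, coeff_add, coeff_X_pow] at this ⊢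
      split_ifs <;> omega

/-- The columns `a` and `-(a - 1)` contribute `(1 - y^(a-1) φ)(φ - y^a)` and `φ (1 - y^a)(1 -
y^(a-1))`, which differ by `y^a (1 - y)³` because `1 - φ = y (1 - y)` and `φ - y = (1 - y)²`. The
products over `l` differ by `-y^a (1 - y)² σ` up to higher terms, where `σ` is the power sum. The
difference of the full products is split accordingly. -/
theorem polyA_sub_polyB_critical_aux (a : ℕ) (l : List ℕ) (ha : 1 ≤ a) (hl : ∀ c ∈ l, a + 1 ≤ c) :
    ∃ e e' : ℤ[X], polyA (a :: l) [a - 1] - polyB (a :: l) [a - 1] =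
      X ^ a * (phi * (1 - X ^ (a - 1)) * (1 - X ^ a) *
        (-(1 - X) ^ 2 * powSum (a + 1) l + X ^ a * (e - X ^ 2 * e')) +
        (1 - X) ^ 3 * (1 - phi * X ^ a * powSum (a + 1) l + X ^ (2 * a) * e)) ∧
      2 * e.coeff 0 = (powSum (a + 1) l).coeff 0 ^ 2 - (powSum (a + 1) l).coeff 0 := by
  obtain ⟨e, hp, he⟩ := prod_expand a (a + 1) (by omega) phi l (fun a => a - 1)
    (fun c hc => by have := hl c hc; omega)
  obtain ⟨e', hq, -⟩ := prod_expand (a + 1) (a + 1) (by omega) 1 l (fun a => a)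
    (fun c hc => by have := hl c hc; omega)
  simp only [mul_one] at hq
  refine ⟨e, e', ?_, by rw [he, phi_coeff_zero]; ring⟩
  obtain ⟨u, rfl⟩ := Nat.exists_eq_add_of_le' ha
  simp only [polyA, polyB, List.map_cons, List.prod_cons, hp, hq, List.map_nil,
    List.prod_nil, mul_one, Nat.add_sub_cancel]
  simp only [phi]
  ring

theorem one_sub_X_pow_three : (1 - X : ℤ[X]) ^ 3 = 1 - Polynomial.C 3 * X + Polynomial.C 3 * X ^ 2 - X ^ 3 := by
  simp only [map_ofNat]
  ring

/-- If the first coefficients all vanished, they would determine those of the power sum `σ` one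
after the other, and one of these would be `-1`, although `σ` has nonnegative coefficients. The case
`a = 3` is separate, because `φ (1 - y²) = (1 + y³)(1 - y)` delays the contradiction to degree `3`.
-/
theorem polyA_sub_polyB_critical (a : ℕ) (l : List ℕ) (ha : 3 ≤ a) (hl : ∀ c ∈ l, a + 1 ≤ c) :
    ∃ i ≤ 3, (polyA (a :: l) [a - 1] - polyB (a :: l) [a - 1]).coeff (a + i) ≠ 0 := by
  obtain ⟨e, e', h, he⟩ := polyA_sub_polyB_critical_aux a l (by omega) hl
  set σ := powSum (a + 1) l with hσ
  have hn := powSum_coeff_nonneg (a + 1) l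
  rw [← hσ] at hn
  clear_value σ
  by_contra! hc
  have key : ∀ i ≤ 3, (phi * (1 - X ^ (a - 1)) * (1 - X ^ a) *
        (-(1 - X) ^ 2 * σ + X ^ a * (e - X ^ 2 * e')) +
        (1 - X) ^ 3 * (1 - phi * X ^ a * σ + X ^ (2 * a) * e)).coeff i = 0 := by
    intro i hi
    by_contra hne
    exact exists_coeff_ne_zero_of_X_pow_mul h hne (hc i hi)
  rcases ha.eq_or_lt with rfl | ha
  · have hK : phi * (1 - X ^ (3 - 1)) * (1 - X ^ 3) *
        (-(1 - X) ^ 2 * σ + X ^ 3 * (e - X ^ 2 * e')) +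
        (1 - X) ^ 3 * (1 - phi * X ^ 3 * σ + X ^ (2 * 3) * e) =
        (1 - Polynomial.C 3 * X + Polynomial.C 3 * X ^ 2 - X ^ 3) * (1 - σ) + X ^ 3 * ((1 - X) ^ 3 * X ^ 3 * σ +
          phi * (1 - X ^ 2) * (1 - X ^ 3) * (e - X ^ 2 * e') +
          (1 - X) ^ 3 * (- phi * σ + X ^ 3 * e)) := by
      rw [← one_sub_X_pow_three]
      simp only [phi]
      ring
    rw [hK] at key
    have k0 := key 0 (by norm_num)
    have k1 := key 1 (by norm_num)
    have k2 := key 2 (by norm_num)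
    have k3 := key 3 (by norm_num)
    simp only [coeff_add, coeff_sub, coeff_neg, mul_coeff_zero, mul_coeff_one, mul_coeff_two,
      mul_coeff_three, coeff_X, coeff_one, Polynomial.coeff_C, phi_coeff_zero, pow_three, pow_two]
      at k0 k1 k2 k3
    norm_num at k0 k1 k2 k3
    -- Here `σ` has constant term `1`, so `e` has constant term `0`, and the equation in degree `3`
    -- gives `σ` the coefficient `-1`.
    have := hn 3
    have hs : σ.coeff 0 = 1 := by linarith
    rw [hs] at he k1 k2 k3
    linarith
  · obtain ⟨t, rfl⟩ := Nat.exists_eq_add_of_le' (show 4 ≤ a from ha)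
    have hK : phi * (1 - X ^ (t + 4 - 1)) * (1 - X ^ (t + 4)) *
        (-(1 - X) ^ 2 * σ + X ^ (t + 4) * (e - X ^ 2 * e')) +
        (1 - X) ^ 3 * (1 - phi * X ^ (t + 4) * σ + X ^ (2 * (t + 4)) * e) =
        (1 - Polynomial.C 3 * X + Polynomial.C 3 * X ^ 2 - X ^ 3) - (phi * (1 - Polynomial.C 2 * X + X ^ 2)) * σ + X ^ 3 *
          (phi * (X ^ t + X ^ (1 + t) - X ^ (4 + 2 * t)) * (1 - X) ^ 2 * σ +
            phi * (1 - X ^ 3 * (X ^ t + X ^ (1 + t) - X ^ (4 + 2 * t))) * X ^ (1 + t) *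
              (e - X ^ 2 * e') +
            (1 - X) ^ 3 * (-phi * X ^ (1 + t) * σ + X ^ (5 + 2 * t) * e)) := by
      rw [← one_sub_X_pow_three, show t + 4 - 1 = t + 3 by omega]
      simp only [map_ofNat]
      ring
    rw [hK] at key
    have k0 := key 0 (by norm_num)
    have k1 := key 1 (by norm_num)
    have k2 := key 2 (by norm_num)
    simp only [coeff_add, coeff_sub, mul_coeff_zero, mul_coeff_one, mul_coeff_two,
      coeff_X_pow, coeff_X, coeff_one, Polynomial.coeff_C, phi_coeff_zero, phi_coeff_one, phi_coeff_two]
      at k0 k1 k2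
    norm_num at k0 k1 k2
    -- The three equations force `σ = 1 + 0 y - y² + …`.
    have := hn 2
    linarith

/-- With exactly one negative column and all positive columns at least `3`, the difference
has a low nonzero coefficient. -/
theorem exists_polyA_sub_polyB_coeff_ne_zero (a b : ℕ) (l : List ℕ) (ha : 3 ≤ a)
    (hl : ∀ c ∈ l, a ≤ c) : ∃ j ≤ a + 3, (polyA (a :: l) [b] - polyB (a :: l) [b]).coeff j ≠ 0 := by
  obtain ⟨d, rfl⟩ := Nat.exists_eq_add_of_le' (show 1 ≤ a by omega)
  by_cases hab : b + 2 ≤ d + 1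
  · exact ⟨b, by omega, polyA_sub_polyB_small _ b l hab hl⟩
  have h := polyA_sub_polyB_large d b ((d + 1) :: l) (by omega) (by omega) (by
    intro c hc
    rcases List.mem_cons.1 hc with rfl | hc
    · exact le_rfl
    · exact hl c hc)
  rw [powSum_coeff_zero_cons] at h
  have h0 := powSum_coeff_nonneg (d + 1) l 0
  by_cases hbd : b = d
  -- If the least column occurs twice, the coefficient in degree `d` is negative; if it occurs once,
  -- that coefficient is `0` and the critical case arises.
  · by_cases hm : d + 1 ∈ l
    · have := one_le_powSum_coeff_zero hm
      exact ⟨d, by omega, by rw [h, if_pos hbd]; omega⟩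
    · obtain ⟨i, hi, h⟩ := polyA_sub_polyB_critical (d + 1) l ha (fun c hc => by
        have := hl c hc
        have : c ≠ d + 1 := fun h => hm (h ▸ hc)
        omega)
      rw [Nat.add_sub_cancel] at h
      subst hbd
      exact ⟨_, by omega, h⟩
  · exact ⟨d, by omega, by rw [h, if_neg hbd]; omega⟩

end

/-! ## Bounds for the columns -/

theorem hasWidth_invert {f : LaurentPolynomial ℤ} {d : ℤ} (h : HasWidth f d) :
    HasWidth (invert f) d := by
  obtain ⟨lo, h1, h2, h3⟩ := h
  refine ⟨-(lo + d), ?_, ?_, fun k hk => ?_⟩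
  · rw [invert_apply, neg_neg]; exact h2
  · rw [invert_apply, show -(-(lo + d) + d) = lo by ring]; exact h1
  · rw [invert_apply] at hk
    have := h3 _ hk
    omega

/-- The substitution of `x⁻¹` for the variable of a polynomial. -/
noncomputable def evalInv : Polynomial ℤ →+* LaurentPolynomial ℤ := Polynomial.eval₂RingHom C (T (-1))

theorem evalInv_X : evalInv Polynomial.X = T (-1) := by simp [evalInv]

theorem coeff_T_mul_evalInv (f : Polynomial ℤ) (n k : ℤ) :
    (T n * evalInv f).coeff k = if k ≤ n then f.coeff (n - k).toNat else 0 := by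
  induction f using Polynomial.induction_on' with
  | add p q hp hq =>
    rw [map_add, mul_add, AddMonoidAlgebra.coeff_add, Finsupp.add_apply, hp, hq,
      Polynomial.coeff_add]
    split_ifs <;> simp
  | monomial m c =>
    have : T n * evalInv (Polynomial.monomial m c) = C c * T (n - m) := by
      simp only [evalInv, Polynomial.coe_eval₂RingHom, Polynomial.eval₂_monomial, T_pow]
      rw [mul_left_comm, ← T_add]
      congr 2
      ring
    rw [this, coeff_monomial, Polynomial.coeff_monomial]
    split_ifs <;> first | rfl | omega

/-- The factor of `pretzelPoly` which remains if the powers of `x - 1` coming from the entries `±1`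
are removed. -/
noncomputable def reducedPoly (ps bs : List ℕ) (k : ℤ) : LaurentPolynomial ℤ :=
  (ps.map fun a : ℕ => T (a : ℤ) + kap).prod * (bs.map fun b : ℕ => T (-(b : ℤ)) + kap).prod +
    T k * kap * ((ps.map fun a : ℕ => T (a : ℤ) - 1).prod *
      (bs.map fun b : ℕ => T (-(b : ℤ)) - 1).prod)

theorem invert_kap : invert kap = kap := by
  simp [kap]
  ring

theorem invert_reducedPoly (ps bs : List ℕ) (k : ℤ) :
    invert (reducedPoly ps bs k) = reducedPoly bs ps (-k) := by
  simp [reducedPoly, map_list_prod, invert_kap, Function.comp_def]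
  ring

theorem reducedPoly_perm {ps ps' : List ℕ} (h : ps.Perm ps') (bs : List ℕ) (k : ℤ) :
    reducedPoly ps bs k = reducedPoly ps' bs k := by
  rw [reducedPoly, reducedPoly, (h.map _).prod_eq, (h.map fun a : ℕ => T (a : ℤ) - 1).prod_eq]

theorem evalInv_phi : T 1 * evalInv phi = -kap := by
  simp only [phi, map_add, map_sub, map_one, map_pow, evalInv_X, kap, T_pow]
  have h1 : (T 1 * T (-1) : LaurentPolynomial ℤ) = 1 := by rw [← T_add]; simp
  have h2 : (T 1 * T (((2 : ℕ) : ℤ) * -1) : LaurentPolynomial ℤ) = T (-1) := by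
    rw [← T_add]; norm_num
  linear_combination h2 - h1

theorem prod_map_eq_T_mul (l : List ℕ) (f : ℕ → LaurentPolynomial ℤ) (g : ℕ → Polynomial ℤ)
    (c : ℕ → ℤ) (ε : LaurentPolynomial ℤ) (h : ∀ a ∈ l, f a = ε * (T (c a) * evalInv (g a))) :
    (l.map f).prod = ε ^ l.length * (T (l.map c).sum * evalInv (l.map g).prod) := by
  induction l with
  | nil => simp
  | cons a l ih =>
    rw [List.map_cons, List.prod_cons, ih fun a ha => h a (List.mem_cons_of_mem _ ha),
      h a (by simp), List.map_cons, List.map_cons, List.sum_cons, List.prod_cons, map_mul, T_add,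
      List.length_cons]
    ring

theorem T_mul_evalInv_X_pow (n : ℤ) (m : ℕ) :
    T n * evalInv (Polynomial.X ^ m) = T (n - m) := by
  rw [map_pow, evalInv_X, T_pow, ← T_add]
  congr 1
  ring

/-- With `y = x⁻¹` one has `κ = -x φ`, and the highest power of `x` is taken out of each factor. The
low coefficients of `polyA` and `polyB` then describe the upper end of the two summands. -/
theorem reducedPoly_eq (ps bs : List ℕ) (k : ℤ) (hp : ∀ a ∈ ps, 2 ≤ a) :
    reducedPoly ps bs k = (-1) ^ bs.length * (T (ps.sum + bs.length) * evalInv (polyA ps bs) -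
      T (ps.sum + k + 1) * evalInv (polyB ps bs)) := by
  have e1 := prod_map_eq_T_mul ps (fun a : ℕ => T (a : ℤ) + kap)
    (fun a => 1 - Polynomial.X ^ (a - 1) * phi) (fun a => a) 1 (fun a ha => by
      have := hp a ha
      have h := T_mul_evalInv_X_pow a (a - 1)
      rw [show (a : ℤ) - (a - 1 : ℕ) = 1 by omega] at h
      rw [map_sub, map_one, map_mul]
      linear_combination evalInv phi * h + evalInv_phi)
  have e2 := prod_map_eq_T_mul ps (fun a : ℕ => T (a : ℤ) - 1)
    (fun a => 1 - Polynomial.X ^ a) (fun a => a) 1 (fun a ha => by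
      have h := T_mul_evalInv_X_pow a a
      rw [sub_self, T_zero] at h
      rw [map_sub, map_one]
      linear_combination h)
  have e3 := prod_map_eq_T_mul bs (fun b : ℕ => T (-(b : ℤ)) + kap)
    (fun b => phi - Polynomial.X ^ (b + 1)) (fun b => 1) (-1) (fun b hb => by
      have h := T_mul_evalInv_X_pow 1 (b + 1)
      rw [show (1 : ℤ) - (b + 1 : ℕ) = -b by omega] at h
      rw [map_sub]
      linear_combination evalInv_phi - h)
  have e4 := prod_map_eq_T_mul bs (fun b : ℕ => T (-(b : ℤ)) - 1)
    (fun b => 1 - Polynomial.X ^ b) (fun b => 0) (-1) (fun b hb => by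
      have h := T_mul_evalInv_X_pow 0 b
      rw [zero_sub] at h
      rw [map_sub, map_one]
      rw [T_zero] at h ⊢
      linear_combination -h)
  have s1 : (ps.map fun a : ℕ => (a : ℤ)).sum = ps.sum := by
    rw [Nat.cast_list_sum]
  have s2 : (bs.map fun _ => (1 : ℤ)).sum = bs.length := by simp
  have s3 : (bs.map fun _ => (0 : ℤ)).sum = 0 := by simp
  rw [s1] at e1 e2
  rw [s2] at e3
  rw [s3, T_zero] at e4
  rw [reducedPoly, e1, e2, e3, e4, polyA, polyB, T_add, T_add, T_add]
  simp only [map_mul, one_pow]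
  linear_combination (T k * T ps.sum * (-1) ^ bs.length *
    evalInv (ps.map fun a => 1 - Polynomial.X ^ a).prod *
    evalInv (bs.map fun b => 1 - Polynomial.X ^ b).prod) * evalInv_phi

theorem coeff_reducedPoly_ne_zero (ps bs : List ℕ) (k z : ℤ) (hp : ∀ a ∈ ps, 2 ≤ a)
    (h : (if z ≤ ps.sum + bs.length then (polyA ps bs).coeff (ps.sum + bs.length - z).toNat else 0) ≠
      (if z ≤ ps.sum + k + 1 then (polyB ps bs).coeff (ps.sum + k + 1 - z).toNat else 0)) :
    (reducedPoly ps bs k).coeff z ≠ 0 := by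
  have e : ((-1) ^ bs.length : LaurentPolynomial ℤ) = C ((-1) ^ bs.length) := by simp
  rw [reducedPoly_eq ps bs k hp, e, ← smul_eq_C_mul, AddMonoidAlgebra.coeff_smul,
    Finsupp.smul_apply, AddMonoidAlgebra.coeff_sub, Finsupp.sub_apply,
    coeff_T_mul_evalInv, coeff_T_mul_evalInv, smul_eq_mul]
  exact mul_ne_zero (by simp) (sub_ne_zero.2 h)

/-- The summands begin at `x^(Σ ps + |bs|)` and `x^(Σ ps + k + 1)`, with coefficients that cancel if
the exponents agree. In that case the next coefficients differ unless the excluded equation holds.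
-/
theorem exists_top (ps bs : List ℕ) (k : ℤ) (hp : ∀ a ∈ ps, 2 ≤ a) (hb : ∀ b ∈ bs, 2 ≤ b)
    (h : ¬ (bs.length = k + 1 ∧ bs.length + ps.count 2 = 1)) :
    ∃ z, (reducedPoly ps bs k).coeff z ≠ 0 ∧ ps.sum + bs.length - 1 ≤ z ∧ ps.sum + k ≤ z ∧
      (bs.length ≠ k + 1 → ps.sum + bs.length ≤ z) := by
  obtain ⟨a0, a1⟩ := polyA_coeff ps bs hp hb
  obtain ⟨b0, b1⟩ := polyB_coeff ps bs hp hb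
  rcases lt_trichotomy (bs.length : ℤ) (k + 1) with hk | hk | hk
  · refine ⟨ps.sum + k + 1, coeff_reducedPoly_ne_zero ps bs k _ hp ?_, by omega, by omega,
      by omega⟩
    rw [if_neg (by omega), if_pos le_rfl, sub_self, Int.toNat_zero, b0]
    norm_num
  · refine ⟨ps.sum + k, coeff_reducedPoly_ne_zero ps bs k _ hp ?_, by omega, by omega,
      fun h => absurd hk h⟩
    rw [if_pos (by omega), if_pos (by omega), hk, show (ps.sum + (k + 1) - (ps.sum + k)).toNat = 1 by omega,
      show (ps.sum + k + 1 - (ps.sum + k)).toNat = 1 by omega, a1, b1]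
    intro h1
    exact h ⟨hk, by omega⟩
  · refine ⟨ps.sum + bs.length, coeff_reducedPoly_ne_zero ps bs k _ hp ?_, by omega, by omega,
      by omega⟩
    rw [if_pos le_rfl, if_neg (by omega), sub_self, Int.toNat_zero, a0]
    norm_num

/-- Mirror image: `x ↦ x⁻¹` exchanges `ps` with `bs` and `k` with `-k`. -/
theorem exists_bottom (ps bs : List ℕ) (k : ℤ) (hp : ∀ a ∈ ps, 2 ≤ a) (hb : ∀ b ∈ bs, 2 ≤ b)
    (h : ¬ (ps.length = -k + 1 ∧ ps.length + bs.count 2 = 1)) :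
    ∃ z, (reducedPoly ps bs k).coeff z ≠ 0 ∧ bs.sum + ps.length - 1 ≤ -z ∧ bs.sum - k ≤ -z ∧
      (ps.length ≠ -k + 1 → bs.sum + ps.length ≤ -z) := by
  obtain ⟨z, h1, h2, h3, h4⟩ := exists_top bs ps (-k) hb hp h
  rw [← invert_reducedPoly, invert_apply] at h1
  exact ⟨-z, h1, by omega, by omega, fun h => by have := h4 h; omega⟩

theorem exists_perm_cons_min (l : List ℕ) (hl : l ≠ []) :
    ∃ a t, l.Perm (a :: t) ∧ ∀ c ∈ t, a ≤ c := by
  have hs := List.pairwise_insertionSort (· ≤ ·) l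
  have hp := List.perm_insertionSort (· ≤ ·) l
  cases h : l.insertionSort (· ≤ ·) with
  | nil => rw [h] at hp; exact absurd hp.symm.eq_nil hl
  | cons a t =>
    rw [h] at hs hp
    exact ⟨a, t, hp.symm, (List.pairwise_cons.1 hs).1⟩

theorem exists_top_one_negative (a b : ℕ) (t : List ℕ) (ha : 3 ≤ a) (ht : ∀ c ∈ t, a ≤ c) (j : ℕ)
    (hj : (polyA (a :: t) [b] - polyB (a :: t) [b]).coeff j ≠ 0) :
    (reducedPoly (a :: t) [b] 0).coeff ((a :: t).sum + 1 - j) ≠ 0 := by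
  refine coeff_reducedPoly_ne_zero (a :: t) [b] 0 _ (fun c hc => ?_) ?_
  · rcases List.mem_cons.1 hc with rfl | hc
    · omega
    · have := ht c hc; omega
  · rw [Polynomial.coeff_sub, sub_ne_zero] at hj
    have h1 : ((a :: t).sum + ([b].length : ℕ) - ((a :: t).sum + 1 - j) : ℤ).toNat = j := by
      rw [List.length_singleton]; omega
    have h2 : ((a :: t).sum + 0 + 1 - ((a :: t).sum + 1 - j) : ℤ).toNat = j := by omega
    rw [h1, h2, if_pos (by simp), if_pos (by simp)]
    exact hj

/-- Columns `-1` and `2` combine to a column `-2`, in Conway's fractions `-1 + 1/2 = -1/2`. This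
reduces one exceptional case to the other. -/
theorem reducedPoly_two_cons (ps : List ℕ) :
    reducedPoly (2 :: ps) [] (-1) = -T 1 * reducedPoly ps [2] 0 := by
  simp only [reducedPoly, List.map_cons, List.map_nil, List.prod_cons, List.prod_nil, T_zero]
  have h1 : (T 1 * T (-1) : LaurentPolynomial ℤ) = 1 := by rw [← T_add]; simp
  have h2 : (T ((2 : ℕ) : ℤ) : LaurentPolynomial ℤ) = T 1 * T 1 := by rw [← T_add]; norm_num
  have h3 : (T (-((2 : ℕ) : ℤ)) : LaurentPolynomial ℤ) = T (-1) * T (-1) := by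
    rw [← T_add]; norm_num
  rw [h2, h3, kap]
  set F := (ps.map fun a : ℕ => T (a : ℤ) + (1 - T 1 - T (-1) : LaurentPolynomial ℤ)).prod
  set K := (ps.map fun a : ℕ => (T (a : ℤ) - 1 : LaurentPolynomial ℤ)).prod
  linear_combination (F * (T (-1) - 1) + (1 - T 1 - T (-1)) * K * (T (-1) + T 1)) * h1

theorem mul_length_le_sum (n : ℕ) (l : List ℕ) (h : ∀ a ∈ l, n ≤ a) : n * l.length ≤ l.sum := by
  simpa [mul_comm] using List.card_nsmul_le_sum l n h

/-- The bounds in the case where cancellation occurs at the top. -/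
theorem bound_of_cancellation {S : ℕ} (ps bs : List ℕ) (k : ℤ) (hp : ∀ a ∈ ps, 2 ≤ a)
    (hb : ∀ b ∈ bs, 2 ≤ b) (hl : 3 ≤ ps.length + bs.length + k.natAbs)
    (h : HasWidth (reducedPoly ps bs k) (S + ps.length + bs.length))
    (ht : bs.length = k + 1 ∧ bs.length + ps.count 2 = 1) :
    ps.sum + bs.sum ≤ 3 * S + 20 ∧ k.natAbs ≤ S + 20 := by
  obtain ⟨hk, hc⟩ := ht
  have hbl : bs.length = 0 ∨ bs.length = 1 := by omega
  rcases hbl with hbl | hbl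
  · obtain rfl := List.length_eq_zero_iff.1 hbl
    obtain rfl : k = -1 := by simp at hk; omega
    simp only [List.length_nil, zero_add, Int.natAbs_neg, Int.natAbs_one, add_zero,
      List.sum_nil, CharP.cast_eq_zero] at *
    obtain ⟨w, hw, h1, -, -⟩ := exists_bottom ps [] (-1) hp hb (by simp; omega)
    have h2 : 2 ∈ ps := List.count_pos_iff.1 (by omega)
    have hpm := List.perm_cons_erase h2
    set ps' := ps.erase 2
    have hps : ∀ a ∈ ps', 3 ≤ a := by
      intro a ha
      have := hp a (hpm.mem_iff.2 (List.mem_cons_of_mem _ ha))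
      have h0 : ps'.count 2 = 0 := by
        have := hpm.count_eq 2
        rw [List.count_cons_self] at this
        omega
      have : a ≠ 2 := by
        rintro rfl
        exact List.count_eq_zero.1 h0 ha
      omega
    have hlen := hpm.length_eq
    have hsum := hpm.sum_eq
    simp only [List.length_cons, List.sum_cons] at hlen hsum
    obtain ⟨a, t, hpm', hmin⟩ := exists_perm_cons_min ps' (by
      rintro h0
      rw [h0] at hlen
      simp at hlen
      omega)
    have ha : 3 ≤ a := hps a (hpm'.mem_iff.2 (by simp))
    -- The negative column has `b = 2` crossings: degree `2` works for `a ≥ 4`, and `a = 3` gives at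
    -- most `a + 3 = 6`.
    have hj : ∃ j ≤ 6, (polyA (a :: t) [2] - polyB (a :: t) [2]).coeff j ≠ 0 := by
      by_cases h4 : 4 ≤ a
      · exact ⟨2, by omega, polyA_sub_polyB_small a 2 t h4 hmin⟩
      · obtain ⟨j, hj, h⟩ := exists_polyA_sub_polyB_coeff_ne_zero a 2 t ha hmin
        exact ⟨j, by omega, h⟩
    obtain ⟨j, hj6, hj⟩ := hj
    have hz := exists_top_one_negative a 2 t ha hmin j hj
    have hz' : (reducedPoly ps [] (-1)).coeff ((a :: t).sum + 2 - j) ≠ 0 := by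
      rw [reducedPoly_perm hpm, reducedPoly_two_cons, reducedPoly_perm hpm', neg_mul,
        AddMonoidAlgebra.coeff_neg, Finsupp.neg_apply, neg_ne_zero]
      have : ∀ (f : LaurentPolynomial ℤ) (n : ℤ), (T 1 * f).coeff (n + 1) = f.coeff n := by
        intro f n
        have := AddMonoidAlgebra.coeff_single_mul_add f (1 : ℤ) (1 : ℤ) n
        rw [one_mul, add_comm] at this
        exact this
      rw [show ((a :: t).sum + 2 - j : ℤ) = (a :: t).sum + 1 - j + 1 by ring, this]
      exact hz
    have h5 := h.le hw hz'
    have hsum' := hpm'.sum_eq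
    omega
  · obtain ⟨b, rfl⟩ := List.length_eq_one_iff.1 hbl
    obtain rfl : k = 0 := by simp at hk; omega
    simp only [List.length_singleton, List.sum_singleton, Int.natAbs_zero, add_zero] at *
    obtain ⟨w, hw, h1, -, h1'⟩ := exists_bottom ps [b] 0 hp hb (by omega)
    have h1'' := h1' (by omega)
    obtain ⟨a, t, hpm, hmin⟩ := exists_perm_cons_min ps (by
      rintro rfl
      simp at hl)
    have h3 : ∀ c ∈ ps, 3 ≤ c := by
      intro c hc'
      have := hp c hc'
      have : c ≠ 2 := by
        rintro rfl
        have := List.count_pos_iff.2 hc'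
        omega
      omega
    have ha := h3 a (hpm.mem_iff.2 (by simp))
    obtain ⟨j, hj, hne⟩ := exists_polyA_sub_polyB_coeff_ne_zero a b t ha hmin
    have hz := exists_top_one_negative a b t ha hmin j hne
    rw [← reducedPoly_perm hpm] at hz
    have h5 := h.le hw hz
    have hsum := hpm.sum_eq
    have hlen := hpm.length_eq
    -- The loss of up to `a + 3` at the top is compensated: `hl` forces a second positive column, so
    -- the sum of `t` is at least `a`. For two columns no such bound could hold.
    have hts := mul_length_le_sum a t hmin
    simp only [List.length_cons, List.sum_cons] at *
    have : a * 1 ≤ a * t.length := Nat.mul_le_mul_left a (by omega)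
    omega

theorem bound_reducedPoly {S : ℕ} (ps bs : List ℕ) (k : ℤ) (hp : ∀ a ∈ ps, 2 ≤ a)
    (hb : ∀ b ∈ bs, 2 ≤ b) (hl : 3 ≤ ps.length + bs.length + k.natAbs)
    (h : HasWidth (reducedPoly ps bs k) (S + ps.length + bs.length)) :
    ps.sum + bs.sum ≤ 3 * S + 20 ∧ k.natAbs ≤ S + 20 := by
  by_cases ht : bs.length = k + 1 ∧ bs.length + ps.count 2 = 1
  · exact bound_of_cancellation ps bs k hp hb hl h ht
  by_cases hb' : ps.length = -k + 1 ∧ ps.length + bs.count 2 = 1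
  · have h' := hasWidth_invert h
    rw [invert_reducedPoly, add_right_comm] at h'
    have := bound_of_cancellation bs ps (-k) hb hp (by omega) h' hb'
    omega
  obtain ⟨z, hz, h1, h2, -⟩ := exists_top ps bs k hp hb ht
  obtain ⟨w, hw, h3, h4, -⟩ := exists_bottom ps bs k hp hb hb'
  have := h.le hw hz
  have := mul_length_le_sum 2 ps hp
  have := mul_length_le_sum 2 bs hb
  omega

/-! ### Separating the entries `±1` -/

/-- The entries of `l` which are at least `2`. -/
def posPart (l : List ℤ) : List ℕ := (l.filter (2 ≤ ·)).map Int.natAbs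

/-- The absolute values of the entries of `l` which are at most `-2`. -/
def negPart (l : List ℤ) : List ℕ := (l.filter (· ≤ -2)).map Int.natAbs

theorem two_le_of_mem_posPart {l : List ℤ} {a : ℕ} (h : a ∈ posPart l) : 2 ≤ a := by
  simp only [posPart, List.mem_map, List.mem_filter, decide_eq_true_eq] at h
  obtain ⟨c, ⟨-, h⟩, rfl⟩ := h
  omega

theorem two_le_of_mem_negPart {l : List ℤ} {a : ℕ} (h : a ∈ negPart l) : 2 ≤ a := by
  simp only [negPart, List.mem_map, List.mem_filter, decide_eq_true_eq] at h
  obtain ⟨c, ⟨-, h⟩, rfl⟩ := h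
  omega

theorem parts_cons (c : ℤ) (l : List ℤ) (hc : c ≠ 0) :
    (c = 1 ∧ posPart (c :: l) = posPart l ∧ negPart (c :: l) = negPart l) ∨
    (c = -1 ∧ posPart (c :: l) = posPart l ∧ negPart (c :: l) = negPart l) ∨
    (∃ n : ℕ, c = n ∧ 2 ≤ n ∧ posPart (c :: l) = n :: posPart l ∧ negPart (c :: l) = negPart l) ∨
    ∃ n : ℕ, c = -n ∧ 2 ≤ n ∧ posPart (c :: l) = posPart l ∧ negPart (c :: l) = n :: negPart l := by
  by_cases h1 : c = 1
  · subst h1; simp [posPart, negPart]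
  by_cases h2 : c = -1
  · subst h2; simp [posPart, negPart]
  by_cases h3 : 2 ≤ c
  · refine Or.inr (Or.inr (Or.inl ⟨c.natAbs, by omega, by omega, ?_, ?_⟩))
    · simp [posPart, h3]
    · simp [negPart, show ¬ c ≤ -2 by omega]
  · refine Or.inr (Or.inr (Or.inr ⟨c.natAbs, by omega, by omega, ?_, ?_⟩))
    · simp [posPart, h3]
    · simp [negPart, show c ≤ -2 by omega]

theorem prod_map_eq_parts {M : Type*} [CommMonoid M] (f : ℤ → M) (l : List ℤ) (hl : 0 ∉ l) :
    (l.map f).prod = f 1 ^ l.count 1 * f (-1) ^ l.count (-1) *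
      (((posPart l).map fun a : ℕ => f a).prod * ((negPart l).map fun b : ℕ => f (-b)).prod) := by
  induction l with
  | nil => simp [posPart, negPart]
  | cons c l ih =>
    have ih := ih fun h => hl (List.mem_cons_of_mem _ h)
    rw [List.map_cons, List.prod_cons, ih]
    rcases parts_cons c l (fun h => hl (by simp [h])) with ⟨rfl, h1, h2⟩ | ⟨rfl, h1, h2⟩ |
      ⟨n, rfl, hn, h1, h2⟩ | ⟨n, rfl, hn, h1, h2⟩
    · rw [h1, h2, List.count_cons_self, List.count_cons_of_ne (by norm_num), pow_succ]
      ac_rfl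
    · rw [h1, h2, List.count_cons_self, List.count_cons_of_ne (by norm_num), pow_succ]
      ac_rfl
    · rw [h1, h2, List.count_cons_of_ne (by omega), List.count_cons_of_ne (by omega),
        List.map_cons, List.prod_cons]
      ac_rfl
    · rw [h1, h2, List.count_cons_of_ne (by omega), List.count_cons_of_ne (by omega),
        List.map_cons, List.prod_cons]
      ac_rfl

theorem length_eq_parts (l : List ℤ) (hl : 0 ∉ l) :
    l.length = l.count 1 + l.count (-1) + ((posPart l).length + (negPart l).length) := by
  induction l with
  | nil => simp [posPart, negPart]
  | cons c l ih =>
    have ih := ih fun h => hl (List.mem_cons_of_mem _ h)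
    rw [List.length_cons, ih]
    rcases parts_cons c l (fun h => hl (by simp [h])) with ⟨rfl, h1, h2⟩ | ⟨rfl, h1, h2⟩ |
      ⟨n, rfl, hn, h1, h2⟩ | ⟨n, rfl, hn, h1, h2⟩
    · rw [h1, h2, List.count_cons_self, List.count_cons_of_ne (by norm_num)]; omega
    · rw [h1, h2, List.count_cons_self, List.count_cons_of_ne (by norm_num)]; omega
    · rw [h1, h2, List.count_cons_of_ne (by omega), List.count_cons_of_ne (by omega),
        List.length_cons]; omega
    · rw [h1, h2, List.count_cons_of_ne (by omega), List.count_cons_of_ne (by omega),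
        List.length_cons]; omega

theorem natAbs_le_of_mem {l : List ℤ} {a : ℤ} (h : a ∈ l) :
    a.natAbs ≤ (posPart l).sum + (negPart l).sum + 1 := by
  by_cases h1 : 2 ≤ a
  · have : a.natAbs ∈ posPart l :=
      List.mem_map_of_mem (List.mem_filter.2 ⟨h, by simpa using h1⟩)
    have := List.le_sum_of_mem this
    omega
  · by_cases h2 : a ≤ -2
    · have : a.natAbs ∈ negPart l :=
        List.mem_map_of_mem (List.mem_filter.2 ⟨h, by simpa using h2⟩)
      have := List.le_sum_of_mem this
      omega
    · omega

theorem hasWidth_T_one_sub_one : HasWidth (T 1 - 1) 1 := by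
  refine ⟨0, ?_, ?_, ?_⟩
  · rw [← T_zero, AddMonoidAlgebra.coeff_sub, Finsupp.sub_apply, T_apply, T_apply]; norm_num
  · rw [← T_zero, AddMonoidAlgebra.coeff_sub, Finsupp.sub_apply, T_apply, T_apply]; norm_num
  · intro k hk
    rw [← T_zero] at hk
    simp only [AddMonoidAlgebra.coeff_sub, Finsupp.sub_apply, T_apply] at hk
    split_ifs at hk <;> omega

/-- Since `x + κ = x⁻¹ (x - 1)`, each column `1` contributes `x - 1` to both products, with a
discrepancy `x` that accumulates in `k`. -/
theorem pretzelPoly_eq_of_pos (l : List ℤ) (h0 : 0 ∉ l) (h1 : -1 ∉ l) : pretzelPoly l =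
    T (-l.count 1) * ((T 1 - 1) ^ l.count 1 *
      reducedPoly (posPart l) (negPart l) (l.count 1)) := by
  rw [pretzelPoly, prod_map_eq_parts _ l h0, prod_map_eq_parts _ l h0, List.count_eq_zero.2 h1,
    reducedPoly]
  have e1 : T 1 + kap = T (-1) * (T 1 - 1) := by
    have h1 : (T (-1) * T 1 : LaurentPolynomial ℤ) = 1 := by rw [← T_add]; simp
    rw [kap]
    linear_combination -h1
  have e2 : (T (-1) : LaurentPolynomial ℤ) ^ l.count 1 = T (-l.count 1) := by
    rw [T_pow]; simp
  have e3 : (T (-l.count 1) * T (l.count 1) : LaurentPolynomial ℤ) = 1 := by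
    rw [← T_add]; simp
  rw [e1, mul_pow, e2]
  linear_combination -(kap * (T 1 - 1) ^ l.count 1 *
    (((posPart l).map fun a : ℕ => T (a : ℤ) - 1).prod *
      ((negPart l).map fun b : ℕ => T (-(b : ℤ)) - 1).prod)) * e3

/-- Here `x⁻¹ + κ = -(x - 1)` and `x⁻¹ - 1 = -(x - 1) x⁻¹`, so the discrepancy is `x⁻¹`. -/
theorem pretzelPoly_eq_of_neg (l : List ℤ) (h0 : 0 ∉ l) (h1 : 1 ∉ l) : pretzelPoly l =
    (-1) ^ l.count (-1) * ((T 1 - 1) ^ l.count (-1) *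
      reducedPoly (posPart l) (negPart l) (-l.count (-1))) := by
  rw [pretzelPoly, prod_map_eq_parts _ l h0, prod_map_eq_parts _ l h0, List.count_eq_zero.2 h1,
    reducedPoly]
  have e1 : T (-1) + kap = -1 * (T 1 - 1) := by
    rw [kap]; ring
  have e2 : T (-1) - 1 = -1 * (T 1 - 1) * (T (-1) : LaurentPolynomial ℤ) := by
    have h1 : (T (-1) * T 1 : LaurentPolynomial ℤ) = 1 := by rw [← T_add]; simp
    linear_combination h1
  have e3 : (T (-1) : LaurentPolynomial ℤ) ^ l.count (-1) = T (-l.count (-1)) := by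
    rw [T_pow]; simp
  rw [e1, e2]
  simp only [mul_pow, e3]
  ring

theorem exists_hasWidth_reducedPoly {l : List ℤ} (h0 : 0 ∉ l) (h1 : ¬ (1 ∈ l ∧ -1 ∈ l)) {S : ℕ}
    (h : HasWidth (pretzelPoly l) (S + l.length)) : ∃ k : ℤ,
      k.natAbs = l.count 1 + l.count (-1) ∧ HasWidth (reducedPoly (posPart l) (negPart l) k)
        (S + (posPart l).length + (negPart l).length) := by
  have hlen := length_eq_parts l h0
  by_cases hn : -1 ∈ l
  · have h1 : 1 ∉ l := fun h => h1 ⟨h, hn⟩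
    refine ⟨-l.count (-1), by rw [List.count_eq_zero.2 h1]; simp, ?_⟩
    rw [pretzelPoly_eq_of_neg l h0 h1] at h
    have hm : IsMonomial ((-1) ^ l.count (-1)) := ⟨(-1) ^ l.count (-1), 0, by simp⟩
    convert (hasWidth_T_one_sub_one.pow _).of_mul (hm.hasWidth.of_mul h) using 1
    rw [List.count_eq_zero.2 h1] at hlen
    omega
  · refine ⟨l.count 1, by rw [List.count_eq_zero.2 hn]; simp, ?_⟩
    rw [pretzelPoly_eq_of_pos l h0 hn] at h
    have hm : IsMonomial (T (-l.count 1)) := ⟨1, -l.count 1, by simp⟩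
    convert (hasWidth_T_one_sub_one.pow _).of_mul (hm.hasWidth.of_mul h) using 1
    rw [List.count_eq_zero.2 hn] at hlen
    omega

/-! ### Lists with a column `0`, and the resulting bounds -/

theorem coeff_T_add_kap (a k : ℤ) : (T a + kap).coeff k =
    (if a = k then 1 else 0) + ((if 0 = k then 1 else 0) - (if 1 = k then 1 else 0) -
      (if -1 = k then 1 else 0)) := by
  rw [kap, ← T_zero]
  simp only [AddMonoidAlgebra.coeff_sub, AddMonoidAlgebra.coeff_add, Finsupp.sub_apply,
    Finsupp.add_apply, T_apply]

/-- For `a = ±1` the power `xᵃ` would cancel against a term of `κ`; this is why reduced lists with a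
`0` contain no `±1`. -/
theorem hasWidth_T_add_kap {a : ℤ} (h1 : a ≠ 1) (h2 : a ≠ -1) :
    HasWidth (T a + kap) (max |a| 1 + 1) := by
  have key : ∀ lo hi : ℤ, (T a + kap).coeff lo ≠ 0 → (T a + kap).coeff hi ≠ 0 →
      (∀ k, (T a + kap).coeff k ≠ 0 → lo ≤ k ∧ k ≤ hi) → hi - lo = max |a| 1 + 1 →
      HasWidth (T a + kap) (max |a| 1 + 1) := by
    intro lo hi h1 h2 h3 h4
    rw [← h4]
    exact ⟨lo, h1, by rwa [add_sub_cancel], fun k hk => by rw [add_sub_cancel]; exact h3 k hk⟩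
  simp only [coeff_T_add_kap] at key
  rcases lt_trichotomy a 0 with h | rfl | h
  · refine key a 1 ?_ ?_ (fun k hk => ?_) ?_
    · split_ifs <;> omega
    · split_ifs <;> omega
    · split_ifs at hk <;> omega
    · rw [abs_of_neg h, max_eq_left (by omega)]; ring
  · refine key (-1) 1 ?_ ?_ (fun k hk => ?_) ?_
    · norm_num
    · norm_num
    · split_ifs at hk <;> omega
    · norm_num
  · refine key (-1) a ?_ ?_ (fun k hk => ?_) ?_
    · split_ifs <;> omega
    · split_ifs <;> omega
    · split_ifs at hk <;> omega
    · rw [abs_of_pos h, max_eq_left (by omega)]; ring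

theorem hasWidth_prod_T_add_kap (l : List ℤ) (h1 : 1 ∉ l) (h2 : -1 ∉ l) :
    HasWidth (l.map fun a => T a + kap).prod ((l.map fun a => max |a| 1).sum + l.length) := by
  induction l with
  | nil => simpa using hasWidth_one
  | cons a l ih =>
    simp only [List.mem_cons, not_or] at h1 h2
    rw [List.map_cons, List.prod_cons]
    convert (hasWidth_T_add_kap (Ne.symm h1.1) (Ne.symm h2.1)).mul (ih h1.2 h2.2) using 1
    simp only [List.map_cons, List.sum_cons, List.length_cons]
    push_cast
    ring

theorem length_le_sum_max (l : List ℤ) : (l.length : ℤ) ≤ (l.map fun a => max |a| 1).sum ∧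
    ∀ a ∈ l, |a| ≤ (l.map fun a => max |a| 1).sum := by
  induction l with
  | nil => simp
  | cons c l ih =>
    simp only [List.map_cons, List.sum_cons, List.length_cons]
    have := le_max_right |c| 1
    have := le_max_left |c| 1
    refine ⟨by push_cast; omega, fun a ha => ?_⟩
    rcases List.mem_cons.1 ha with rfl | ha
    · omega
    · have := ih.2 a ha
      omega

/-- The span bounds the reduced pretzel diagrams. -/
theorem Reduced.bound {l : List ℤ} (hl : Reduced l) {S : ℕ}
    (h : HasWidth (pretzelPoly l) (S + l.length)) :
    l.length ≤ 8 * S + 100 ∧ ∀ a ∈ l, a.natAbs ≤ 8 * S + 100 := by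
  by_cases h0 : 0 ∈ l
  · obtain ⟨h1, h2⟩ := hl.not_zero h0
    -- A column `0` gives the factor `x⁰ - 1 = 0`, so only a product with known width is left.
    have hz : (l.map fun a => (T a - 1 : LaurentPolynomial ℤ)).prod = 0 :=
      List.prod_eq_zero (List.mem_map.2 ⟨0, h0, by simp⟩)
    rw [pretzelPoly, hz, mul_zero, add_zero] at h
    have h3 := h.unique (hasWidth_prod_T_add_kap l h1 h2)
    obtain ⟨h4, h5⟩ := length_le_sum_max l
    refine ⟨by omega, fun a ha => ?_⟩
    have := h5 a ha
    rw [Int.abs_eq_natAbs] at this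
    omega
  · obtain ⟨k, hk, hw⟩ := exists_hasWidth_reducedPoly h0 hl.not_opposite h
    have hlen := length_eq_parts l h0
    have h3 : 3 ≤ l.length := by
      by_contra! h3
      exact h0 (hl.zero_mem (by omega))
    have hp : ∀ a ∈ posPart l, 2 ≤ a := fun a ha => two_le_of_mem_posPart ha
    have hb : ∀ a ∈ negPart l, 2 ≤ a := fun a ha => two_le_of_mem_negPart ha
    have hB := bound_reducedPoly _ _ k hp hb (by omega) hw
    have := mul_length_le_sum 2 _ hp
    have := mul_length_le_sum 2 _ hb
    refine ⟨by omega, fun a ha => ?_⟩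
    have := natAbs_le_of_mem ha
    omega

/-! ## Finiteness -/

theorem finite_bounded_lists (B : ℕ) :
    {l : List ℤ | l.length ≤ B ∧ ∀ a ∈ l, a.natAbs ≤ B}.Finite := by
  have : {a : ℤ | a.natAbs ≤ B}.Finite :=
    (Set.finite_Icc (-(B : ℤ)) B).subset fun a ha => by
      simp only [Set.mem_ofPred_eq] at ha
      exact ⟨by omega, by omega⟩
  have : Finite {a : ℤ | a.natAbs ≤ B} := this
  refine ((List.finite_length_le {a : ℤ | a.natAbs ≤ B} B).image (List.map Subtype.val)).subset ?_
  rintro l ⟨h1, h2⟩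
  lift l to List {a : ℤ | a.natAbs ≤ B} using h2
  exact ⟨l, by rwa [List.length_map] at h1, rfl⟩

/-- Orientations differ only in the labels of the minima, two choices for each. -/
theorem finite_forget_eq (w : List (Slice Unit)) :
    {v : List (Slice Bool) | forget v = w}.Finite := by
  induction w with
  | nil =>
    refine (Set.finite_singleton []).subset fun v hv => ?_
    simpa [forget] using hv
  | cons s w ih =>
    have hp : {p : Piece Bool | (⟨s.pos, match p with
        | .cup _ => .cup ()
        | .cap => .cap
        | .cross o => .cross o⟩ : Slice Unit) = s}.Finite := by
      refine (Set.toFinite {.cup true, .cup false, .cap, .cross true, .cross false}).subset ?_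
      rintro (b | _ | b) - <;> (try cases b) <;> simp
    refine ((hp.image (Slice.mk s.pos)).image2 List.cons ih).subset ?_
    intro v hv
    cases v with
    | nil => simp [forget] at hv
    | cons t v =>
      simp only [forget, List.map_cons, Set.mem_ofPred_eq, List.cons.injEq] at hv
      obtain ⟨h1, h2⟩ := hv
      have h3 : t.pos = s.pos := by rw [← h1]
      refine ⟨t, ⟨t.piece, ?_, by rw [← h3]⟩, v, h2, rfl⟩
      simp only [Set.mem_ofPred_eq]
      rw [← h3]
      exact h1

end PretzelJones

theorem theorem4p3 (S : ℕ) :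
    {L : PretzelJones.OrientedLink |
      L.IsPretzel ∧
        ∃ V : AddMonoidAlgebra ℤ ℚ, L.HasJones V ∧ PretzelJones.HasSpan V (S : ℚ)}.Finite := by
  open PretzelJones in
  have h1 : {D : OrientedDiagram | ∃ l : List ℤ, (l.length ≤ 8 * S + 100 ∧
      ∀ a ∈ l, a.natAbs ≤ 8 * S + 100) ∧ forget D.1 = pretzel l}.Finite := by
    have := (finite_bounded_lists (8 * S + 100)).biUnion fun l _ => finite_forget_eq (pretzel l)
    refine Set.Finite.of_finite_image (f := Subtype.val) (this.subset ?_)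
      Subtype.val_injective.injOn
    rintro _ ⟨D, ⟨l, hl, h⟩, rfl⟩
    exact Set.mem_biUnion hl h
  refine (h1.image PretzelJones.OrientedDiagram.link).subset ?_
  rintro L ⟨⟨D', a, ha, rfl, hD'⟩, V, ⟨D, hD, rfl⟩, hV⟩
  -- The diagram `D` computing `V` need not be the pretzel diagram `D'`; invariance of the bracket
  -- up to units connects it with the reduced diagram `E`.
  obtain ⟨l, hl, hi⟩ := PretzelJones.exists_reduced a ha
  obtain ⟨E, hE, hEL⟩ := hi.link D' hD'
  refine ⟨E, ⟨l, hl.bound ?_, hE⟩, hEL⟩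
  exact PretzelJones.hasWidth_pretzelPoly hl.ne_nil hE (hD.trans hEL.symm) hV
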